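/- Let $k$ be a field of characteristic $0$ with an automorphism $\sigma$ and a derivation $\delta$ (written $x\mapsto x'$) such that $\sigma\delta=\delta\sigma$, and suppose that the field $C_k=\{x\in k:\sigma(x)=x\}$ is relatively algebraically closed in $k$. Let $A\in GL_m(k)$, let $X$ be an $m\times m$ matrix of differential indeterminates over $k$, and let $L=k\langle X\rangle$ be the field of differential rational functions in the entries of $X$. Extend $\sigma$ to $L$ by $\sigma(X)=AX$ and $\sigma\delta=\delta\sigma$. Let $C_L=\{x\in L:\sigma(x)=x\}$, a differential subfield of $L$, and let $kC_L$ be the subfield of $L$ generated by $k$ and $C_L$. Put $$R=kC_L\{X,\det(X)^{-1}\}=\bigcup_{n\ge 0}R_n,\qquad R_n=kC_L[X,\det(X)^{-1},X',\dots,X^{(n)}].$$ For a matrix $M$ over a differential ring let $M_{[n]}$ be the block lower-triangular matrix whose block in position $(i,j)$, $0\le j\le i\le n$, is $\binom ij M^{(i-j)}$. Then $X_{[n]}$ is a fundamental matrix of the prolonged system $\sigma(Y)=A_{[n]}Y$, that is, of $\sigma(X^{(j)})=\sum_{i=0}^j\binom ji A^{(i)}X^{(j-i)}$, $0\le j\le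 n$. For a differential field extension $C$ of $C_L$, on which $\sigma$ acts trivially, let $\mathbb H(C)$ be the group of all $B\in GL_m(C)$ for which there is an automorphism $g$ of $R\otimes_{C_L}C$ over $kC_L\otimes_{C_L}C$ that commutes with $\sigma$ and $\delta$ and satisfies $g(X)=XB$. Let $\mathbb H_n(C)$ be the group of all $\mathcal B\in GL_{(n+1)m}(C)$ for which there is an automorphism $g$ of $R_n\otimes_{C_L}C$ over $kC_L\otimes_{C_L}C$ that commutes with $\sigma$ and satisfies $g(X_{[n]})=X_{[n]}\mathcal B$. Then the following hold. 1. The formulas $g(X)=XB_g$ and $g(X_{[n]})=X_{[n]}\mathcal B_g$ define isomorphisms of groups $g\mapsto B_g$ and $g\mapsto\mathcal B_g$, $$\mathrm{Aut}_{\sigma\delta}(kC_L\langle X\rangle/kC_L)\cong\mathbb H(C_L),\qquad \mathrm{Aut}_\sigma(R_n/kC_L)\cong\mathbb H_n(C_L)\quad(n\ge 0).$$ So $\mathbb H$ and $\mathbb H_n$ are the Galois groups of the system $\sigma(X)=AX$ and of the prolonged system. 2. For every differential field extension $C$ of $C_L$ (in particular for $C=C_L$) and every $B\in GL_m(C)$,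 $$B\in\mathbb H(C)\iff B_{[n]}\in\mathbb H_n(C)\text{ for all }n\in\mathbb N.$$ 3. There is an $n_0\in\mathbb N$ such that for every differential field extension $C$ of $C_L$ and every $B\in GL_m(C)$, $$B\in\mathbb H(C)\iff B_{[n]}\in\mathbb H_n(C)\text{ for all }n\in\{0,\dots,n_0\}.$$ 4. For every $n$ and every differential field extension $C$ of $C_L$, the map $i_n:B\mapsto B_{[n]}$ is an injective group homomorphism $\mathbb H(C)\to\mathbb H_n(C)$. The embedding $i_n:\mathbb H\to\mathbb H_n$ has Zariski-dense image: if $C$ is differentially closed, then every polynomial over $C$ in the matrix entries that vanishes on $i_n(\mathbb H(C))$ vanishes on $\mathbb H_n(C)$. -/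

import Mathlib

open scoped Differential TensorProduct Matrix

universe u

noncomputable section

namespace DiffGalois

/-! ### Derivations from ring homomorphisms to dual numbers -/

/-- A ring homomorphism `a ↦ a + ε d(a)` into the dual numbers gives the derivation `d`. -/
def derivOfDual {R : Type*} [CommRing R] (f : R →+* TrivSqZeroExt R R)
    (hf : ∀ a, (f a).fst = a) : Derivation ℤ R R :=
  Derivation.mk' (((TrivSqZeroExt.sndHom R R).toAddMonoidHom.comp f.toAddMonoidHom).toIntLinearMap)
    (by intro a b; simp [hf, mul_comm])

lemma derivOfDual_apply {R : Type*} [CommRing R] (f : R →+* TrivSqZeroExt R R)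
    (hf : ∀ a, (f a).fst = a) (a : R) : derivOfDual f hf a = (f a).snd := rfl

/-- The ring homomorphism `a ↦ φ(a) + ε φ(a′)` into the dual numbers. -/
def dualOfDeriv {R S : Type*} [CommRing R] [CommRing S] [Differential R] (φ : R →+* S) :
    R →+* TrivSqZeroExt S S where
  toFun a := TrivSqZeroExt.inl (φ a) + TrivSqZeroExt.inr (φ a′)
  map_one' := by ext <;> simp
  map_zero' := by ext <;> simp
  map_add' a b := by ext <;> simp
  map_mul' a b := by ext <;> simp [mul_comm]

lemma snd_dualOfDeriv {R S : Type*} [CommRing R] [CommRing S] [Differential R] (φ : R →+* S)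
    (a : R) : (dualOfDeriv φ a).snd = φ a′ := by simp [dualOfDeriv]

/-- The subfield of elements fixed by the automorphism `σ`. -/
def fixedSubfield {K : Type*} [Field K] (σ : K ≃+* K) : Subfield K :=
  (σ : K →+* K).eqLocusField (RingHom.id K)

/-! ### Differential polynomials in an `m × m` matrix of differential indeterminates -/

/-- The ring `k{X}` of differential polynomials in the entries of an `m × m` matrix `X` of
differential indeterminates: the variable `(j, a, b)` is the `(a, b)` entry of `X^{(j)}`. -/
abbrev DiffPoly (m : ℕ) (k : Type u) [Field k] : Type u :=
  MvPolynomial (ℕ × Fin m × Fin m) k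

/-- The matrix `σ⁻¹(A⁻¹)`, which defines the inverse of the automorphism `X ↦ A X`. -/
def invMatrix {m : ℕ} {k : Type u} [Field k] (σ : k ≃+* k)
    (A : GL (Fin m) k) : Matrix (Fin m) (Fin m) k :=
  ((A⁻¹ : GL (Fin m) k) : Matrix (Fin m) (Fin m) k).map (σ.symm : k →+* k)

lemma invMatrix_mul {m : ℕ} {k : Type u} [Field k] (σ : k ≃+* k)
    (A : GL (Fin m) k) :
    (invMatrix σ A).map (σ : k →+* k) * (A : Matrix (Fin m) (Fin m) k) = 1 := by
  have h : (invMatrix σ A).map (σ : k →+* k) =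
      ((A⁻¹ : GL (Fin m) k) : Matrix (Fin m) (Fin m) k) := by
    ext i j
    exact σ.apply_symm_apply _
  rw [h]
  exact A.inv_mul

lemma mul_invMatrix {m : ℕ} {k : Type u} [Field k] (σ : k ≃+* k)
    (A : GL (Fin m) k) :
    (A : Matrix (Fin m) (Fin m) k).map (σ.symm : k →+* k) * invMatrix σ A = 1 := by
  rw [invMatrix, ← Matrix.map_mul, A.mul_inv]
  exact Matrix.map_one _ (map_zero _) (map_one _)

section Poly

variable {m : ℕ} {k : Type u} [Field k] [Differential k]

/-- The homomorphism `p ↦ p + ε p′`, with `X^{(j)} ↦ X^{(j)} + ε X^{(j+1)}`. -/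
def DiffPoly.dual : DiffPoly m k →+* TrivSqZeroExt (DiffPoly m k) (DiffPoly m k) :=
  MvPolynomial.eval₂Hom (dualOfDeriv MvPolynomial.C)
    fun p => TrivSqZeroExt.inl (MvPolynomial.X p) +
      TrivSqZeroExt.inr (MvPolynomial.X (p.1 + 1, p.2))

lemma DiffPoly.fst_dual (p : DiffPoly m k) : (DiffPoly.dual p).fst = p := by
  have : ((TrivSqZeroExt.fstHom ℤ (DiffPoly m k) (DiffPoly m k)).toRingHom.comp
      DiffPoly.dual) = RingHom.id (DiffPoly m k) := by
    apply MvPolynomial.ringHom_ext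
    · intro r; simp [DiffPoly.dual, dualOfDeriv]
    · intro r; simp [DiffPoly.dual]
  exact congrArg (fun f => f p) this

/-- The derivation of `k{X}` that extends the one of `k` and sends `X^{(j)}` to `X^{(j+1)}`. -/
instance : Differential (DiffPoly m k) := ⟨derivOfDual DiffPoly.dual DiffPoly.fst_dual⟩

lemma DiffPoly.deriv_C (c : k) : (MvPolynomial.C c : DiffPoly m k)′ = MvPolynomial.C c′ := by
  change (DiffPoly.dual _).snd = _
  simp [DiffPoly.dual, dualOfDeriv]

lemma DiffPoly.deriv_X (p : ℕ × Fin m × Fin m) :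
    (MvPolynomial.X p : DiffPoly m k)′ = MvPolynomial.X (p.1 + 1, p.2) := by
  change (DiffPoly.dual _).snd = _
  simp [DiffPoly.dual]

/-- The matrix `X^{(j)}` over `k{X}`. -/
def DiffPoly.X (j : ℕ) : Matrix (Fin m) (Fin m) (DiffPoly m k) :=
  Matrix.of fun a b => MvPolynomial.X (j, a, b)

/-- The endomorphism of `k{X}` that is `s` on `k` and is given by `X^{(j)} ↦ (M X)^{(j)}`. -/
def DiffPoly.shift (s : k →+* k) (M : Matrix (Fin m) (Fin m) k) : DiffPoly m k →+* DiffPoly m k :=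
  MvPolynomial.eval₂Hom (MvPolynomial.C.comp s) fun p =>
    (⇑(Differential.deriv (R := DiffPoly m k)))^[p.1]
      ((M.map MvPolynomial.C * DiffPoly.X 0 : Matrix _ _ (DiffPoly m k)) p.2.1 p.2.2)

lemma ringHom_dual_ext {R S : Type*} [CommRing R] [CommRing S] [Differential R] [Differential S]
    {f : R →+* S} (h : ((dualOfDeriv f : R →+* _)) =
      (dualOfDeriv (RingHom.id S)).comp f) (a : R) : f a′ = (f a)′ := by
  have := congrArg (fun g => (g a).snd) h
  simpa [dualOfDeriv] using this

lemma DiffPoly.shift_deriv (s : k →+* k) (hs : ∀ x, s x′ = (s x)′)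
    (M : Matrix (Fin m) (Fin m) k) (p : DiffPoly m k) :
    DiffPoly.shift s M p′ = (DiffPoly.shift s M p)′ := by
  apply ringHom_dual_ext
  apply MvPolynomial.ringHom_ext
  · intro r
    simp [dualOfDeriv, DiffPoly.shift, DiffPoly.deriv_C, hs]
  · intro p
    simp [dualOfDeriv, DiffPoly.shift, DiffPoly.deriv_X, Function.iterate_succ_apply']

lemma DiffPoly.X_iterate (j : ℕ) (a b : Fin m) :
    (MvPolynomial.X (j, a, b) : DiffPoly m k) =
      (⇑(Differential.deriv (R := DiffPoly m k)))^[j] (MvPolynomial.X (0, a, b)) := by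
  induction j with
  | zero => rfl
  | succ j ih => rw [Function.iterate_succ_apply', ← ih, DiffPoly.deriv_X]

lemma DiffPoly.shift_comp (s t : k →+* k) (hs : ∀ x, s x′ = (s x)′)
    (M N : Matrix (Fin m) (Fin m) k) (hst : ∀ x, s (t x) = x) (hMN : N.map s * M = 1)
    (p : DiffPoly m k) :
    DiffPoly.shift s M (DiffPoly.shift t N p) = p := by
  have hit : ∀ j (q : DiffPoly m k), DiffPoly.shift s M
      ((⇑(Differential.deriv (R := DiffPoly m k)))^[j] q) =
      (⇑(Differential.deriv (R := DiffPoly m k)))^[j] (DiffPoly.shift s M q) := by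
    intro j
    induction j with
    | zero => intro q; rfl
    | succ j ih => intro q; rw [Function.iterate_succ_apply', Function.iterate_succ_apply',
        DiffPoly.shift_deriv s hs, ih]
  have : (DiffPoly.shift s M).comp (DiffPoly.shift t N) = RingHom.id (DiffPoly m k) := by
    apply MvPolynomial.ringHom_ext
    · intro r; simp [DiffPoly.shift, hst]
    · rintro ⟨j, a, b⟩
      have h1 : DiffPoly.shift t N (MvPolynomial.X (j, a, b)) =
        (⇑(Differential.deriv (R := DiffPoly m k)))^[j]
          ((N.map MvPolynomial.C * DiffPoly.X 0 : Matrix _ _ (DiffPoly m k)) a b) := by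
        simp [DiffPoly.shift]
      rw [RingHom.comp_apply, h1, hit, RingHom.id_apply, DiffPoly.X_iterate j a b]
      have h2 : (DiffPoly.X 0 : Matrix _ _ (DiffPoly m k)).map (DiffPoly.shift s M) =
          M.map MvPolynomial.C * DiffPoly.X 0 := by
        ext a b
        simp [DiffPoly.shift, DiffPoly.X]
      have h3 : (N.map MvPolynomial.C : Matrix _ _ (DiffPoly m k)).map (DiffPoly.shift s M) =
          (N.map s).map MvPolynomial.C := by
        ext a b
        simp [DiffPoly.shift]
      have h4 : (N.map MvPolynomial.C * DiffPoly.X 0 : Matrix _ _ (DiffPoly m k)).map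
          (DiffPoly.shift s M) = DiffPoly.X 0 := by
        rw [Matrix.map_mul, h2, h3, ← mul_assoc, ← Matrix.map_mul, hMN,
          Matrix.map_one _ MvPolynomial.C_0 MvPolynomial.C_1, one_mul]
      exact congrArg _ (congrFun (congrFun h4 a) b)
  exact congrArg (fun f => f p) this

lemma symm_deriv (σ : k ≃+* k) (hσ : ∀ x, σ x′ = (σ x)′) (x : k) :
    (σ.symm : k →+* k) x′ = ((σ.symm : k →+* k) x)′ :=
  σ.injective (by simp [hσ])

/-- The automorphism of `k{X}` that extends `σ`, commutes with the derivation and satisfies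
`σ(X) = A X`. -/
def DiffPoly.sigma (σ : k ≃+* k) (hσ : ∀ x, σ x′ = (σ x)′) (A : GL (Fin m) k) :
    DiffPoly m k ≃+* DiffPoly m k :=
  RingEquiv.ofRingHom (DiffPoly.shift (σ : k →+* k) (A : Matrix (Fin m) (Fin m) k))
    (DiffPoly.shift (σ.symm : k →+* k) (invMatrix σ A))
    (RingHom.ext fun p => DiffPoly.shift_comp (σ : k →+* k) (σ.symm : k →+* k) hσ _ _
      σ.apply_symm_apply (invMatrix_mul σ A) p)
    (RingHom.ext fun p => DiffPoly.shift_comp (σ.symm : k →+* k) (σ : k →+* k)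
      (symm_deriv σ hσ) _ _ σ.symm_apply_apply (mul_invMatrix σ A) p)

lemma DiffPoly.sigma_deriv (σ : k ≃+* k) (hσ : ∀ x, σ x′ = (σ x)′) (A : GL (Fin m) k)
    (p : DiffPoly m k) : DiffPoly.sigma σ hσ A p′ = (DiffPoly.sigma σ hσ A p)′ :=
  DiffPoly.shift_deriv (σ : k →+* k) hσ _ p

end Poly

/-! ### The `σδ`-field `L = k⟨X⟩` -/

/-- The field `L = k⟨X⟩` of differential rational functions in the entries of `X`. -/
def GenField (m : ℕ) (k : Type u) [Field k] : Type u := FractionRing (DiffPoly m k)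

instance (m : ℕ) (k : Type u) [Field k] : Field (GenField m k) :=
  inferInstanceAs (Field (FractionRing (DiffPoly m k)))

instance (m : ℕ) (k : Type u) [Field k] : Algebra (DiffPoly m k) (GenField m k) :=
  inferInstanceAs (Algebra (DiffPoly m k) (FractionRing (DiffPoly m k)))

instance (m : ℕ) (k : Type u) [Field k] : IsFractionRing (DiffPoly m k) (GenField m k) :=
  inferInstanceAs (IsFractionRing (DiffPoly m k) (FractionRing (DiffPoly m k)))

instance (m : ℕ) (k : Type u) [Field k] : Algebra k (GenField m k) :=
  ((algebraMap (DiffPoly m k) (GenField m k)).comp MvPolynomial.C).toAlgebra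

instance (m : ℕ) (k : Type u) [Field k] : IsScalarTower k (DiffPoly m k) (GenField m k) :=
  IsScalarTower.of_algebraMap_eq fun _ => rfl

section GenField

variable {m : ℕ} {k : Type u} [Field k] [Differential k]

/-- The homomorphism `x ↦ x + ε x′` on `L`. -/
def GenField.dual : GenField m k →+* TrivSqZeroExt (GenField m k) (GenField m k) :=
  IsLocalization.lift (M := nonZeroDivisors (DiffPoly m k))
    (g := dualOfDeriv (algebraMap (DiffPoly m k) (GenField m k))) (by
      intro y
      rw [TrivSqZeroExt.isUnit_iff_isUnit_fst]
      simp [dualOfDeriv])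

lemma GenField.fst_dual (x : GenField m k) : (GenField.dual x).fst = x := by
  have : ((TrivSqZeroExt.fstHom ℤ (GenField m k) (GenField m k)).toRingHom.comp
      GenField.dual) = RingHom.id (GenField m k) := by
    apply IsLocalization.ringHom_ext (nonZeroDivisors (DiffPoly m k))
    ext p <;> simp [GenField.dual, dualOfDeriv]
  exact congrArg (fun f => f x) this

/-- The derivation of `L = k⟨X⟩` that extends the one of `k{X}`. -/
instance : Differential (GenField m k) := ⟨derivOfDual GenField.dual GenField.fst_dual⟩

lemma GenField.deriv_algebraMap (p : DiffPoly m k) :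
    (algebraMap (DiffPoly m k) (GenField m k) p)′ =
      algebraMap (DiffPoly m k) (GenField m k) p′ := by
  have h : GenField.dual (algebraMap (DiffPoly m k) (GenField m k) p) =
      dualOfDeriv (algebraMap (DiffPoly m k) (GenField m k)) p := IsLocalization.lift_eq _ p
  change (GenField.dual _).snd = _
  rw [h, snd_dualOfDeriv]

instance : DifferentialAlgebra k (GenField m k) where
  deriv_algebraMap c := by
    rw [IsScalarTower.algebraMap_apply k (DiffPoly m k) (GenField m k),
      IsScalarTower.algebraMap_apply k (DiffPoly m k) (GenField m k),
      GenField.deriv_algebraMap, MvPolynomial.algebraMap_eq, DiffPoly.deriv_C]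

/-- The matrix `X^{(j)}` over `L`. -/
def GenField.X (m : ℕ) (k : Type u) [Field k] (j : ℕ) : Matrix (Fin m) (Fin m) (GenField m k) :=
  Matrix.of fun a b => algebraMap (DiffPoly m k) (GenField m k) (MvPolynomial.X (j, a, b))

lemma GenField.deriv_X (j : ℕ) (a b : Fin m) :
    (GenField.X m k j a b)′ = GenField.X m k (j + 1) a b := by
  simp [GenField.X, GenField.deriv_algebraMap, DiffPoly.deriv_X]

variable (σ : k ≃+* k) (hσ : ∀ x, σ x′ = (σ x)′) (A : GL (Fin m) k)

/-- The automorphism `σ` of `L`: it extends the one of `k`, commutes with the derivation and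
satisfies `σ(X) = A X`. -/
def sigmaL : GenField m k ≃+* GenField m k :=
  IsFractionRing.ringEquivOfRingEquiv (DiffPoly.sigma σ hσ A)

lemma sigmaL_algebraMap (p : DiffPoly m k) :
    sigmaL σ hσ A (algebraMap _ _ p) = algebraMap _ _ (DiffPoly.sigma σ hσ A p) := by
  simp [sigmaL]

lemma sigmaL_deriv (x : GenField m k) : sigmaL σ hσ A x′ = (sigmaL σ hσ A x)′ := by
  refine ringHom_dual_ext (f := (sigmaL σ hσ A : GenField m k →+* GenField m k)) ?_ x
  apply IsLocalization.ringHom_ext (nonZeroDivisors (DiffPoly m k))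
  apply RingHom.ext
  intro p
  simp [dualOfDeriv, sigmaL_algebraMap, GenField.deriv_algebraMap, DiffPoly.sigma_deriv]

lemma sigmaL_base (c : k) : sigmaL σ hσ A (algebraMap k _ c) = algebraMap k _ (σ c) := by
  rw [IsScalarTower.algebraMap_apply k (DiffPoly m k) (GenField m k),
    IsScalarTower.algebraMap_apply k (DiffPoly m k) (GenField m k), sigmaL_algebraMap]
  simp [DiffPoly.sigma, DiffPoly.shift]

lemma sigmaL_X : (GenField.X m k 0).map (sigmaL σ hσ A) =
    (A : Matrix (Fin m) (Fin m) k).map (algebraMap k (GenField m k)) * GenField.X m k 0 := by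
  ext a b
  have : DiffPoly.sigma σ hσ A (MvPolynomial.X (0, a, b)) =
      ∑ c, MvPolynomial.C ((A : Matrix (Fin m) (Fin m) k) a c) * MvPolynomial.X (0, c, b) := by
    simp [DiffPoly.sigma, DiffPoly.shift, Matrix.mul_apply, DiffPoly.X]
  simp only [Matrix.map_apply, GenField.X, Matrix.of_apply, sigmaL_algebraMap, this, map_sum,
    map_mul, Matrix.mul_apply]
  rfl

/-! ### Constants, the field `k C_L` and the rings generated by the solution -/

/-- The field `C_L` of `σ`-constants of `L`. -/
def constL : Subfield (GenField m k) := fixedSubfield (sigmaL σ hσ A)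

lemma mem_constL {x : GenField m k} : x ∈ constL σ hσ A ↔ sigmaL σ hσ A x = x := Iff.rfl

lemma deriv_mem_constL {x : GenField m k} (hx : x ∈ constL σ hσ A) : x′ ∈ constL σ hσ A := by
  rw [mem_constL] at *
  rw [sigmaL_deriv, hx]

/-- The derivation of `C_L`, restricted from `L`. -/
instance : Differential (constL σ hσ A) where
  deriv := Derivation.mk'
    (AddMonoidHom.mk' (fun x => ⟨(x : GenField m k)′, deriv_mem_constL σ hσ A x.2⟩)
      (fun x y => by ext; simp)).toIntLinearMap
    (fun x y => by ext; simp)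

instance : DifferentialAlgebra (constL σ hσ A) (GenField m k) where
  deriv_algebraMap _ := rfl

/-- The field `k C_L`, the subfield of `L` generated by `k` and `C_L`. -/
def kConstL : IntermediateField (constL σ hσ A) (GenField m k) :=
  IntermediateField.adjoin _ (Set.range (algebraMap k (GenField m k)))

lemma sigmaL_mem_kConstL {x : GenField m k} (hx : x ∈ kConstL σ hσ A) :
    sigmaL σ hσ A x ∈ kConstL σ hσ A := by
  induction hx using IntermediateField.adjoin_induction with
  | mem x hx =>
    obtain ⟨c, rfl⟩ := hx
    rw [sigmaL_base]
    exact IntermediateField.subset_adjoin _ _ ⟨_, rfl⟩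
  | algebraMap x =>
    have : sigmaL σ hσ A (x : GenField m k) = x := x.2
    change sigmaL σ hσ A (x : GenField m k) ∈ _
    rw [this]
    exact (kConstL σ hσ A).algebraMap_mem x
  | add x y _ _ hx hy => rw [map_add]; exact add_mem hx hy
  | inv x _ hx => rw [map_inv₀]; exact inv_mem hx
  | mul x y _ _ hx hy => rw [map_mul]; exact mul_mem hx hy

lemma deriv_mem_kConstL {x : GenField m k} (hx : x ∈ kConstL σ hσ A) :
    x′ ∈ kConstL σ hσ A := by
  induction hx using IntermediateField.adjoin_induction with
  | mem x hx =>
    obtain ⟨c, rfl⟩ := hx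
    rw [deriv_algebraMap]
    exact IntermediateField.subset_adjoin _ _ ⟨_, rfl⟩
  | algebraMap x =>
    rw [deriv_algebraMap]
    exact (kConstL σ hσ A).algebraMap_mem _
  | add x y _ _ hx hy => rw [map_add]; exact add_mem hx hy
  | inv x h hx =>
    rw [Derivation.leibniz_inv]
    exact mul_mem (neg_mem (pow_mem (inv_mem h) 2)) hx
  | mul x y h h' hx hy =>
    rw [Derivation.leibniz]
    exact add_mem (mul_mem h hy) (mul_mem h' hx)

/-- The `k C_L`-subalgebra `k C_L[X, det(X)⁻¹, X′, …, X^{(N)}]` of `L`. For `N = n` finite it is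
the ring `F_n C_L`, and for `N = ⊤` it is the ring `R = k C_L{X, det(X)⁻¹}`. -/
def solRing (N : ℕ∞) : Subalgebra (kConstL σ hσ A) (GenField m k) :=
  Algebra.adjoin _ ({x | ∃ j : ℕ, (j : ℕ∞) ≤ N ∧ ∃ a b, x = GenField.X m k j a b} ∪
    {(GenField.X m k 0).det⁻¹})

variable {σ hσ A}

lemma X_mem_solRing {N : ℕ∞} {j : ℕ} (hj : (j : ℕ∞) ≤ N) (a b : Fin m) :
    GenField.X m k j a b ∈ solRing σ hσ A N :=
  Algebra.subset_adjoin (Or.inl ⟨j, hj, a, b, rfl⟩)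

lemma base_mem_solRing (N : ℕ∞) (c : k) :
    algebraMap k (GenField m k) c ∈ solRing σ hσ A N :=
  (solRing σ hσ A N).algebraMap_mem
    ⟨_, IntermediateField.subset_adjoin (constL σ hσ A) _ ⟨c, rfl⟩⟩

lemma iterate_mem_solRing {N : ℕ∞} (j : ℕ) : ∀ (i : ℕ) (_ : ((i + j : ℕ) : ℕ∞) ≤ N) (c : k)
    (a b : Fin m), (⇑(Differential.deriv (R := GenField m k)))^[j]
      (algebraMap k _ c * GenField.X m k i a b) ∈ solRing σ hσ A N := by
  induction j with
  | zero => intro i hi c a b; exact mul_mem (base_mem_solRing N c) (X_mem_solRing hi a b)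
  | succ j ih =>
    intro i hi c a b
    rw [Function.iterate_succ_apply, Derivation.leibniz, iterate_map_add, GenField.deriv_X,
      smul_eq_mul, smul_eq_mul, deriv_algebraMap, mul_comm (GenField.X m k i a b)]
    refine add_mem (ih (i + 1) ?_ c a b) (ih i ?_ _ a b)
    · rwa [add_assoc, add_comm 1 j]
    · exact le_trans (by exact_mod_cast by omega) hi

lemma iterate_deriv_sum {R ι : Type*} [CommRing R] [Differential R] (j : ℕ) (s : Finset ι)
    (f : ι → R) : (⇑(Differential.deriv (R := R)))^[j] (∑ i ∈ s, f i) =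
      ∑ i ∈ s, (⇑(Differential.deriv (R := R)))^[j] (f i) := by
  induction j with
  | zero => rfl
  | succ j ih => simp only [Function.iterate_succ_apply', ih, map_sum]

lemma X_iterate (j : ℕ) (a b : Fin m) : GenField.X m k j a b =
    (⇑(Differential.deriv (R := GenField m k)))^[j] (GenField.X m k 0 a b) := by
  induction j with
  | zero => rfl
  | succ j ih => rw [Function.iterate_succ_apply', ← ih, GenField.deriv_X]

lemma sigmaL_iterate (j : ℕ) (x : GenField m k) :
    sigmaL σ hσ A ((⇑(Differential.deriv (R := GenField m k)))^[j] x) =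
    (⇑(Differential.deriv (R := GenField m k)))^[j] (sigmaL σ hσ A x) := by
  induction j with
  | zero => rfl
  | succ j ih => rw [Function.iterate_succ_apply', Function.iterate_succ_apply', sigmaL_deriv, ih]

lemma sigmaL_mem_solRing {N : ℕ∞} {x : GenField m k} (hx : x ∈ solRing σ hσ A N) :
    sigmaL σ hσ A x ∈ solRing σ hσ A N := by
  induction hx using Algebra.adjoin_induction with
  | mem x hx =>
    rcases hx with ⟨j, hj, a, b, rfl⟩ | rfl
    · have h : sigmaL σ hσ A (GenField.X m k 0 a b) = _ :=
        congrFun (congrFun (sigmaL_X σ hσ A) a) b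
      rw [X_iterate, sigmaL_iterate, h, Matrix.mul_apply]
      rw [iterate_deriv_sum]
      exact sum_mem fun c _ => iterate_mem_solRing j 0 (by simpa using hj) _ c b
    · rw [map_inv₀, RingEquiv.map_det, RingEquiv.mapMatrix_apply, sigmaL_X, Matrix.det_mul,
        mul_inv]
      refine mul_mem ?_ (Algebra.subset_adjoin (Or.inr rfl))
      rw [← RingHom.mapMatrix_apply, ← RingHom.map_det, ← map_inv₀]
      exact base_mem_solRing N _
  | algebraMap x =>
    exact (solRing σ hσ A N).algebraMap_mem ⟨_, sigmaL_mem_kConstL σ hσ A x.2⟩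
  | add x y _ _ hx hy => rw [map_add]; exact add_mem hx hy
  | mul x y _ _ hx hy => rw [map_mul]; exact mul_mem hx hy

lemma deriv_mem_solRing {x : GenField m k} (hx : x ∈ solRing σ hσ A ⊤) :
    x′ ∈ solRing σ hσ A ⊤ := by
  have key : ∀ y ∈ Algebra.adjoin (kConstL σ hσ A)
      {x : GenField m k | ∃ (j : ℕ) (a b : Fin m), x = GenField.X m k j a b},
      y ∈ solRing σ hσ A ⊤ ∧ y′ ∈ solRing σ hσ A ⊤ := by
    intro y hy
    induction hy using Algebra.adjoin_induction with
    | mem x hx =>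
      obtain ⟨j, a, b, rfl⟩ := hx
      rw [GenField.deriv_X]
      exact ⟨X_mem_solRing le_top a b, X_mem_solRing le_top a b⟩
    | algebraMap x =>
      exact ⟨(solRing σ hσ A ⊤).algebraMap_mem x,
        (solRing σ hσ A ⊤).algebraMap_mem ⟨_, deriv_mem_kConstL σ hσ A x.2⟩⟩
    | add x y _ _ hx hy => rw [map_add]; exact ⟨add_mem hx.1 hy.1, add_mem hx.2 hy.2⟩
    | mul x y _ _ hx hy =>
      rw [Derivation.leibniz]
      exact ⟨mul_mem hx.1 hy.1, add_mem (mul_mem hx.1 hy.2) (mul_mem hy.1 hx.2)⟩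
  have hdet : (GenField.X m k 0).det ∈ Algebra.adjoin (kConstL σ hσ A)
      {x : GenField m k | ∃ (j : ℕ) (a b : Fin m), x = GenField.X m k j a b} := by
    have hX : ∀ a b : Fin m, GenField.X m k 0 a b ∈ Algebra.adjoin (kConstL σ hσ A)
        {x : GenField m k | ∃ (j : ℕ) (a b : Fin m), x = GenField.X m k j a b} :=
      fun a b => Algebra.subset_adjoin ⟨0, a, b, rfl⟩
    rw [Matrix.det_apply]
    exact Subalgebra.sum_mem _ fun τ _ => Subalgebra.zsmul_mem _ (Subalgebra.prod_mem _
      fun i _ => hX _ _) _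
  have hd : (GenField.X m k 0).det⁻¹ ∈ solRing σ hσ A ⊤ := Algebra.subset_adjoin (Or.inr rfl)
  induction hx using Algebra.adjoin_induction with
  | mem x hx =>
    rcases hx with ⟨j, hj, a, b, rfl⟩ | rfl
    · rw [GenField.deriv_X]
      exact X_mem_solRing le_top a b
    · rw [Derivation.leibniz_inv]
      exact mul_mem (neg_mem (pow_mem hd 2)) (key _ hdet).2
  | algebraMap x =>
    exact (solRing σ hσ A ⊤).algebraMap_mem ⟨_, deriv_mem_kConstL σ hσ A x.2⟩
  | add x y _ _ hx hy => rw [map_add]; exact add_mem hx hy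
  | mul x y h h' hx hy =>
    rw [Derivation.leibniz]
    exact add_mem (mul_mem h hy) (mul_mem h' hx)


variable (σ hσ A)

instance (N : ℕ∞) : Algebra (constL σ hσ A) (solRing σ hσ A N) := Subalgebra.algebra' _

/-- The restriction of `σ` to `F_N C_L`, a `C_L`-algebra endomorphism. -/
def sigmaRing (N : ℕ∞) : solRing σ hσ A N →ₐ[constL σ hσ A] solRing σ hσ A N where
  toFun x := ⟨sigmaL σ hσ A x, sigmaL_mem_solRing x.2⟩
  map_one' := Subtype.ext (map_one _)
  map_zero' := Subtype.ext (map_zero _)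
  map_add' _ _ := Subtype.ext (map_add _ _ _)
  map_mul' _ _ := Subtype.ext (map_mul _ _ _)
  commutes' c := Subtype.ext c.2

/-- The restriction of the derivation to `R`. -/
instance : Differential (solRing σ hσ A ⊤) where
  deriv := Derivation.mk'
    (AddMonoidHom.mk' (fun x => ⟨(x : GenField m k)′, deriv_mem_solRing x.2⟩)
      (fun x y => by ext; simp)).toIntLinearMap
    (fun x y => by ext; simp)

instance : DifferentialAlgebra (constL σ hσ A) (solRing σ hσ A ⊤) where
  deriv_algebraMap _ := rfl

/-- The matrix `X^{(j)}` over `F_N C_L`, for `j ≤ N`. -/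
def solX (N : ℕ∞) (j : ℕ) (hj : (j : ℕ∞) ≤ N) : Matrix (Fin m) (Fin m) (solRing σ hσ A N) :=
  Matrix.of fun a b => ⟨GenField.X m k j a b, X_mem_solRing hj a b⟩

/-- The block lower-triangular fundamental matrix of the prolonged system
`σ(X^{(j)}) = ∑ i, (j choose i) A^{(i)} X^{(j-i)}`, `j = 0, …, n`; its block in position `(i, j)`
is `(i choose j) X^{(i-j)}` for `j ≤ i`, and zero for `i < j`. -/
def fundMatrix (n : ℕ) :
    Matrix (Fin (n + 1) × Fin m) (Fin (n + 1) × Fin m) (solRing σ hσ A (n : ℕ∞)) :=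
  Matrix.of fun p q => ((p.1 : ℕ).choose q.1 : solRing σ hσ A (n : ℕ∞)) *
    solX σ hσ A n (p.1 - q.1) (by exact_mod_cast (by omega : (p.1 : ℕ) - q.1 ≤ n)) p.2 q.2

end GenField

/-! ### Prolongation of matrices over a differential ring -/

section Prolong

variable {m : ℕ} {S : Type*} [CommRing S] [Differential S]

/-- The block lower-triangular matrix built from `(B, B′, …, B^{(n)})`: its block in position
`(i, j)` is `(i choose j) B^{(i-j)}` for `j ≤ i`, and zero for `i < j`. -/
def prolongMatrix (n : ℕ) (B : Matrix (Fin m) (Fin m) S) :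
    Matrix (Fin (n + 1) × Fin m) (Fin (n + 1) × Fin m) S :=
  Matrix.of fun p q => ((p.1 : ℕ).choose q.1 : S) *
    (⇑(Differential.deriv (R := S)))^[p.1 - q.1] (B p.2 q.2)

lemma iterate_deriv_mul (n : ℕ) (x y : S) : (⇑(Differential.deriv (R := S)))^[n] (x * y) =
    ∑ ij ∈ Finset.HasAntidiagonal.antidiagonal n, (n.choose ij.1 : S) *
      ((⇑(Differential.deriv (R := S)))^[ij.1] x * (⇑(Differential.deriv (R := S)))^[ij.2] y) := by
  induction n with
  | zero => simp
  | succ n ih =>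
    rw [Function.iterate_succ_apply', ih, map_sum,
      Finset.sum_antidiagonal_choose_succ_mul (fun i j =>
        (⇑(Differential.deriv (R := S)))^[i] x * (⇑(Differential.deriv (R := S)))^[j] y) n,
      ← Finset.sum_add_distrib]
    refine Finset.sum_congr rfl fun ij hij => ?_
    have h : n.choose ij.2 = n.choose ij.1 := by
      rw [← Finset.HasAntidiagonal.mem_antidiagonal.1 hij]
      exact (Nat.choose_symm_add).symm
    simp only [Derivation.leibniz, smul_eq_mul, Derivation.map_natCast,
      Function.iterate_succ_apply', h]
    ring

lemma prolongMatrix_mul (n : ℕ) (B D : Matrix (Fin m) (Fin m) S) :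
    prolongMatrix n (B * D) = prolongMatrix n B * prolongMatrix n D := by
  ext ⟨⟨i, hi⟩, a⟩ ⟨⟨j, hj⟩, b⟩
  simp only [prolongMatrix, Matrix.of_apply, Matrix.mul_apply, Fintype.sum_prod_type,
    iterate_deriv_sum]
  rw [Finset.sum_comm, Finset.mul_sum]
  refine Finset.sum_congr rfl fun c _ => ?_
  rw [iterate_deriv_mul]
  rcases lt_or_ge i j with hij | hij
  · rw [Nat.choose_eq_zero_of_lt hij, Nat.cast_zero, zero_mul]
    refine (Finset.sum_eq_zero fun l _ => ?_).symm
    rcases lt_or_ge i l with hl | hl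
    · simp [Nat.choose_eq_zero_of_lt hl]
    · simp [Nat.choose_eq_zero_of_lt (lt_of_le_of_lt hl hij)]
  · rw [Fin.sum_univ_eq_sum_range (fun l => ((i.choose l : ℕ) : S) *
      (⇑(Differential.deriv (R := S)))^[i - l] (B a c) * (((l.choose j : ℕ) : S) *
      (⇑(Differential.deriv (R := S)))^[l - j] (D c b))) (n + 1),
      ← Finset.sum_subset (s₁ := Finset.Ico j (i + 1)), Finset.sum_Ico_eq_sum_range,
      ← Finset.Nat.sum_antidiagonal_swap, Finset.Nat.sum_antidiagonal_eq_sum_range_succ_mk,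
      Finset.mul_sum, Nat.succ_eq_add_one, Nat.sub_add_comm hij]
    · refine Finset.sum_congr rfl fun l hl => ?_
      have hl' : l + j ≤ i := by have := Finset.mem_range.1 hl; omega
      have e1 : i - (j + l) = i - j - l := by omega
      have e2 : j + l - j = l := by omega
      have e3 : (i.choose (j + l) : S) * ((j + l).choose j : S) =
          (i.choose j : S) * ((i - j).choose (i - j - l) : S) := by
        rw [← Nat.cast_mul, ← Nat.cast_mul, Nat.choose_mul, e2,
          Nat.choose_symm (by omega)]
        omega
      simp only [Prod.swap, e1, e2]
      linear_combination (-(⇑(Differential.deriv (R := S)))^[i - j - l] (B a c) *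
        (⇑(Differential.deriv (R := S)))^[l] (D c b)) * e3
    · intro l hl
      have := Finset.mem_Ico.1 hl
      exact Finset.mem_range.2 (by omega)
    · intro l _ hl
      rcases lt_or_ge l j with h | h
      · simp [Nat.choose_eq_zero_of_lt h]
      · have : i < l := by
          by_contra h'
          exact hl (Finset.mem_Ico.2 ⟨h, by omega⟩)
        simp [Nat.choose_eq_zero_of_lt this]

lemma prolongMatrix_one (n : ℕ) : prolongMatrix n (1 : Matrix (Fin m) (Fin m) S) = 1 := by
  ext ⟨i, a⟩ ⟨j, b⟩
  have h0 : ∀ l, (⇑(Differential.deriv (R := S)))^[l] 0 = 0 := fun l => iterate_map_zero _ l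
  have h1 : ∀ l, 0 < l → (⇑(Differential.deriv (R := S)))^[l] 1 = 0 := by
    intro l hl
    obtain ⟨l, rfl⟩ := Nat.exists_eq_succ_of_ne_zero hl.ne'
    rw [Function.iterate_succ_apply, Derivation.map_one_eq_zero, h0]
  simp only [prolongMatrix, Matrix.of_apply, Matrix.one_apply, Prod.mk.injEq]
  by_cases hab : a = b
  · rcases lt_trichotomy i j with hij | rfl | hij
    · simp [Nat.choose_eq_zero_of_lt (Fin.lt_def.1 hij), hij.ne]
    · simp [hab]
    · simp [hab, hij.ne', h1 _ (Nat.sub_pos_of_lt (Fin.lt_def.1 hij))]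
  · simp [hab, h0]

/-- The group homomorphism `B ↦ (B, B′, …, B^{(n)})` from `GL_m` to `GL_{(n+1)m}`, the right-hand
side being read as a block lower-triangular matrix. -/
def prolong (n : ℕ) : GL (Fin m) S →* GL (Fin (n + 1) × Fin m) S :=
  Units.map ⟨⟨prolongMatrix n, prolongMatrix_one n⟩, prolongMatrix_mul n⟩

end Prolong

/-! ### Automorphism groups and their matrices -/

/-- The group of ring automorphisms of `E` that fix the set `base` pointwise and commute with all
the operators in `ops`. -/
def opAut {E : Type*} [CommRing E] (base : Set E) (ops : Set (E → E)) :
    Subgroup (E ≃+* E) where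
  carrier := {g | (∀ x ∈ base, g x = x) ∧ ∀ T ∈ ops, ∀ x, g (T x) = T (g x)}
  one_mem' := ⟨fun _ _ => rfl, fun _ _ _ => rfl⟩
  mul_mem' {g h} hg hh := ⟨fun x hx => by rw [RingAut.mul_apply, hh.1 x hx, hg.1 x hx],
    fun T hT x => by rw [RingAut.mul_apply, RingAut.mul_apply, hh.2 T hT, hg.2 T hT]⟩
  inv_mem' {g} hg := ⟨fun x hx => g.injective (by
      rw [hg.1 x hx]; exact g.apply_symm_apply x),
    fun T hT x => g.injective (by
      rw [hg.2 T hT]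
      exact (g.apply_symm_apply _).trans (congrArg T (g.apply_symm_apply x).symm))⟩

/-- The matrices `B` over `C` with `g(M) = M B` for some automorphism `g` in the group `Γ`, whose
elements fix the image of `C`. -/
def matrixGroup {ι : Type*} [Fintype ι] [DecidableEq ι] {C E : Type*} [CommRing C] [CommRing E]
    (Γ : Subgroup (E ≃+* E)) (f : C →+* E) (hf : ∀ g ∈ Γ, ∀ c, g (f c) = f c)
    (M : Matrix ι ι E) : Subgroup (GL ι C) where
  carrier := {B | ∃ g ∈ Γ, M.map g = M * (B : Matrix ι ι C).map f}
  one_mem' := ⟨1, Γ.one_mem, by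
    rw [Units.val_one, Matrix.map_one _ (map_zero f) (map_one f), mul_one]; rfl⟩
  mul_mem' := by
    rintro B D ⟨g, hg, hB⟩ ⟨h, hh, hD⟩
    refine ⟨g * h, Γ.mul_mem hg hh, ?_⟩
    have e : M.map (g * h) = (M.map h).map g := by ext; rfl
    have e' : ((D : Matrix ι ι C).map f).map g = (D : Matrix ι ι C).map f := by
      ext i j; exact hf g hg _
    rw [e, hD, Matrix.map_mul, hB, e', Units.val_mul, Matrix.map_mul, mul_assoc]
  inv_mem' := by
    rintro B ⟨g, hg, hB⟩
    refine ⟨g⁻¹, Γ.inv_mem hg, ?_⟩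
    have e : M = M.map (g⁻¹ : E ≃+* E) * (B : Matrix ι ι C).map f := by
      have := congrArg (fun N : Matrix ι ι E => N.map (g⁻¹ : E ≃+* E)) hB
      have e1 : (M.map g).map (g⁻¹ : E ≃+* E) = M := by
        ext i j; exact g.symm_apply_apply _
      have e2 : ((B : Matrix ι ι C).map f).map (g⁻¹ : E ≃+* E) = (B : Matrix ι ι C).map f := by
        ext i j; exact hf _ (Γ.inv_mem hg) _
      simpa only [Matrix.map_mul, e1, e2] using this
    have e3 : (B : Matrix ι ι C).map f * ((B⁻¹ : GL ι C) : Matrix ι ι C).map f = 1 := by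
      rw [← Matrix.map_mul, B.mul_inv, Matrix.map_one _ (map_zero f) (map_one f)]
    calc M.map (g⁻¹ : E ≃+* E) = M.map (g⁻¹ : E ≃+* E) *
        ((B : Matrix ι ι C).map f * ((B⁻¹ : GL ι C) : Matrix ι ι C).map f) := by rw [e3, mul_one]
      _ = M * ((B⁻¹ : GL ι C) : Matrix ι ι C).map f := by rw [← mul_assoc, ← e]

/-- The additive map `x ⊗ y ↦ x′ ⊗ y + x ⊗ y′` on the tensor product of two differential algebras
over a differential ring. -/
def tensorDeriv (R S T : Type*) [CommRing R] [CommRing S] [CommRing T] [Algebra R S]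
    [Algebra R T] [Differential R] [Differential S] [Differential T] [DifferentialAlgebra R S]
    [DifferentialAlgebra R T] : S ⊗[R] T →+ S ⊗[R] T :=
  TensorProduct.liftAddHom
    (AddMonoidHom.mk' (fun s => AddMonoidHom.mk' (fun t => s′ ⊗ₜ[R] t + s ⊗ₜ[R] t′)
      (fun t t' => by simp only [map_add, TensorProduct.tmul_add]; abel))
      (fun s s' => by
        ext t
        simp only [map_add, TensorProduct.add_tmul, AddMonoidHom.mk'_apply, AddMonoidHom.add_apply]
        abel))
    (fun r s t => by
      have h1 : (r • s)′ = r′ • s + r • s′ := by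
        simp only [Algebra.smul_def, Derivation.leibniz, deriv_algebraMap,
          Algebra.algebraMap_self, RingHom.id_apply]; ring
      have h2 : (r • t)′ = r′ • t + r • t′ := by
        simp only [Algebra.smul_def, Derivation.leibniz, deriv_algebraMap,
          Algebra.algebraMap_self, RingHom.id_apply]; ring
      simp only [AddMonoidHom.mk'_apply, h1, h2, TensorProduct.add_tmul, TensorProduct.tmul_add,
        TensorProduct.smul_tmul]
      abel)

section Points

variable {m : ℕ} {k : Type u} [Field k] [Differential k]
  (σ : k ≃+* k) (hσ : ∀ x, σ x′ = (σ x)′) (A : GL (Fin m) k)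

/-- The group `Aut_{σδ}(L / k C_L)` of automorphisms of `L = k C_L⟨X⟩` over `k C_L` that commute
with `σ` and with the derivation. -/
def autL : Subgroup (GenField m k ≃+* GenField m k) :=
  opAut (kConstL σ hσ A : Set (GenField m k)) {⇑(sigmaL σ hσ A), fun x => x′}

/-- The group `Aut_σ(F_n C_L / k C_L)`. -/
def autRing (n : ℕ) : Subgroup (solRing σ hσ A (n : ℕ∞) ≃+* solRing σ hσ A (n : ℕ∞)) :=
  opAut (Set.range (algebraMap (kConstL σ hσ A) _)) {⇑(sigmaRing σ hσ A n)}

variable (C : Type u) [Field C] [Algebra (constL σ hσ A) C]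

/-- The ring `F_N C_L ⊗ C` over `C_L`. -/
abbrev ringC (N : ℕ∞) : Type u := solRing σ hσ A N ⊗[constL σ hσ A] C

/-- The endomorphism `σ ⊗ id` of `F_N C_L ⊗ C`. -/
def sigmaC (N : ℕ∞) : ringC σ hσ A C N →ₐ[constL σ hσ A] ringC σ hσ A C N :=
  Algebra.TensorProduct.map (sigmaRing σ hσ A N) (AlgHom.id _ C)

/-- The base ring `k C_L ⊗ C`, as a subset of `F_N C_L ⊗ C`. -/
def baseC (N : ℕ∞) : Set (ringC σ hσ A C N) :=
  Set.range (Algebra.TensorProduct.map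
    (IsScalarTower.toAlgHom (constL σ hσ A) (kConstL σ hσ A) (solRing σ hσ A N))
    (AlgHom.id (constL σ hσ A) C))

/-- The map `c ↦ 1 ⊗ c`. -/
def inclC (N : ℕ∞) : C →+* ringC σ hσ A C N :=
  (Algebra.TensorProduct.includeRight : C →ₐ[constL σ hσ A] ringC σ hσ A C N).toRingHom

lemma inclC_mem (N : ℕ∞) (c : C) : inclC σ hσ A C N c ∈ baseC σ hσ A C N :=
  ⟨1 ⊗ₜ c, by simp [inclC]⟩

/-- The map `x ↦ x ⊗ 1`. -/
def inclL (N : ℕ∞) : solRing σ hσ A N →+* ringC σ hσ A C N :=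
  Algebra.TensorProduct.includeLeftRingHom

/-- The group `ℍ_n(C)`: the matrices over `C` that describe, on the fundamental matrix of the
prolonged system, the automorphisms of `F_n C_L ⊗ C` over `k C_L ⊗ C` that commute with `σ`. -/
def groupHn (n : ℕ) : Subgroup (GL (Fin (n + 1) × Fin m) C) :=
  matrixGroup (opAut (baseC σ hσ A C n) {⇑(sigmaC σ hσ A C n)}) (inclC σ hσ A C n)
    (fun _ hg c => hg.1 _ (inclC_mem σ hσ A C n c)) ((fundMatrix σ hσ A n).map (inclL σ hσ A C n))

variable [Differential C] [DifferentialAlgebra (constL σ hσ A) C]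

/-- The group `ℍ(C)`: the matrices over `C` that describe, on the fundamental matrix `X`, the
automorphisms of `R ⊗ C` over `k C_L ⊗ C` that commute with `σ` and with the derivation. -/
def groupH : Subgroup (GL (Fin m) C) :=
  matrixGroup (opAut (baseC σ hσ A C ⊤) {⇑(sigmaC σ hσ A C ⊤),
      ⇑(tensorDeriv (constL σ hσ A) (solRing σ hσ A ⊤) C)}) (inclC σ hσ A C ⊤)
    (fun _ hg c => hg.1 _ (inclC_mem σ hσ A C ⊤ c))
    ((solX σ hσ A ⊤ 0 le_top).map (inclL σ hσ A C ⊤))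

end Points

/-- A differential field `C` is differentially closed if every finite system of differential
polynomial equations over `C`, in finitely many unknowns, that has a solution in some differential
field extension of `C` has a solution in `C`. The variable `(i, j)` stands for the `j`-th
derivative of the `i`-th unknown. -/
def IsDifferentiallyClosed (C : Type u) [Field C] [Differential C] : Prop :=
  ∀ (r : ℕ) (P : Finset (MvPolynomial (Fin r × ℕ) C)),
    (∃ (E : Type u) (_ : Field E) (_ : Differential E) (_ : Algebra C E)
      (_ : DifferentialAlgebra C E) (y : Fin r → E), ∀ p ∈ P,
        MvPolynomial.aeval (fun v => (⇑(Differential.deriv (R := E)))^[v.2] (y v.1)) p = 0) →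
    ∃ y : Fin r → C, ∀ p ∈ P,
      MvPolynomial.aeval (fun v => (⇑(Differential.deriv (R := C)))^[v.2] (y v.1)) p = 0

/-- The set `S` of invertible matrices over the field `C` is Zariski dense in the set `T ⊇ S`:
every polynomial in the entries that vanishes on `S` vanishes on `T`. -/
def IsZariskiDenseIn {ι C : Type*} [Fintype ι] [DecidableEq ι] [Field C]
    (S T : Set (GL ι C)) : Prop :=
  S ⊆ T ∧ ∀ P : MvPolynomial (ι × ι) C,
    (∀ B ∈ S, MvPolynomial.eval (fun v => (B : Matrix ι ι C) v.1 v.2) P = 0) →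
    ∀ B ∈ T, MvPolynomial.eval (fun v => (B : Matrix ι ι C) v.1 v.2) P = 0

end DiffGalois
end

open DiffGalois

/-! Write K = kC_L. Everything rests on describing the groups by polynomial relations. A matrix 𝓑 in
GL_{(n+1)m}(C) lies in ℍ_n(C) if and only if X_[n] ↦ X_[n]𝓑, with values in L ⊗ C, preserves every
polynomial relation over K among the entries of X_[n] (`IsTranslation`, `mem_groupHn_iff`). Likewise
B lies in ℍ(C) if and only if all B_[n] have this property (`mem_groupH_iff`), because the images
(XB)^{(j)} then define an endomorphism of R ⊗ C. So ℍ is cut out by the groups ℍ_n. Commutation with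
σ is automatic, since σ multiplies X_[n] on the left and 𝓑 acts on the right.

Galois groups as matrix groups: if g commutes with σ, then M⁻¹g(M) is fixed by σ for a fundamental
matrix M, so its entries are in C_L (`exists_matrix_of_fixed`). Points over C_L are compared with
automorphisms through R_n ⊗ C_L ≅ R_n and through the fraction field L of R.

Finitely many n suffice (`exists_bound_isSpec`, `exists_bound_isTranslation`): list the entries of
X, X′, X″, … as a sequence y with y_v′ = y_{v+r}, r = m². If y_v is algebraic over its predecessors,
then, in characteristic zero, a separable relation differentiates to a linear equation s·y_{v+r} + b
= 0 with s ≠ 0. The algebraic indices are therefore closed under adding r. Beyond a bound N, each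
algebraic step arises by differentiating an earlier relation, and a transcendental step imposes no
relation. To transfer the linear equation to the entries of XB, the image of s must be a
nonzerodivisor of L ⊗ C. It is one, because an automorphism of R_n ⊗ C carries s there and L is flat
over R_n (`IsTranslation.mem_nonZeroDivisors`).

Density: the equations f(X_[n]Y) = 0, for f over K with f(X_[n]) = 0, generate a σ-stable ideal, so
it is spanned by polynomials over C_L (`isSpec_iff_constIdeal`), and ℍ_n is given by polynomial
equations over C_L. Let 𝓑 ∈ ℍ_n(C) and P(𝓑) ≠ 0. In L ⊗_K (R_n ⊗ C) consider P evaluated at the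
product of X_[n]⁻¹ from the first factor and X_[n] from the second. An automorphism attached to 𝓑
specializes this element to P(𝓑), so it is not nilpotent. It remains non-nilpotent in the
differential ring L ⊗_K (L ⊗ C), and Taylor series give a homomorphism from that ring to a
differential field E which does not kill it (`exists_differentialField`,
`exists_differentialField_pair`). The quotient Y of the two resulting copies of X in GL_m(E)
satisfies the equations of every ℍ_j after prolongation, and P(Y_[n]) ≠ 0. By the bound N and
Hilbert's basis theorem, finitely many of these equations characterize ℍ, so a differentially closed
C contains a solution B ∈ ℍ(C) with P(B_[n]) ≠ 0 (`exists_prolong_eval_ne_zero`). -/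

noncomputable section

namespace DiffGalois

/-! ### Derivations on tensor products -/

/-- The differential structure given by an additive map that satisfies the Leibniz rule. -/
abbrev differentialOfLeibniz {R : Type*} [CommRing R] (d : R →+ R)
    (h : ∀ a b, d (a * b) = a * d b + b * d a) : Differential R :=
  ⟨Derivation.mk' d.toIntLinearMap h⟩

section TensorDeriv

variable (R S T : Type*) [CommRing R] [CommRing S] [CommRing T] [Algebra R S]
    [Algebra R T] [Differential R] [Differential S] [Differential T] [DifferentialAlgebra R S]
    [DifferentialAlgebra R T]

lemma tensorDeriv_tmul (s : S) (t : T) :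
    tensorDeriv R S T (s ⊗ₜ t) = s′ ⊗ₜ t + s ⊗ₜ t′ := rfl

lemma tensorDeriv_mul (x y : S ⊗[R] T) :
    tensorDeriv R S T (x * y) = x * tensorDeriv R S T y + y * tensorDeriv R S T x := by
  induction x with
  | zero => simp
  | add x₁ x₂ h₁ h₂ => simp only [add_mul, map_add, h₁, h₂, mul_add]; abel
  | tmul a b =>
    induction y with
    | zero => simp
    | add y₁ y₂ h₁ h₂ => simp only [add_mul, map_add, h₁, h₂, mul_add]; abel
    | tmul a' b' =>
      simp only [Algebra.TensorProduct.tmul_mul_tmul, tensorDeriv_tmul, Derivation.leibniz,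
        smul_eq_mul, TensorProduct.add_tmul, TensorProduct.tmul_add, mul_add]
      rw [mul_comm a' a, mul_comm b' b, mul_comm b' b′, mul_comm a' a′]
      abel

/-- The tensor product of two differential algebras as a differential ring. -/
abbrev tensorDifferential : Differential (S ⊗[R] T) :=
  differentialOfLeibniz (tensorDeriv R S T) (tensorDeriv_mul R S T)

end TensorDeriv

/-! ### Descent of subspaces to the fixed field -/

/-- This is Artin's minimal-support argument. A nonzero vector of `W` with smallest support, scaled
to have a coordinate 1, must be fixed, as its difference with its σ-image has smaller support.
Subtracting a multiple of it shrinks the support of `h`, and induction finishes. -/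
lemma mem_span_of_stable {α : Type*} {L : Type*} [Field L] (σ : L ≃+* L)
    (W : Submodule L (α →₀ L))
    (hW : ∀ h ∈ W, h.mapRange σ (map_zero σ) ∈ W) (h : α →₀ L) (hh : h ∈ W) :
    h ∈ Submodule.span L {f | f ∈ W ∧ ∀ a, σ (f a) = f a} := by
  classical
  obtain ⟨n, hn⟩ : ∃ n, h.support.card = n := ⟨_, rfl⟩
  induction n using Nat.strong_induction_on generalizing h with
  | _ n ih =>
  by_cases h0 : h = 0
  · rw [h0]; exact zero_mem _
  -- The minimum is taken only over vectors supported inside the support of `h`, so that subtracting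
  -- a multiple of one cannot enlarge that support.
  have hex : ∃ d, ∃ f ∈ W, f ≠ 0 ∧ f.support ⊆ h.support ∧ f.support.card = d :=
    ⟨_, h, hh, h0, subset_rfl, rfl⟩
  obtain ⟨f, hfW, hf0, hfs, hfc⟩ := Nat.find_spec hex
  have hmin := fun d => Nat.find_min hex (m := d)
  obtain ⟨a, ha⟩ : ∃ a, f a ≠ 0 := by
    by_contra! hcon
    exact hf0 (Finsupp.ext hcon)
  set f₁ : α →₀ L := (f a)⁻¹ • f with hf₁
  have hf₁W : f₁ ∈ W := W.smul_mem _ hfW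
  have hf₁a : f₁ a = 1 := by simp [hf₁, ha]
  have hf₁s : f₁.support ⊆ f.support := Finsupp.support_smul
  have hfix : f₁.mapRange σ (map_zero σ) - f₁ = 0 := by
    by_contra hne
    have hs : (f₁.mapRange σ (map_zero σ) - f₁).support ⊆ f.support.erase a := by
      intro b hb
      rw [Finset.mem_erase]
      constructor
      · rintro rfl
        simp [hf₁a] at hb
      · by_contra hbf
        have : f₁ b = 0 := by
          by_contra hb0
          exact hbf (hf₁s (Finsupp.mem_support_iff.2 hb0))
        simp [this] at hb
    refine hmin _ ?_ ⟨_, W.sub_mem (hW _ hf₁W) hf₁W, hne,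
      hs.trans ((Finset.erase_subset _ _).trans hfs), rfl⟩
    rw [← hfc]
    exact (Finset.card_le_card hs).trans_lt
      (Finset.card_erase_lt_of_mem (Finsupp.mem_support_iff.2 ha))
  have hf₁fix : ∀ b, σ (f₁ b) = f₁ b := fun b => by
    have := DFunLike.congr_fun hfix b
    simpa [sub_eq_zero] using this
  have hsub : h - h a • f₁ ∈ Submodule.span L {f | f ∈ W ∧ ∀ a, σ (f a) = f a} := by
    refine ih _ ?_ _ (W.sub_mem hh (W.smul_mem _ hf₁W)) rfl
    rw [← hn]
    have hs : (h - h a • f₁).support ⊆ h.support.erase a := by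
      intro b hb
      rw [Finset.mem_erase]
      constructor
      · rintro rfl
        simp [hf₁a] at hb
      · by_contra hbh
        have h1 : f₁ b = 0 := by
          by_contra hb0
          exact hbh (hfs (hf₁s (Finsupp.mem_support_iff.2 hb0)))
        have h2 : h b = 0 := by simpa using hbh
        simp [h1, h2] at hb
    exact (Finset.card_le_card hs).trans_lt
      (Finset.card_erase_lt_of_mem (hfs (Finsupp.mem_support_iff.2 ha)))
  have := Submodule.add_mem _ hsub (Submodule.smul_mem _ (h a)
    (Submodule.subset_span (show f₁ ∈ {f | f ∈ W ∧ ∀ a, σ (f a) = f a} from ⟨hf₁W, hf₁fix⟩)))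
  simpa using this

/-! ### Surjective endomorphisms -/

/-- `g` is `T`-linear and maps the finitely generated module spanned by 1 and `v` onto itself, hence
also each of its powers. These exhaust `S`, and a surjective endomorphism of a finite module over a
commutative ring is injective. -/
lemma bijective_of_map_span {S : Type*} [CommRing S] (g : S →+* S) (T : Subring S)
    (hT : ∀ x ∈ T, g x = x) (v : Set S) (hv : v.Finite)
    (htop : Algebra.adjoin T v = ⊤)
    (hle : ∀ x ∈ v, g x ∈ Submodule.span T v)
    (hge : ∀ x ∈ v, ∃ y ∈ Submodule.span T v, g y = x) : Function.Bijective g := by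
  let G : S →ₐ[T] S := { g with commutes' := fun t => hT _ t.2 }
  -- Including 1 makes the powers of `W` increasing.
  set W : Submodule T S := Submodule.span T (insert 1 v) with hWdef
  have h1W : (1 : S) ∈ W := Submodule.subset_span (Set.mem_insert _ _)
  have hvW : Submodule.span T v ≤ W := Submodule.span_mono (Set.subset_insert _ _)
  have hmap : W.map G.toLinearMap = W := by
    apply le_antisymm
    · rw [hWdef, Submodule.map_span, Submodule.span_le]
      rintro _ ⟨x, rfl | hx, rfl⟩
      · change G 1 ∈ W
        rw [map_one]; exact h1W
      · exact hvW (hle x hx)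
    · conv_lhs => rw [hWdef]
      rw [Submodule.span_le]
      rintro x (rfl | hx)
      · exact ⟨1, h1W, map_one G⟩
      · obtain ⟨y, hy, rfl⟩ := hge x hx
        exact ⟨y, hvW hy, rfl⟩
  have hmapn : ∀ d, (W ^ d).map G.toLinearMap = W ^ d := fun d => by
    rw [Submodule.map_pow, hmap]
  have hmono : ∀ {d e}, d ≤ e → W ^ d ≤ W ^ e := by
    intro d e hde
    exact pow_le_pow_right₀ (Submodule.one_le.2 h1W) hde
  have hall : ∀ x : S, ∃ d, x ∈ W ^ d := by
    intro x
    have hx : x ∈ Algebra.adjoin T v := by rw [htop]; trivial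
    induction hx using Algebra.adjoin_induction with
    | mem x hx => exact ⟨1, by rw [pow_one]; exact hvW (Submodule.subset_span hx)⟩
    | algebraMap t => exact ⟨0, by rw [pow_zero]; exact Submodule.algebraMap_mem t⟩
    | add x y _ _ hx hy =>
      obtain ⟨d, hd⟩ := hx
      obtain ⟨e, he⟩ := hy
      exact ⟨max d e, add_mem (hmono (le_max_left _ _) hd) (hmono (le_max_right _ _) he)⟩
    | mul x y _ _ hx hy =>
      obtain ⟨d, hd⟩ := hx
      obtain ⟨e, he⟩ := hy
      exact ⟨d + e, by rw [pow_add]; exact Submodule.mul_mem_mul hd he⟩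
  have hfg : ∀ d, Module.Finite T ↥(W ^ d) := fun d =>
    Module.Finite.iff_fg.2 (Submodule.FG.pow (Submodule.fg_span (hv.insert 1)) d)
  constructor
  · rw [injective_iff_map_eq_zero]
    intro x hx
    obtain ⟨d, hd⟩ := hall x
    have hst : ∀ y ∈ W ^ d, G.toLinearMap y ∈ W ^ d := fun y hy => by
      rw [← hmapn d]; exact ⟨y, hy, rfl⟩
    have hsurj : Function.Surjective (G.toLinearMap.restrict hst) := by
      rintro ⟨y, hy⟩
      rw [← hmapn d] at hy
      obtain ⟨z, hz, rfl⟩ := hy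
      exact ⟨⟨z, hz⟩, rfl⟩
    have := hfg d
    have hinj := OrzechProperty.injective_of_surjective_endomorphism _ hsurj
    have : (⟨x, hd⟩ : ↥(W ^ d)) = 0 := hinj (by
      rw [map_zero]; exact Subtype.ext hx)
    exact congrArg Subtype.val this
  · intro x
    obtain ⟨d, hd⟩ := hall x
    rw [← hmapn d] at hd
    obtain ⟨y, -, hy⟩ := hd
    exact ⟨y, hy⟩

/-! ### Differential fields from differential rings -/

section FractionField

variable (S F : Type*) [CommRing S] [IsDomain S] [Differential S] [Field F] [Algebra S F]
  [IsFractionRing S F]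

/-- The homomorphism `x ↦ x + ε x′` on the fraction field. -/
def fractionDual : F →+* TrivSqZeroExt F F :=
  IsLocalization.lift (M := nonZeroDivisors S) (g := dualOfDeriv (algebraMap S F)) (by
    intro y
    rw [TrivSqZeroExt.isUnit_iff_isUnit_fst]
    simp [dualOfDeriv])

lemma fst_fractionDual (x : F) : (fractionDual S F x).fst = x := by
  have : ((TrivSqZeroExt.fstHom ℤ F F).toRingHom.comp (fractionDual S F)) = RingHom.id F := by
    apply IsLocalization.ringHom_ext (nonZeroDivisors S)
    ext p
    simp [fractionDual, dualOfDeriv]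
  exact congrArg (fun f => f x) this

/-- The derivation of the fraction field that extends the one of `S`. -/
abbrev fractionDifferential : Differential F :=
  ⟨derivOfDual (fractionDual S F) (fst_fractionDual S F)⟩

lemma fractionDifferential_algebraMap (x : S) :
    (fractionDifferential S F).deriv (algebraMap S F x) = algebraMap S F x′ := by
  have h : fractionDual S F (algebraMap S F x) = dualOfDeriv (algebraMap S F) x :=
    IsLocalization.lift_eq _ x
  change (fractionDual S F _).snd = _
  rw [h, snd_dualOfDeriv]

end FractionField

/-- The Taylor series homomorphism `a ↦ ∑ φ(a^{(i)}) tⁱ / i!`. -/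
def taylorHom {D Ω : Type*} [CommRing D] [Differential D] [Field Ω] [CharZero Ω] (φ : D →+* Ω) :
    D →+* PowerSeries Ω where
  toFun a := PowerSeries.mk fun i => φ ((⇑(Differential.deriv (R := D)))^[i] a) / (i.factorial : Ω)
  map_zero' := by
    ext i
    simp [iterate_map_zero]
  map_one' := by
    ext i
    rcases i with _ | i
    · simp
    · simp [PowerSeries.coeff_one, Function.iterate_succ_apply, iterate_map_zero]
  map_add' a b := by
    ext i
    simp [iterate_map_add, add_div]
  map_mul' a b := by
    ext i
    simp only [PowerSeries.coeff_mk, PowerSeries.coeff_mul, iterate_deriv_mul, map_sum, map_mul,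
      map_natCast, Finset.sum_div]
    refine Finset.sum_congr rfl fun p hp => ?_
    have hp' := Finset.HasAntidiagonal.mem_antidiagonal.1 hp
    -- Dividing the binomial coefficient of the Leibniz rule by (i+j)! leaves 1/(i! j!), the
    -- coefficient in the Cauchy product.
    rw [← hp', Nat.choose_symm_add, Nat.add_choose, Nat.cast_div (Nat.factorial_mul_factorial_dvd_factorial_add _ _)
      (by exact_mod_cast Nat.mul_ne_zero (Nat.factorial_ne_zero _) (Nat.factorial_ne_zero _))]
    have h1 : ((p.1 + p.2).factorial : Ω) ≠ 0 := by exact_mod_cast Nat.factorial_ne_zero _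
    have h2 : (p.1.factorial : Ω) ≠ 0 := by exact_mod_cast Nat.factorial_ne_zero _
    have h3 : (p.2.factorial : Ω) ≠ 0 := by exact_mod_cast Nat.factorial_ne_zero _
    push_cast
    field_simp

/-- The derivation `d/dt` on power series. -/
abbrev powerSeriesDifferential (Ω : Type*) [Field Ω] : Differential (PowerSeries Ω) :=
  differentialOfLeibniz (PowerSeries.derivative Ω).toLinearMap.toAddMonoidHom
    (PowerSeries.derivative Ω).leibniz

lemma taylorHom_deriv {D Ω : Type*} [CommRing D] [Differential D] [Field Ω] [CharZero Ω]
    (φ : D →+* Ω) (a : D) :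
    taylorHom φ a′ = (powerSeriesDifferential Ω).deriv (taylorHom φ a) := by
  change _ = PowerSeries.derivative Ω (taylorHom φ a)
  ext i
  simp only [taylorHom, RingHom.coe_mk, MonoidHom.coe_mk, OneHom.coe_mk, PowerSeries.coeff_mk,
    PowerSeries.coeff_derivative, Nat.factorial_succ, ← Function.iterate_succ_apply]
  have h2 : (i.factorial : Ω) ≠ 0 := by exact_mod_cast Nat.factorial_ne_zero _
  have h1 : (i : Ω) + 1 ≠ 0 := by exact_mod_cast Nat.succ_ne_zero i
  push_cast
  field_simp

/-- A non-nilpotent element of a differential ring over a field of characteristic zero is nonzero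
in some differential field to which the ring maps. -/
lemma exists_differentialField {D : Type u} [CommRing D] [Differential D] [Algebra ℚ D] (p : D)
    (hp : ¬ IsNilpotent p) :
    ∃ (E : Type u) (_ : Field E) (_ : Differential E) (θ : D →+* E),
      (∀ x, θ x′ = (θ x)′) ∧ θ p ≠ 0 := by
  obtain ⟨I, hI, hpI⟩ : ∃ I : Ideal D, I.IsPrime ∧ p ∉ I := by
    by_contra! hcon
    refine hp ?_
    rw [← mem_nilradical, nilradical_eq_sInf]
    exact Submodule.mem_sInf.2 hcon
  -- The prime `I` need not be stable under the derivation. The Taylor homomorphism of `φ` is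
  -- nevertheless differential, and its constant term at `p` is `φ p ≠ 0`.
  let φ : D →+* FractionRing (D ⧸ I) := (algebraMap (D ⧸ I) _).comp (Ideal.Quotient.mk I)
  have hφ : φ p ≠ 0 := by
    simpa [φ, Ideal.Quotient.eq_zero_iff_mem] using hpI
  have : CharZero (FractionRing (D ⧸ I)) :=
    charZero_of_injective_algebraMap (φ.comp (algebraMap ℚ D)).injective
  let _ := powerSeriesDifferential (FractionRing (D ⧸ I))
  refine ⟨FractionRing (PowerSeries (FractionRing (D ⧸ I))), inferInstance,
    fractionDifferential (PowerSeries (FractionRing (D ⧸ I))) _, (algebraMap _ _).comp (taylorHom φ), fun x => ?_, ?_⟩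
  · rw [RingHom.comp_apply, RingHom.comp_apply, fractionDifferential_algebraMap, taylorHom_deriv]
  · rw [RingHom.comp_apply, Ne, FaithfulSMul.algebraMap_eq_zero_iff]
    intro h
    have := congrArg (PowerSeries.coeff 0) h
    simp [taylorHom, hφ] at this

/-! ### Specializations -/

section Specialization

variable (K : Type*) {L M : Type*} [CommRing K] [CommRing L] [CommRing M] [Algebra K L]
  [Algebra K M]

/-- The subalgebra of `L × M` generated by the pairs `(x i, z i)`. -/
def graphAlg {ι : Type*} (x : ι → L) (z : ι → M) : Subalgebra K (L × M) :=
  Algebra.adjoin K (Set.range fun i => (x i, z i))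

/-- The family `z` satisfies all the polynomial relations over `K` that `x` satisfies: the
subalgebra generated by the pairs `(x i, z i)` is the graph of a map. -/
def IsSpec {ι : Type*} (x : ι → L) (z : ι → M) : Prop :=
  ∀ p ∈ graphAlg K x z, p.1 = 0 → p.2 = 0

variable {K}

lemma mem_graphAlg_iff {ι : Type*} {x : ι → L} {z : ι → M} {p : L × M} :
    p ∈ graphAlg K x z ↔
      ∃ f : MvPolynomial ι K, MvPolynomial.aeval x f = p.1 ∧ MvPolynomial.aeval z f = p.2 := by
  have h : ∀ f : MvPolynomial ι K, MvPolynomial.aeval (fun i => (x i, z i)) f =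
      (MvPolynomial.aeval x f, MvPolynomial.aeval z f) := by
    intro f
    refine Prod.ext ?_ ?_
    · exact congrArg (fun φ : MvPolynomial ι K →ₐ[K] L => φ f) (MvPolynomial.algHom_ext
        (f := (AlgHom.fst K L M).comp (MvPolynomial.aeval fun i => (x i, z i))) (by simp))
    · exact congrArg (fun φ : MvPolynomial ι K →ₐ[K] M => φ f) (MvPolynomial.algHom_ext
        (f := (AlgHom.snd K L M).comp (MvPolynomial.aeval fun i => (x i, z i))) (by simp))
  rw [graphAlg, Algebra.adjoin_range_eq_range_aeval]
  constructor
  · rintro ⟨f, hf⟩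
    have hf' : MvPolynomial.aeval (fun i => (x i, z i)) f = p := hf
    rw [h] at hf'
    exact ⟨f, congrArg Prod.fst hf', congrArg Prod.snd hf'⟩
  · rintro ⟨f, h1, h2⟩
    exact ⟨f, (h f).trans (Prod.ext h1 h2)⟩

lemma isSpec_iff {ι : Type*} {x : ι → L} {z : ι → M} :
    IsSpec K x z ↔ ∀ f : MvPolynomial ι K,
      MvPolynomial.aeval x f = 0 → MvPolynomial.aeval z f = 0 := by
  constructor
  · exact fun h f hf => h (_, _) (mem_graphAlg_iff.2 ⟨f, rfl, rfl⟩) hf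
  · rintro h p hp h0
    obtain ⟨f, h1, h2⟩ := mem_graphAlg_iff.1 hp
    rw [← h2]
    exact h f (h1.trans h0)

lemma graphAlg_le {ι κ : Type*} {x : ι → L} {z : ι → M} {x' : κ → L} {z' : κ → M}
    (h : ∀ j, (x' j, z' j) ∈ graphAlg K x z) : graphAlg K x' z' ≤ graphAlg K x z :=
  Algebra.adjoin_le (by rintro _ ⟨j, rfl⟩; exact h j)

lemma mem_graphAlg {ι : Type*} (x : ι → L) (z : ι → M) (i : ι) :
    (x i, z i) ∈ graphAlg K x z := Algebra.subset_adjoin ⟨i, rfl⟩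

/-- This allows a change of generators: being a specialization depends only on the graph algebra,
and passes to smaller ones. -/
lemma IsSpec.of_mem {ι κ : Type*} {x : ι → L} {z : ι → M} (hs : IsSpec K x z) {x' : κ → L}
    {z' : κ → M} (h : ∀ j, (x' j, z' j) ∈ graphAlg K x z) : IsSpec K x' z' :=
  fun p hp => hs p (graphAlg_le h hp)

lemma isSpec_map_iff {N : Type*} [CommRing N] [Algebra K N] (j : M →ₐ[K] N)
    (hj : Function.Injective j) {ι : Type*} {x : ι → L} {z : ι → M} :
    IsSpec K x (fun i => j (z i)) ↔ IsSpec K x z := by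
  have h : ∀ f : MvPolynomial ι K, MvPolynomial.aeval (fun i => j (z i)) f =
      j (MvPolynomial.aeval z f) := fun f => by
    rw [← AlgHom.comp_apply, MvPolynomial.comp_aeval]
  simp only [isSpec_iff, h, map_eq_zero_iff j hj]

lemma isSpec_comp_iff {N : Type*} [CommRing N] [Algebra K N] (j : L →ₐ[K] N)
    (hj : Function.Injective j) {ι : Type*} {x : ι → L} {z : ι → M} :
    IsSpec K (fun i => j (x i)) z ↔ IsSpec K x z := by
  have h : ∀ f : MvPolynomial ι K, MvPolynomial.aeval (fun i => j (x i)) f =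
      j (MvPolynomial.aeval x f) := fun f => by
    rw [← AlgHom.comp_apply, MvPolynomial.comp_aeval]
  simp only [isSpec_iff, h, map_eq_zero_iff j hj]

/-- Each relation involves finitely many variables and so lives at some finite stage. -/
lemma isSpec_iUnion {ι : Type*} {x : ι → L} {z : ι → M} (s : ℕ → Set ι) (hs : Monotone s)
    (hu : ∀ i, ∃ n, i ∈ s n)
    (h : ∀ n, IsSpec K (fun i : s n => x i) (fun i : s n => z i)) : IsSpec K x z := by
  have key : ∀ p ∈ graphAlg K x z,
      ∃ n, p ∈ graphAlg K (fun i : s n => x i) (fun i : s n => z i) := by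
    have hle : ∀ {a b}, a ≤ b → graphAlg K (fun i : s a => x i) (fun i : s a => z i) ≤
        graphAlg K (fun i : s b => x i) (fun i : s b => z i) := fun hab =>
      graphAlg_le fun i => mem_graphAlg (fun i : s _ => x i) (fun i : s _ => z i) ⟨i, hs hab i.2⟩
    intro p hp
    induction hp using Algebra.adjoin_induction with
    | mem p hp =>
      obtain ⟨i, rfl⟩ := hp
      obtain ⟨n, hn⟩ := hu i
      exact ⟨n, mem_graphAlg (fun i : s n => x i) (fun i : s n => z i) ⟨i, hn⟩⟩
    | algebraMap t => exact ⟨0, Subalgebra.algebraMap_mem _ t⟩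
    | add p q _ _ hp hq =>
      obtain ⟨a, ha⟩ := hp
      obtain ⟨b, hb⟩ := hq
      exact ⟨max a b, add_mem (hle (le_max_left _ _) ha) (hle (le_max_right _ _) hb)⟩
    | mul p q _ _ hp hq =>
      obtain ⟨a, ha⟩ := hp
      obtain ⟨b, hb⟩ := hq
      exact ⟨max a b, mul_mem (hle (le_max_left _ _) ha) (hle (le_max_right _ _) hb)⟩
  intro p hp
  obtain ⟨n, hn⟩ := key p hp
  exact h n p hn

/-- Powers of `d` serve as common denominators: it is enough to clear them on generators. -/
lemma exists_pow_mul_mem {S : Type*} [CommRing S] [Algebra K S] {B : Subalgebra K S} {d : S}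
    (hd : d ∈ B) {t : Set S} (ht : ∀ x ∈ t, ∃ e : ℕ, d ^ e * x ∈ B) {p : S}
    (hp : p ∈ Algebra.adjoin K t) : ∃ e : ℕ, d ^ e * p ∈ B := by
  induction hp using Algebra.adjoin_induction with
  | mem p hp => exact ht p hp
  | algebraMap t => exact ⟨0, by rw [pow_zero, one_mul]; exact Subalgebra.algebraMap_mem _ t⟩
  | add p q _ _ hp hq =>
    obtain ⟨a, ha⟩ := hp
    obtain ⟨b, hb⟩ := hq
    refine ⟨a + b, ?_⟩
    have : d ^ (a + b) * (p + q) = d ^ b * (d ^ a * p) + d ^ a * (d ^ b * q) := by ring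
    rw [this]
    exact add_mem (mul_mem (pow_mem hd _) ha) (mul_mem (pow_mem hd _) hb)
  | mul p q _ _ hp hq =>
    obtain ⟨a, ha⟩ := hp
    obtain ⟨b, hb⟩ := hq
    refine ⟨a + b, ?_⟩
    have : d ^ (a + b) * (p * q) = d ^ a * p * (d ^ b * q) := by ring
    rw [this]
    exact mul_mem ha hb

/-- A specialization for which the element `d` of the graph has invertible components extends to
the subalgebra generated by the family and the inverse of `d`. -/
lemma IsSpec.exists_algHom {ι : Type*} {x : ι → L} {z : ι → M} (hs : IsSpec K x z)
    {d : L × M} (hd : d ∈ graphAlg K x z) {u : L} {w : M} (hu : d.1 * u = 1) (hw : d.2 * w = 1) :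
    ∃ ψ : Algebra.adjoin K (Set.range x ∪ {u}) →ₐ[K] M,
      (∀ i (h : x i ∈ Algebra.adjoin K (Set.range x ∪ {u})), ψ ⟨x i, h⟩ = z i) := by
  -- `G` is the graph of the extension to be built. A power of `d` brings each of its elements back
  -- into the old graph, and `d.2` is invertible, so the second component is still determined by the
  -- first.
  let G : Subalgebra K (L × M) :=
    Algebra.adjoin K ((Set.range fun i => (x i, z i)) ∪ {(u, w)})
  have hmul : ∀ p ∈ G, ∃ e : ℕ, d ^ e * p ∈ graphAlg K x z := by
    refine fun p hp => exists_pow_mul_mem hd ?_ hp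
    rintro q (hq | rfl)
    · exact ⟨0, by rw [pow_zero, one_mul]; exact Algebra.subset_adjoin hq⟩
    · refine ⟨1, ?_⟩
      have : d ^ 1 * (u, w) = 1 := by rw [pow_one]; exact Prod.ext hu hw
      rw [this]; exact one_mem _
  have hfun : ∀ p ∈ G, p.1 = 0 → p.2 = 0 := by
    intro p hp h0
    obtain ⟨e, he⟩ := hmul p hp
    have h2 : d.2 ^ e * p.2 = 0 := hs _ he (by simp [h0])
    calc p.2 = w ^ e * (d.2 ^ e * p.2) := by
          rw [← mul_assoc, ← mul_pow, mul_comm w, hw, one_pow, one_mul]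
      _ = 0 := by rw [h2, mul_zero]
  have hmap : G.map (AlgHom.fst K L M) = Algebra.adjoin K (Set.range x ∪ {u}) := by
    rw [AlgHom.map_adjoin, Set.image_union, Set.image_singleton, ← Set.range_comp]
    rfl
  have hex : ∀ y : Algebra.adjoin K (Set.range x ∪ {u}), ∃ p ∈ G, p.1 = y := by
    intro y
    obtain ⟨p, hp, h⟩ := hmap.ge y.2
    exact ⟨p, hp, h⟩
  choose P hP hP1 using hex
  have huniq : ∀ p q, p ∈ G → q ∈ G → p.1 = q.1 → p.2 = q.2 := fun p q hp hq h =>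
    sub_eq_zero.1 (hfun (p - q) (sub_mem hp hq) (by simp [h]))
  refine ⟨{ toFun := fun y => (P y).2
            map_one' := huniq _ 1 (hP _) (one_mem _) (hP1 _)
            map_zero' := huniq _ 0 (hP _) (zero_mem _) (hP1 _)
            map_add' := fun a b => huniq _ (P a + P b) (hP _) (add_mem (hP _) (hP _))
              (by simp [hP1])
            map_mul' := fun a b => huniq _ (P a * P b) (hP _) (mul_mem (hP _) (hP _))
              (by simp [hP1])
            commutes' := fun t => huniq _ (algebraMap K _ t) (hP _) (Subalgebra.algebraMap_mem _ t)
              (by simp [hP1]) }, fun i h => ?_⟩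
  exact huniq _ (x i, z i) (hP _) (Algebra.subset_adjoin (Or.inl ⟨i, rfl⟩)) (hP1 _)

end Specialization

/-! ### Finite determination of differential specializations -/

/-- If the derivative of a relation also vanishes at `y`, replace the relation by its derivative. In
characteristic zero this is nonzero and of smaller degree, so the process stops. -/
lemma exists_separable_relation {B L : Type*} [CommRing B] [Field L] [CharZero L] [Algebra B L]
    (hB : Function.Injective (algebraMap B L)) {y : L} (hy : IsAlgebraic B y) :
    ∃ p : Polynomial B, Polynomial.aeval y p = 0 ∧ Polynomial.aeval y p.derivative ≠ 0 := by
  obtain ⟨p, hp0, hp⟩ := hy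
  obtain ⟨n, hn⟩ : ∃ n, p.natDegree = n := ⟨_, rfl⟩
  induction n using Nat.strong_induction_on generalizing p with
  | _ n ih =>
  by_cases hd : Polynomial.aeval y p.derivative = 0
  · have hn0 : p.natDegree ≠ 0 := by
      intro h0
      rw [Polynomial.natDegree_eq_zero] at h0
      obtain ⟨b, rfl⟩ := h0
      rw [Polynomial.aeval_C, map_eq_zero_iff _ hB] at hp
      exact hp0 (by rw [hp, map_zero])
    have hlt : p.derivative.natDegree < n := hn ▸ Polynomial.natDegree_derivative_lt hn0
    refine ih _ hlt _ (fun h => ?_) hd rfl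
    have hc := congrArg (fun q => algebraMap B L (q.coeff (p.natDegree - 1))) h
    simp only [Polynomial.coeff_derivative, Polynomial.coeff_zero, map_zero, map_mul, map_add,
      map_one, map_natCast] at hc
    rw [Nat.sub_add_cancel (Nat.one_le_iff_ne_zero.2 hn0)] at hc
    rcases mul_eq_zero.1 hc with h1 | h1
    · rw [map_eq_zero_iff _ hB] at h1
      exact hp0 (Polynomial.leadingCoeff_eq_zero.1 h1)
    · exact Nat.cast_add_one_ne_zero _ h1
  · exact ⟨p, hp, hd⟩

/-- The subalgebra generated by the terms of index less than `v` of a sequence. -/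
def initialAlg (K : Type*) {S : Type*} [CommRing K] [CommRing S] [Algebra K S] (x : ℕ → S)
    (v : ℕ) : Subalgebra K S := Algebra.adjoin K (x '' Set.Iio v)

lemma initialAlg_mono {K S : Type*} [CommRing K] [CommRing S] [Algebra K S] (x : ℕ → S) {v w : ℕ}
    (h : v ≤ w) : initialAlg K x v ≤ initialAlg K x w :=
  Algebra.adjoin_mono (Set.image_mono (Set.Iio_subset_Iio h))

lemma mem_initialAlg {K S : Type*} [CommRing K] [CommRing S] [Algebra K S] (x : ℕ → S) {v w : ℕ}
    (h : v < w) : x v ∈ initialAlg K x w :=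
  Algebra.subset_adjoin ⟨v, h, rfl⟩

section Sequence

variable {K S : Type*} [CommRing K] [Differential K] [CommRing S] [Differential S] [Algebra K S]
  [DifferentialAlgebra K S] {x : ℕ → S} {r : ℕ}

lemma deriv_mem_initialAlg (hx : ∀ v, (x v)′ = x (v + r)) {v : ℕ} {a : S} (ha : a ∈ initialAlg K x v) :
    a′ ∈ initialAlg K x (v + r) := by
  have hle := initialAlg_mono (K := K) x (Nat.le_add_right v r)
  induction ha using Algebra.adjoin_induction with
  | mem a ha =>
    obtain ⟨w, hw, rfl⟩ := ha
    rw [hx]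
    exact mem_initialAlg x (Nat.add_lt_add_right hw r)
  | algebraMap t => rw [deriv_algebraMap]; exact Subalgebra.algebraMap_mem _ _
  | add a b _ _ ha hb => rw [map_add]; exact add_mem ha hb
  | mul a b h h' ha hb =>
    rw [Derivation.leibniz, smul_eq_mul, smul_eq_mul]
    exact add_mem (mul_mem (hle h) hb) (mul_mem (hle h') ha)

/-- The chain rule: the only new term `x (v + r)` enters linearly, with the formal derivative as
coefficient. The remainder differentiates the coefficients, and `0 < r` ensures that `x v` itself is
available for it. -/
lemma deriv_aeval_initialAlg (hx : ∀ v, (x v)′ = x (v + r)) (hr : 0 < r) {v : ℕ}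
    (p : Polynomial (initialAlg K x v)) :
    ∃ b ∈ initialAlg K x (v + r), (Polynomial.aeval (x v) p)′ =
      Polynomial.aeval (x v) p.derivative * x (v + r) + b := by
  have hxv : x v ∈ initialAlg K x (v + r) := mem_initialAlg x (Nat.lt_add_of_pos_right hr)
  induction p using Polynomial.induction_on' with
  | add p q hp hq =>
    obtain ⟨b, hb, hb'⟩ := hp
    obtain ⟨c, hc, hc'⟩ := hq
    exact ⟨b + c, add_mem hb hc, by rw [map_add, map_add, hb', hc', map_add, map_add]; ring⟩
  | monomial n a =>
    refine ⟨(a : S)′ * x v ^ n, mul_mem (deriv_mem_initialAlg hx a.2) (pow_mem hxv _), ?_⟩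
    rw [Polynomial.aeval_monomial, Polynomial.derivative_monomial, Polynomial.aeval_monomial,
      Derivation.leibniz, Derivation.leibniz_pow, hx, map_mul, map_natCast]
    simp only [smul_eq_mul, nsmul_eq_mul]
    change (a : S) * _ + _ * (a : S)′ = (a : S) * _ * _ * _ + _
    ring

end Sequence

/-- Differentiating a separable relation for `y v` yields a linear equation for `y (v + r)` whose
leading coefficient is nonzero. -/
lemma isAlgebraic_initialAlg_add {K L : Type*} [CommRing K] [Differential K] [Field L] [CharZero L]
    [Differential L] [Algebra K L] [DifferentialAlgebra K L] {y : ℕ → L} {r : ℕ} (hr : 0 < r)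
    (hy : ∀ v, (y v)′ = y (v + r)) {v : ℕ} (h : IsAlgebraic (initialAlg K y v) (y v)) :
    IsAlgebraic (initialAlg K y (v + r)) (y (v + r)) := by
  obtain ⟨p, hp, hp'⟩ := exists_separable_relation Subtype.val_injective h
  obtain ⟨b, hb, hb'⟩ := deriv_aeval_initialAlg hy hr p
  rw [hp, map_zero] at hb'
  have hs : Polynomial.aeval (y v) p.derivative ∈ initialAlg K y (v + r) := by
    rw [Polynomial.aeval_eq_sum_range]
    refine sum_mem fun i _ => mul_mem (initialAlg_mono y (Nat.le_add_right v r) (SetLike.coe_mem _))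
      (pow_mem (mem_initialAlg y (Nat.lt_add_of_pos_right hr)) _)
  refine ⟨Polynomial.C ⟨_, hs⟩ * Polynomial.X + Polynomial.C ⟨b, hb⟩, fun h0 => ?_, ?_⟩
  · have := congrArg (fun q => (q.coeff 1 : L)) h0
    simp [hp'] at this
  · rw [map_add, map_mul, Polynomial.aeval_C, Polynomial.aeval_C, Polynomial.aeval_X]
    exact hb'.symm

/-- Once a residue class mod `r` meets `s`, it stays in `s` from there on. The bound lies past one
chosen element of each class that meets `s`. -/
lemma exists_bound_of_add_mem {s : Set ℕ} {r : ℕ} (hs : ∀ v ∈ s, v + r ∈ s) (hr : 0 < r) :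
    ∃ N, ∀ v ∈ s, N ≤ v → ∃ w ∈ s, w + r = v := by
  classical
  have hs' : ∀ v ∈ s, ∀ j, v + j * r ∈ s := fun v hv j => by
    induction j with
    | zero => simpa using hv
    | succ j ih => rw [Nat.succ_mul, ← add_assoc]; exact hs _ ih
  have hb : ∀ i : Fin r, ∃ b, ∀ v ∈ s, v % r = i → b ≤ v → ∃ w ∈ s, w + r = v := by
    intro i
    by_cases h : ∃ w ∈ s, w % r = i
    · obtain ⟨w, hw, hwi⟩ := h
      -- The `+ 1` excludes `v = w`, so `v` exceeds `w` by a positive multiple of `r`.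
      refine ⟨w + 1, fun v _ hvi hle => ?_⟩
      have hdvd : r ∣ v - w := (Nat.modEq_iff_dvd' (by omega)).1 (hwi.trans hvi.symm)
      obtain ⟨j, hj⟩ := hdvd
      rcases j with _ | j
      · omega
      · refine ⟨w + j * r, hs' w hw j, ?_⟩
        have : r * (j + 1) = j * r + r := by ring
        omega
    · exact ⟨0, fun v hv hvi => (h ⟨v, hv, hvi⟩).elim⟩
  choose b hb using hb
  refine ⟨Finset.univ.sup b, fun v hv hle => hb ⟨v % r, Nat.mod_lt _ hr⟩ v hv rfl ?_⟩
  exact (Finset.le_sup (f := b) (Finset.mem_univ _)).trans hle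

lemma graphAlg_Iio {K L M : Type*} [CommRing K] [CommRing L] [CommRing M] [Algebra K L]
    [Algebra K M] (y : ℕ → L) (z : ℕ → M) (v : ℕ) :
    graphAlg K (fun i : Set.Iio v => y i.1) (fun i : Set.Iio v => z i.1) =
      initialAlg K (fun i => (y i, z i)) v := by
  rw [graphAlg, initialAlg, Set.image_eq_range]

/-- The product of two differential rings. -/
abbrev prodDifferential (L M : Type*) [CommRing L] [CommRing M] [Differential L]
    [Differential M] : Differential (L × M) :=
  differentialOfLeibniz
    (AddMonoidHom.prodMap Differential.deriv.toLinearMap.toAddMonoidHom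
      Differential.deriv.toLinearMap.toAddMonoidHom)
    (fun _ _ => Prod.ext (Derivation.leibniz _ _ _) (Derivation.leibniz _ _ _))

/-- A differential specialization in characteristic zero is determined by finitely many of its
terms. -/
theorem exists_bound_isSpec {K : Type*} {L : Type*} [CommRing K] [Differential K] [Field L]
    [CharZero L] [Differential L] [Algebra K L] [DifferentialAlgebra K L] (y : ℕ → L) {r : ℕ}
    (hr : 0 < r) (hy : ∀ v, (y v)′ = y (v + r)) :
    ∃ N, ∀ (M : Type u) [CommRing M] [Differential M] [Algebra K M] [DifferentialAlgebra K M]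
      (z : ℕ → M), (∀ v, (z v)′ = z (v + r)) →
      (∀ n, IsSpec K (fun i : Set.Iio (n * r) => y i.1) (fun i : Set.Iio (n * r) => z i.1) →
        ∀ p ∈ graphAlg K (fun i : Set.Iio (n * r) => y i.1) (fun i : Set.Iio (n * r) => z i.1),
          p.1 ≠ 0 → p.2 ∈ nonZeroDivisors M) →
      IsSpec K (fun i : Set.Iio N => y i.1) (fun i : Set.Iio N => z i.1) →
      ∀ v, IsSpec K (fun i : Set.Iio v => y i.1) (fun i : Set.Iio v => z i.1) := by
  obtain ⟨N, hN⟩ := exists_bound_of_add_mem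
    (s := {v | IsAlgebraic (initialAlg K y v) (y v)})
    (fun v hv => isAlgebraic_initialAlg_add hr hy hv) hr
  refine ⟨N, fun M _ _ _ _ z hz hnzd hspec => ?_⟩
  simp only [IsSpec, graphAlg_Iio] at hnzd hspec ⊢
  -- The two sequences are differentiated together: in `L × M` the pairs satisfy the same recursion,
  -- so an identity among pairs yields identities for `y` and `z` at once.
  let _ := prodDifferential L M
  have hda : DifferentialAlgebra K (L × M) :=
    ⟨fun a => Prod.ext (deriv_algebraMap (B := L) a) (deriv_algebraMap (B := M) a)⟩
  set x : ℕ → L × M := fun i => (y i, z i) with hxdef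
  have hx : ∀ v, (x v)′ = x (v + r) := fun v => Prod.ext (hy v) (hz v)
  have hmono : ∀ {v w : ℕ}, v ≤ w → (∀ p ∈ initialAlg K x w, p.1 = 0 → p.2 = 0) →
      ∀ p ∈ initialAlg K x v, p.1 = 0 → p.2 = 0 := fun hvw h p hp =>
    h p (initialAlg_mono x hvw hp)
  have hfst : ∀ v, (initialAlg K x v).map (AlgHom.fst K L M) = initialAlg K y v := fun v => by
    rw [initialAlg, AlgHom.map_adjoin, ← Set.image_comp]
    rfl
  have heval : ∀ v (q : Polynomial (initialAlg K x v)), (Polynomial.aeval (x v) q).1 =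
      (q.map ((RingHom.fst L M).comp (algebraMap (initialAlg K x v) (L × M)))).eval (y v) := by
    intro v q
    rw [Polynomial.eval_map, Polynomial.aeval_def]
    exact Polynomial.hom_eval₂ q _ (RingHom.fst L M) (x v)
  have hmem : ∀ v (q : Polynomial (initialAlg K x v)),
      Polynomial.aeval (x v) q ∈ initialAlg K x (v + 1) := by
    intro v q
    rw [Polynomial.aeval_eq_sum_range]
    exact sum_mem fun i _ => mul_mem (initialAlg_mono x (Nat.le_succ v) (SetLike.coe_mem _))
      (pow_mem (mem_initialAlg x (Nat.lt_succ_self v)) _)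
  have hstep : ∀ v, N ≤ v → (∀ p ∈ initialAlg K x v, p.1 = 0 → p.2 = 0) →
      ∀ p ∈ initialAlg K x (v + 1), p.1 = 0 → p.2 = 0 := by
    intro v hv ih f hf hf0
    by_cases halg : IsAlgebraic (initialAlg K y v) (y v)
    · obtain ⟨w, hw, rfl⟩ := hN v halg hv
      obtain ⟨p, hp, hp'⟩ := exists_separable_relation Subtype.val_injective hw
      -- The coefficients of the relation are lifted from `L` to the graph algebra, so that the
      -- relation also makes sense for `z`.
      obtain ⟨q, hq⟩ : p.map (algebraMap _ L) ∈
          Polynomial.lifts ((RingHom.fst L M).comp (algebraMap (initialAlg K x w) (L × M))) := by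
        rw [Polynomial.lifts_iff_coeff_lifts]
        intro i
        rw [Polynomial.coeff_map]
        obtain ⟨a, ha, ha'⟩ := (hfst w).ge (p.coeff i).2
        exact ⟨⟨a, ha⟩, ha'⟩
      rw [Polynomial.coe_mapRingHom] at hq
      have h1 : (Polynomial.aeval (x w) q).1 = 0 := by
        rw [heval, hq, Polynomial.eval_map_algebraMap, hp]
      have h2 : (Polynomial.aeval (x w) q.derivative).1 ≠ 0 := by
        rw [heval, ← Polynomial.derivative_map, hq, Polynomial.derivative_map,
          Polynomial.eval_map_algebraMap]
        exact hp'
      -- Since `w + 1 ≤ w + r`, the induction hypothesis already covers this relation and its second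
      -- component vanishes too.
      have h3 : Polynomial.aeval (x w) q = 0 :=
        Prod.ext h1 (hmono (by omega) ih _ (hmem w q) h1)
      obtain ⟨b, hb, hb'⟩ := deriv_aeval_initialAlg hx hr q
      rw [h3, map_zero] at hb'
      set s := Polynomial.aeval (x w) q.derivative with hs
      -- The hypothesis `hnzd` concerns complete blocks of length `r`. The end of the block
      -- containing `w` lies beyond `w` and at most at `w + r`, where the induction hypothesis
      -- applies.
      have hlt : w < (w / r + 1) * r := by
        rw [mul_comm]; exact Nat.lt_mul_div_succ w hr
      have hle : (w / r + 1) * r ≤ w + r := by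
        rw [Nat.succ_mul]; exact Nat.add_le_add_right (Nat.div_mul_le_self w r) r
      have hsnzd : s.2 ∈ nonZeroDivisors M := hnzd _ (hmono hle ih) s
        (initialAlg_mono x hlt (hmem w _)) h2
      -- As `s * x (w + r) = -b`, multiplying by a power of `s` eliminates the new term from `f`.
      -- The nonzerodivisor `s.2` is cancelled afterwards.
      obtain ⟨e, he⟩ : ∃ e : ℕ, s ^ e * f ∈ initialAlg K x (w + r) := by
        refine exists_pow_mul_mem (initialAlg_mono x (by omega) (hmem w _)) ?_ hf
        rintro _ ⟨i, hi, rfl⟩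
        rcases Nat.lt_succ_iff_lt_or_eq.1 hi with hi | rfl
        · exact ⟨0, by rw [pow_zero, one_mul]; exact mem_initialAlg x hi⟩
        · refine ⟨1, ?_⟩
          rw [pow_one, eq_neg_of_add_eq_zero_left hb'.symm]
          exact neg_mem hb
      have h4 : s.2 ^ e * f.2 = 0 := ih _ he (by simp [hf0])
      exact (mul_right_mem_nonZeroDivisors_eq_zero_iff (pow_mem hsnzd e)).1
        (by rw [mul_comm]; exact h4)
    -- Transcendental step: write `f` as a polynomial in the new term. A relation for `y v` must
    -- have all coefficients zero in `L`, and then the induction hypothesis kills their second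
    -- components.
    · obtain ⟨q, rfl⟩ : ∃ q : Polynomial (initialAlg K x v), Polynomial.aeval (x v) q = f := by
        clear hf0
        induction hf using Algebra.adjoin_induction with
        | mem f hf =>
          obtain ⟨i, hi, rfl⟩ := hf
          rcases Nat.lt_succ_iff_lt_or_eq.1 hi with hi | rfl
          · exact ⟨Polynomial.C ⟨x i, mem_initialAlg x hi⟩, by rw [Polynomial.aeval_C]; rfl⟩
          · exact ⟨Polynomial.X, Polynomial.aeval_X _⟩
        | algebraMap t =>
          exact ⟨Polynomial.C (algebraMap K _ t), by rw [Polynomial.aeval_C]; rfl⟩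
        | add a b _ _ ha hb =>
          obtain ⟨p, hp⟩ := ha
          obtain ⟨q, hq⟩ := hb
          exact ⟨p + q, by rw [map_add, hp, hq]⟩
        | mul a b _ _ ha hb =>
          obtain ⟨p, hp⟩ := ha
          obtain ⟨q, hq⟩ := hb
          exact ⟨p * q, by rw [map_mul, hp, hq]⟩
      obtain ⟨p, hp⟩ : q.map ((RingHom.fst L M).comp (algebraMap (initialAlg K x v) (L × M))) ∈
          Polynomial.lifts (algebraMap (initialAlg K y v) L) := by
        rw [Polynomial.lifts_iff_coeff_lifts]
        intro i
        rw [Polynomial.coeff_map]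
        exact ⟨⟨_, (hfst v).le ⟨_, (q.coeff i).2, rfl⟩⟩, rfl⟩
      rw [Polynomial.coe_mapRingHom] at hp
      rw [heval, ← hp, Polynomial.eval_map_algebraMap] at hf0
      have hp0 : p = 0 := by
        by_contra hne
        exact halg ⟨p, hne, hf0⟩
      have hq0 : q = 0 := by
        ext1 i
        have h1 : ((q.coeff i : L × M)).1 = 0 := by
          have := congrArg (fun f => Polynomial.coeff f i) hp
          simp only [hp0, Polynomial.map_zero, Polynomial.coeff_zero, Polynomial.coeff_map] at this
          exact this.symm
        exact Subtype.ext (Prod.ext h1 (ih _ (q.coeff i).2 h1))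
      rw [hq0, map_zero]
      rfl
  intro v
  rcases le_total v N with hv | hv
  · exact hmono hv hspec
  · induction v, hv using Nat.le_induction with
    | base => exact hspec
    | succ v hv ih => exact hstep v hv ih

/-! ### Equations over the constants -/

section ConstIdeal

variable {ι : Type*} [Fintype ι] (c K : Type*) {L : Type*} [Field c] [Field K] [Field L]
  [Algebra c L] [Algebra K L] (V : Matrix ι ι L)

/-- The ideal generated by the polynomials `f(V Y)`, for `f` over `K` with `f(V) = 0`. -/
def translateIdeal : Ideal (MvPolynomial (ι × ι) L) :=
  Ideal.span {h | ∃ f : MvPolynomial (ι × ι) K,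
    MvPolynomial.aeval (fun v => V v.1 v.2) f = 0 ∧
    h = MvPolynomial.aeval
      (fun v => ∑ l, MvPolynomial.C (V v.1 l) * MvPolynomial.X (R := L) (l, v.2)) f}

/-- The polynomials with constant coefficients in `translateIdeal`. -/
def constIdeal : Ideal (MvPolynomial (ι × ι) c) :=
  (translateIdeal K V).comap (MvPolynomial.map (algebraMap c L))

variable {c K V}

/-- Substituting `W` for Y and applying `α` turns f(VY) into f(α(V)W), which vanishes because
`α(V)W` specializes `V`. -/
lemma eval₂_translateIdeal {D : Type*} [CommRing D] [Algebra K D] (α : L →ₐ[K] D)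
    (W : Matrix ι ι D)
    (hW : IsSpec K (fun v : ι × ι => V v.1 v.2) (fun v : ι × ι => (V.map α * W) v.1 v.2))
    {h : MvPolynomial (ι × ι) L} (hh : h ∈ translateIdeal K V) :
    MvPolynomial.eval₂ (α : L →+* D) (fun v => W v.1 v.2) h = 0 := by
  rw [isSpec_iff] at hW
  suffices hle : translateIdeal K V ≤
      RingHom.ker (MvPolynomial.eval₂Hom (α : L →+* D) fun v => W v.1 v.2) from hle hh
  rw [translateIdeal, Ideal.span_le]
  rintro _ ⟨f, hf, rfl⟩
  refine Eq.trans ?_ (hW f hf)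
  have : ((MvPolynomial.eval₂Hom (α : L →+* D) fun v => W v.1 v.2).comp
      (MvPolynomial.aeval (R := K) (fun v : ι × ι => ∑ l, MvPolynomial.C (V v.1 l) *
        MvPolynomial.X (R := L) (l, v.2))).toRingHom) =
      (MvPolynomial.aeval (R := K) fun v : ι × ι => (V.map α * W) v.1 v.2).toRingHom := by
    apply MvPolynomial.ringHom_ext
    · intro r
      simp [MvPolynomial.algebraMap_apply]
    · intro v
      simp [Matrix.mul_apply]
  exact congrArg (fun φ => φ f) this

/-- The target `D` is an arbitrary algebra, since the equations are needed both in `L ⊗ C` and in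
the differential field of the density argument. -/
lemma eval_constIdeal {D : Type*} [CommRing D] [Algebra K D] [Algebra c D] (α : L →ₐ[K] D)
    (hα : ∀ x : c, α (algebraMap c L x) = algebraMap c D x) (W : Matrix ι ι D)
    (hW : IsSpec K (fun v : ι × ι => V v.1 v.2) (fun v : ι × ι => (V.map α * W) v.1 v.2))
    {f : MvPolynomial (ι × ι) c} (hf : f ∈ constIdeal c K V) :
    MvPolynomial.aeval (fun v => W v.1 v.2) f = 0 := by
  have := eval₂_translateIdeal α W hW hf
  rw [MvPolynomial.eval₂_map] at this
  rw [MvPolynomial.aeval_def, ← this]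
  congr 1
  exact RingHom.ext fun x => (hα x).symm

variable (σ : L ≃+* L) (σK : K →+* K) (A : Matrix ι ι K)

/-- Applying σ to f(VY) gives f^σ(AVY) = h(VY) with h(Z) = f^σ(AZ), and h(V) = σ(f(V)) = 0. -/
lemma map_mem_translateIdeal (hσK : ∀ x, σ (algebraMap K L x) = algebraMap K L (σK x))
    (hV : V.map σ = A.map (algebraMap K L) * V) {h : MvPolynomial (ι × ι) L}
    (hh : h ∈ translateIdeal K V) :
    MvPolynomial.map (σ : L →+* L) h ∈ translateIdeal K V := by
  suffices hle : translateIdeal K V ≤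
      (translateIdeal K V).comap (MvPolynomial.map (σ : L →+* L)) from hle hh
  conv_lhs => rw [translateIdeal]
  rw [Ideal.span_le]
  rintro _ ⟨f, hf, rfl⟩
  refine Ideal.subset_span ⟨MvPolynomial.aeval
    (fun v => ∑ l, MvPolynomial.C (A v.1 l) * MvPolynomial.X (R := K) (l, v.2))
      (MvPolynomial.map σK f), ?_, ?_⟩
  · have : ((MvPolynomial.aeval fun v : ι × ι => V v.1 v.2).toRingHom.comp
        ((MvPolynomial.aeval (R := K) fun v : ι × ι => ∑ l, MvPolynomial.C (A v.1 l) *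
          MvPolynomial.X (R := K) (l, v.2)).toRingHom.comp (MvPolynomial.map σK))) =
        (σ : L →+* L).comp (MvPolynomial.aeval (R := K) fun v : ι × ι => V v.1 v.2).toRingHom := by
      apply MvPolynomial.ringHom_ext
      · intro r
        simp [hσK]
      · intro v
        have := congrFun (congrFun hV v.1) v.2
        simp only [Matrix.map_apply, Matrix.mul_apply] at this
        simp [this]
    refine (congrArg (fun φ => φ f) this).trans ?_
    change σ (MvPolynomial.aeval _ f) = 0
    rw [hf, map_zero]
  · have : ((MvPolynomial.map (σ : L →+* L)).comp
        (MvPolynomial.aeval (R := K) fun v : ι × ι => ∑ l, MvPolynomial.C (V v.1 l) *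
          MvPolynomial.X (R := L) (l, v.2)).toRingHom) =
        (MvPolynomial.aeval (R := K) fun v : ι × ι => ∑ l, MvPolynomial.C (V v.1 l) *
          MvPolynomial.X (R := L) (l, v.2)).toRingHom.comp
        ((MvPolynomial.aeval (R := K) fun v : ι × ι => ∑ l, MvPolynomial.C (A v.1 l) *
          MvPolynomial.X (R := K) (l, v.2)).toRingHom.comp (MvPolynomial.map σK)) := by
      apply MvPolynomial.ringHom_ext
      · intro r
        simp [MvPolynomial.algebraMap_apply, hσK]
      · intro v
        have h1 : ∀ l, σ (V v.1 l) = ∑ j, algebraMap K L (A v.1 j) * V j l := fun l => by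
          have := congrFun (congrFun hV v.1) l
          simpa only [Matrix.map_apply, Matrix.mul_apply] using this
        simp only [RingHom.comp_apply, AlgHom.toRingHom_eq_coe, RingHom.coe_coe,
          MvPolynomial.aeval_X, map_sum, map_mul, MvPolynomial.map_C, MvPolynomial.map_X, h1,
          MvPolynomial.aeval_C, MvPolynomial.algebraMap_apply, Finset.sum_mul, Finset.mul_sum]
        rw [Finset.sum_comm]
        exact Finset.sum_congr rfl fun l _ => Finset.sum_congr rfl fun j _ => by ring
    exact congrArg (fun φ => φ f) this

/-- The ideal is a σ-stable `L`-subspace, so `mem_span_of_stable` applies to the coefficient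
vectors. Fixed coefficients come from `c`. -/
lemma translateIdeal_le_span (hσK : ∀ x, σ (algebraMap K L x) = algebraMap K L (σK x))
    (hV : V.map σ = A.map (algebraMap K L) * V)
    (hc : ∀ x, σ x = x → x ∈ Set.range (algebraMap c L)) {h : MvPolynomial (ι × ι) L}
    (hh : h ∈ translateIdeal K V) :
    h ∈ Submodule.span L (MvPolynomial.map (algebraMap c L) ''
      (constIdeal c K V : Set (MvPolynomial (ι × ι) c))) := by
  let e : MvPolynomial (ι × ι) L ≃ₗ[L] ((ι × ι →₀ ℕ) →₀ L) := AddMonoidAlgebra.coeffLinearEquiv L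
  have he : ∀ p a, e p a = MvPolynomial.coeff a p := fun _ _ => rfl
  have key := mem_span_of_stable σ (((translateIdeal K V).restrictScalars L).map e.toLinearMap)
    (by
      rintro _ ⟨p, hp, rfl⟩
      refine ⟨_, map_mem_translateIdeal σ σK A hσK hV hp, ?_⟩
      ext a
      change e _ a = σ (e p a)
      rw [he, he, MvPolynomial.coeff_map]
      rfl)
    (e h) ⟨h, hh, rfl⟩
  have := Submodule.mem_map_of_mem (f := e.symm.toLinearMap) key
  rw [Submodule.map_span] at this
  have h0 : e.symm.toLinearMap (e h) = h := e.symm_apply_apply h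
  rw [h0] at this
  refine Submodule.span_mono ?_ this
  rintro _ ⟨_, ⟨⟨p, hp, rfl⟩, hfix⟩, rfl⟩
  have h1 : e.symm.toLinearMap (e.toLinearMap p) = p := e.symm_apply_apply p
  rw [h1]
  obtain ⟨q, hq⟩ : p ∈ Set.range (MvPolynomial.map (algebraMap c L)) := by
    classical
    rw [MvPolynomial.mem_range_map_iff_coeffs_subset]
    intro x hx
    rw [MvPolynomial.coeffs, Finset.coe_image] at hx
    obtain ⟨a, -, rfl⟩ := hx
    exact hc _ (hfix a)
  exact ⟨q, by
    change MvPolynomial.map (algebraMap c L) q ∈ translateIdeal K V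
    rw [hq]; exact hp, hq⟩

variable {C : Type*} [Field C] [Algebra c C] [Algebra c K] [IsScalarTower c K L]

/-- A matrix over `C` gives a specialization `V ↦ V B` if and only if it satisfies the equations
in `constIdeal`. -/
theorem isSpec_iff_constIdeal (hσK : ∀ x, σ (algebraMap K L x) = algebraMap K L (σK x))
    (hV : V.map σ = A.map (algebraMap K L) * V)
    (hc : ∀ x, σ x = x → x ∈ Set.range (algebraMap c L)) (B : Matrix ι ι C) :
    IsSpec K (fun v : ι × ι => V v.1 v.2) (fun v : ι × ι =>
      (V.map (Algebra.TensorProduct.includeLeft : L →ₐ[K] L ⊗[c] C) *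
        B.map (Algebra.TensorProduct.includeRight : C →ₐ[c] L ⊗[c] C)) v.1 v.2) ↔
    ∀ f ∈ constIdeal c K V, MvPolynomial.aeval (fun v => B v.1 v.2) f = 0 := by
  have hmap : ∀ f : MvPolynomial (ι × ι) c, MvPolynomial.aeval (fun v : ι × ι =>
      (B.map (Algebra.TensorProduct.includeRight : C →ₐ[c] L ⊗[c] C)) v.1 v.2) f =
      (Algebra.TensorProduct.includeRight : C →ₐ[c] L ⊗[c] C)
        (MvPolynomial.aeval (fun v => B v.1 v.2) f) := by
    intro f
    rw [← AlgHom.comp_apply, MvPolynomial.comp_aeval]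
    rfl
  constructor
  · intro h f hf
    have h1 := eval_constIdeal (c := c) (Algebra.TensorProduct.includeLeft : L →ₐ[K] L ⊗[c] C)
      (fun x => rfl) _ h hf
    rw [hmap] at h1
    -- The vanishing takes place in `L ⊗ C`, and `C` embeds there.
    exact (map_eq_zero_iff _ (Algebra.TensorProduct.includeRight_injective
      (FaithfulSMul.algebraMap_injective c L))).1 h1
  · intro h
    rw [isSpec_iff]
    intro f hf
    have hle : ∀ p ∈ translateIdeal K V, MvPolynomial.aeval (R := L) (fun v : ι × ι =>
        (B.map (Algebra.TensorProduct.includeRight : C →ₐ[c] L ⊗[c] C)) v.1 v.2) p = 0 := by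
      intro p hp
      have hp' := translateIdeal_le_span σ σK A hσK hV hc hp
      clear hp
      induction hp' using Submodule.span_induction with
      | mem p hp =>
        obtain ⟨q, hq, rfl⟩ := hp
        rw [MvPolynomial.aeval_map_algebraMap, hmap, h q hq, map_zero]
      | zero => exact map_zero _
      | add p q _ _ hp hq => rw [map_add, hp, hq, add_zero]
      | smul a p _ hp => rw [map_smul, hp, smul_zero]
    have h2 := hle _ (Ideal.subset_span ⟨f, hf, rfl⟩)
    refine Eq.trans ?_ h2
    have : (MvPolynomial.aeval (R := K) fun v : ι × ι =>
        (V.map (Algebra.TensorProduct.includeLeft : L →ₐ[K] L ⊗[c] C) *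
          B.map (Algebra.TensorProduct.includeRight : C →ₐ[c] L ⊗[c] C)) v.1 v.2).toRingHom =
      (MvPolynomial.aeval (R := L) (fun v : ι × ι =>
        (B.map (Algebra.TensorProduct.includeRight : C →ₐ[c] L ⊗[c] C)) v.1 v.2)).toRingHom.comp
      (MvPolynomial.aeval (R := K) (fun v : ι × ι => ∑ l, MvPolynomial.C (V v.1 l) *
        MvPolynomial.X (R := L) (l, v.2))).toRingHom := by
      apply MvPolynomial.ringHom_ext
      · intro r
        simp [MvPolynomial.algebraMap_apply, Algebra.TensorProduct.algebraMap_apply]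
      · intro v
        simp [Matrix.mul_apply, Algebra.TensorProduct.algebraMap_apply]
    exact congrArg (fun φ => φ f) this

end ConstIdeal

/-! ### Regular elements of tensor products -/

section Regular

variable {c R L C : Type*} [Field c] [CommRing R] [IsDomain R] [Field L] [Field C] [Algebra c R]
  [Algebra c L] [Algebra c C] [Algebra R L] [IsScalarTower c R L]

lemma tmul_one_mem_nonZeroDivisors {s : R} (hs : s ≠ 0) :
    s ⊗ₜ[c] (1 : C) ∈ nonZeroDivisors (R ⊗[c] C) := by
  have h : Function.Injective ((LinearMap.mulLeft c s).rTensor C) :=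
    Module.Flat.rTensor_preserves_injective_linearMap _ (mul_right_injective₀ hs)
  have h2 : ∀ y : R ⊗[c] C, (LinearMap.mulLeft c s).rTensor C y = s ⊗ₜ[c] (1 : C) * y := by
    intro y
    induction y with
    | zero => simp
    | add a b ha hb => rw [map_add, ha, hb, mul_add]
    | tmul a b => simp
  rw [mem_nonZeroDivisors_iff_left]
  intro y hy
  exact h (by rw [h2, hy, map_zero])

variable [FaithfulSMul R L]

/-- `L` is flat over `R`, being an extension of the fraction field. Tensoring the injective
multiplication by `x` with `L` over `R` gives multiplication by `φ x` on L ⊗_R (R ⊗ C) ≅ L ⊗ C. -/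
lemma map_mem_nonZeroDivisors_tensor (φ : R ⊗[c] C →+* L ⊗[c] C)
    (hφ : ∀ r x, φ (r ⊗ₜ x) = algebraMap R L r ⊗ₜ x) {x : R ⊗[c] C}
    (hx : x ∈ nonZeroDivisors (R ⊗[c] C)) : φ x ∈ nonZeroDivisors (L ⊗[c] C) := by
  have : Module.Flat R L := by
    let _ := FractionRing.liftAlgebra R L
    have := IsLocalization.flat (R := R) (FractionRing R) (nonZeroDivisors R)
    exact Module.Flat.trans R (FractionRing R) L
  let e := TensorProduct.AlgebraTensorModule.cancelBaseChange c R R L C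
  have he : ∀ (l : L) (x y : R ⊗[c] C), e (l ⊗ₜ[R] (x * y)) =
      φ x * e (l ⊗ₜ[R] y) := by
    intro l x y
    induction x with
    | zero => simp
    | add a b ha hb => rw [add_mul, TensorProduct.tmul_add, map_add, ha, hb, map_add, add_mul]
    | tmul a b =>
      induction y with
      | zero => simp
      | add y z hy hz => rw [mul_add, TensorProduct.tmul_add, map_add, hy, hz,
          TensorProduct.tmul_add, map_add, mul_add]
      | tmul a' b' =>
        simp [e, hφ, Algebra.smul_def, mul_assoc]
  have h : Function.Injective ((LinearMap.mulLeft R x).lTensor L) :=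
    Module.Flat.lTensor_preserves_injective_linearMap _ (by
      intro a b hab
      exact (mul_cancel_left_mem_nonZeroDivisors hx).1 hab)
  have h2 : ∀ y, e ((LinearMap.mulLeft R x).lTensor L y) = φ x * e y := by
    intro y
    induction y with
    | zero => simp
    | add a b ha hb => rw [map_add, map_add, ha, hb, map_add, mul_add]
    | tmul a b => rw [LinearMap.lTensor_tmul, LinearMap.mulLeft_apply, he]
  rw [mem_nonZeroDivisors_iff_left]
  intro y hy
  obtain ⟨y, rfl⟩ := e.surjective y
  rw [← h2] at hy
  rw [h (((map_eq_zero_iff _ e.injective).1 hy).trans (map_zero _).symm), map_zero]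

end Regular

/-! ### Prolongations and differential homomorphisms -/

lemma map_iterate_deriv {R S : Type*} [CommRing R] [CommRing S] [Differential R] [Differential S]
    (f : R →+* S) (hf : ∀ x, f x′ = (f x)′) (j : ℕ) (x : R) :
    f ((⇑(Differential.deriv (R := R)))^[j] x) = (⇑(Differential.deriv (R := S)))^[j] (f x) := by
  induction j with
  | zero => rfl
  | succ j ih => rw [Function.iterate_succ_apply', Function.iterate_succ_apply', hf, ih]

lemma prolongMatrix_map {m : ℕ} {R S : Type*} [CommRing R] [CommRing S] [Differential R]
    [Differential S] (f : R →+* S) (hf : ∀ x, f x′ = (f x)′) (n : ℕ)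
    (B : Matrix (Fin m) (Fin m) R) :
    prolongMatrix n (B.map f) = (prolongMatrix n B).map f := by
  ext p q
  simp [prolongMatrix, map_iterate_deriv f hf]

lemma prolongMatrix_zero_right {m : ℕ} {S : Type*} [CommRing S] [Differential S] (n : ℕ)
    (B : Matrix (Fin m) (Fin m) S) (j : Fin (n + 1)) (a b : Fin m) :
    prolongMatrix n B (j, a) (0, b) = (⇑(Differential.deriv (R := S)))^[j] (B a b) := by
  simp [prolongMatrix]

/-- The first block column determines the matrix through integer multiples. These are polynomial
relations, so every specialization of a prolonged matrix inherits them. -/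
lemma prolongMatrix_eq {m : ℕ} {S : Type*} [CommRing S] [Differential S] (n : ℕ)
    (B : Matrix (Fin m) (Fin m) S) (p q : Fin (n + 1) × Fin m) :
    prolongMatrix n B p q = ((p.1 : ℕ).choose q.1 : S) *
      prolongMatrix n B (⟨p.1 - q.1, by omega⟩, p.2) (0, q.2) := by
  simp [prolongMatrix]

section Solution

variable {m : ℕ} {k : Type u} [Field k] [Differential k]
  (σ : k ≃+* k) (hσ : ∀ x, σ x′ = (σ x)′) (A : GL (Fin m) k)

/-! ### The base field and the fundamental matrix -/

instance : Differential (kConstL σ hσ A) :=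
  differentialOfLeibniz
    (AddMonoidHom.mk' (fun x => ⟨(x : GenField m k)′, deriv_mem_kConstL σ hσ A x.2⟩)
      (fun x y => by ext; simp))
    (fun x y => by ext; simp)

instance : DifferentialAlgebra (kConstL σ hσ A) (GenField m k) where
  deriv_algebraMap _ := rfl

instance : Algebra (constL σ hσ A) (kConstL σ hσ A) := IntermediateField.algebra' _

instance (N : ℕ∞) : CommRing (solRing σ hσ A N) := Subalgebra.toCommRing _

instance (N : ℕ∞) : Algebra (kConstL σ hσ A) (solRing σ hσ A N) := Subalgebra.algebra _

instance (N : ℕ∞) : Module (kConstL σ hσ A) (solRing σ hσ A N) := Algebra.toModule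

instance (N : ℕ∞) : Module (constL σ hσ A) (solRing σ hσ A N) := Algebra.toModule

instance (N : ℕ∞) : SMul (kConstL σ hσ A) (solRing σ hσ A N) := Algebra.toSMul

instance (N : ℕ∞) : SMul (constL σ hσ A) (solRing σ hσ A N) := Algebra.toSMul

instance (N : ℕ∞) : IsScalarTower (constL σ hσ A) (kConstL σ hσ A) (solRing σ hσ A N) :=
  IsScalarTower.of_algebraMap_eq fun _ => rfl

instance (N : ℕ∞) : IsScalarTower (constL σ hσ A) (solRing σ hσ A N) (GenField m k) :=
  IsScalarTower.of_algebraMap_eq fun _ => rfl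

/-- The restriction of `σ` to `k C_L`. -/
def sigmaK : kConstL σ hσ A →+* kConstL σ hσ A where
  toFun x := ⟨sigmaL σ hσ A x, sigmaL_mem_kConstL σ hσ A x.2⟩
  map_one' := Subtype.ext (map_one _)
  map_zero' := Subtype.ext (map_zero _)
  map_add' _ _ := Subtype.ext (map_add _ _ _)
  map_mul' _ _ := Subtype.ext (map_mul _ _ _)

/-- The inclusion of `k` into `k C_L`. -/
def baseToK : k →+* kConstL σ hσ A :=
  (algebraMap k (GenField m k)).codRestrict (kConstL σ hσ A) fun x =>
    IntermediateField.subset_adjoin (constL σ hσ A) _ ⟨x, rfl⟩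

/-- The prolongation of the matrix `A`, over `k C_L`. -/
def prolongA (n : ℕ) : Matrix (Fin (n + 1) × Fin m) (Fin (n + 1) × Fin m) (kConstL σ hσ A) :=
  prolongMatrix n ((A : Matrix (Fin m) (Fin m) k).map (baseToK σ hσ A))

/-- Specializing every X^{(j)} to the identity matrix sends the determinant to 1. -/
lemma det_X_ne_zero (m : ℕ) (k : Type u) [Field k] : (GenField.X m k 0).det ≠ 0 := by
  have h : GenField.X m k 0 = (DiffPoly.X 0 : Matrix (Fin m) (Fin m) (DiffPoly m k)).map
      (algebraMap (DiffPoly m k) (GenField m k)) := rfl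
  rw [h, ← RingHom.mapMatrix_apply, ← RingHom.map_det, Ne,
    map_eq_zero_iff _ (IsFractionRing.injective (DiffPoly m k) (GenField m k))]
  intro h0
  have h1 := congrArg (MvPolynomial.eval
    fun p : ℕ × Fin m × Fin m => (1 : Matrix (Fin m) (Fin m) k) p.2.1 p.2.2) h0
  rw [RingHom.map_det, map_zero] at h1
  have h2 : (MvPolynomial.eval
      fun p : ℕ × Fin m × Fin m => (1 : Matrix (Fin m) (Fin m) k) p.2.1 p.2.2).mapMatrix
      (DiffPoly.X 0 : Matrix (Fin m) (Fin m) (DiffPoly m k)) = 1 := by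
    ext a b
    simp [DiffPoly.X]
  rw [h2, Matrix.det_one] at h1
  exact one_ne_zero h1

/-- The generic matrix `X`, as an invertible matrix over `L`. -/
def XL (m : ℕ) (k : Type u) [Field k] : GL (Fin m) (GenField m k) :=
  Matrix.GeneralLinearGroup.mkOfDetNeZero _ (det_X_ne_zero m k)

/-- The fundamental matrix of the prolonged system, over `L`. -/
def jetX (m : ℕ) (k : Type u) [Field k] [Differential k] (n : ℕ) :
    Matrix (Fin (n + 1) × Fin m) (Fin (n + 1) × Fin m) (GenField m k) :=
  prolongMatrix n (GenField.X m k 0)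

/-- The fundamental matrix of the prolonged system, as an invertible matrix over `L`. -/
def fundL (m : ℕ) (k : Type u) [Field k] [Differential k] (n : ℕ) :
    GL (Fin (n + 1) × Fin m) (GenField m k) := prolong n (XL m k)

lemma fundL_val (n : ℕ) : (fundL m k n).1 = jetX m k n := rfl

lemma jetX_zero_right (n : ℕ) (j : Fin (n + 1)) (a b : Fin m) :
    jetX m k n (j, a) (0, b) = GenField.X m k j a b := by
  rw [jetX, prolongMatrix_zero_right, ← X_iterate]

lemma jetX_apply (n : ℕ) (p q : Fin (n + 1) × Fin m) :
    jetX m k n p q =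
      ((p.1 : ℕ).choose q.1 : GenField m k) * GenField.X m k (p.1 - q.1) p.2 q.2 := by
  rw [jetX, prolongMatrix, Matrix.of_apply, ← X_iterate]

/-- Prolongation is multiplicative and natural for differential homomorphisms, so it can be applied
to σ(X) = AX. -/
lemma sigmaL_jetX (n : ℕ) : (jetX m k n).map (sigmaL σ hσ A) =
    (prolongA σ hσ A n).map (algebraMap (kConstL σ hσ A) (GenField m k)) *
      jetX m k n := by
  have h1 := prolongMatrix_map ((sigmaL σ hσ A : GenField m k →+* GenField m k))
    (sigmaL_deriv σ hσ A) n (GenField.X m k 0)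
  have h2 := prolongMatrix_map (algebraMap (kConstL σ hσ A) (GenField m k))
    (fun x => (deriv_algebraMap x).symm) n
    ((A : Matrix (Fin m) (Fin m) k).map (baseToK σ hσ A))
  rw [jetX, prolongA, ← h2, ← prolongMatrix_mul]
  refine h1.symm.trans (congrArg _ ?_)
  exact sigmaL_X σ hσ A

/-- The fundamental matrix over `F_N C_L`, for `n ≤ N`. -/
def fundR {N : ℕ∞} (n : ℕ) (hn : (n : ℕ∞) ≤ N) :
    Matrix (Fin (n + 1) × Fin m) (Fin (n + 1) × Fin m) (solRing σ hσ A N) :=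
  Matrix.of fun p q => ((p.1 : ℕ).choose q.1 : solRing σ hσ A N) *
    solX σ hσ A N (p.1 - q.1) (le_trans (by exact_mod_cast (by omega : (p.1 : ℕ) - q.1 ≤ n)) hn)
      p.2 q.2

lemma fundR_val {N : ℕ∞} (n : ℕ) (hn : (n : ℕ∞) ≤ N) :
    (fundR σ hσ A n hn).map (solRing σ hσ A N).val = jetX m k n := by
  ext p q
  rw [jetX_apply]
  simp [fundR, solX]

lemma fundR_zero_right {N : ℕ∞} (n : ℕ) (hn : (n : ℕ∞) ≤ N) (j : Fin (n + 1)) (a b : Fin m)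
    (hj : ((j : ℕ) : ℕ∞) ≤ N) :
    fundR σ hσ A n hn (j, a) (0, b) = solX σ hσ A N j hj a b := by
  apply Subtype.ext
  simp [fundR, solX]

lemma sigmaRing_fundR {N : ℕ∞} (n : ℕ) (hn : (n : ℕ∞) ≤ N) :
    (fundR σ hσ A n hn).map (sigmaRing σ hσ A N) =
      (prolongA σ hσ A n).map (algebraMap (kConstL σ hσ A) (solRing σ hσ A N)) *
        fundR σ hσ A n hn := by
  have hinj : Function.Injective (solRing σ hσ A N).val := Subtype.val_injective
  apply Matrix.map_injective hinj
  have h1 : ((fundR σ hσ A n hn).map (sigmaRing σ hσ A N)).map (solRing σ hσ A N).val =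
      ((fundR σ hσ A n hn).map (solRing σ hσ A N).val).map (sigmaL σ hσ A) := rfl
  have h2 : ((prolongA σ hσ A n).map (algebraMap (kConstL σ hσ A) (solRing σ hσ A N))).map
      (solRing σ hσ A N).val =
      (prolongA σ hσ A n).map (algebraMap (kConstL σ hσ A) (GenField m k)) := rfl
  dsimp only
  rw [h1, Matrix.map_mul, fundR_val, sigmaL_jetX, h2]

instance (N : ℕ∞) : SMulCommClass (constL σ hσ A) (kConstL σ hσ A) (solRing σ hσ A N) :=
  IsScalarTower.to_smulCommClass

instance : SMulCommClass (constL σ hσ A) (kConstL σ hσ A) (GenField m k) :=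
  IsScalarTower.to_smulCommClass

section Instances

variable (C : Type u) [Field C] [Algebra (constL σ hσ A) C]

instance (N : ℕ∞) : CommRing (ringC σ hσ A C N) := Algebra.TensorProduct.instCommRing

instance (N : ℕ∞) : Algebra (kConstL σ hσ A) (ringC σ hσ A C N) :=
  Algebra.TensorProduct.leftAlgebra

instance : CommRing (GenField m k ⊗[constL σ hσ A] C) := Algebra.TensorProduct.instCommRing

instance : Algebra (kConstL σ hσ A) (GenField m k ⊗[constL σ hσ A] C) :=
  Algebra.TensorProduct.leftAlgebra

end Instances

/-! ### Homomorphisms from the rings generated by the solution -/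

lemma solRing_hom_ext {N : ℕ∞} {S : Type*} [CommRing S] {f g : solRing σ hσ A N →+* S}
    (hbase : ∀ r : kConstL σ hσ A, f (algebraMap _ _ r) = g (algebraMap _ _ r))
    (hX : ∀ (j : ℕ) (hj : (j : ℕ∞) ≤ N) (a b : Fin m),
      f (solX σ hσ A N j hj a b) = g (solX σ hσ A N j hj a b)) : f = g := by
  have hdet : f (solX σ hσ A N 0 (zero_le)).det = g (solX σ hσ A N 0 (zero_le)).det := by
    rw [RingHom.map_det, RingHom.map_det]
    congr 1
    ext a b
    exact hX 0 _ a b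
  apply RingHom.ext
  rintro ⟨x, hx⟩
  induction hx using Algebra.adjoin_induction with
  | mem x hx =>
    rcases hx with ⟨j, hj, a, b, rfl⟩ | rfl
    · exact hX j hj a b
    · set u : solRing σ hσ A N := ⟨(GenField.X m k 0).det⁻¹, _⟩
      have hu : u * (solX σ hσ A N 0 (zero_le)).det = 1 := by
        apply Subtype.ext
        have h1 : ((solX σ hσ A N 0 (zero_le)).det : GenField m k) = (GenField.X m k 0).det :=
          RingHom.map_det (solRing σ hσ A N).val.toRingHom _
        rw [MulMemClass.coe_mul, h1]
        exact inv_mul_cancel₀ (det_X_ne_zero m k)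
      -- Uniqueness of inverses: `f` and `g` agree on the determinant, hence on its inverse.
      calc f u = f u * (g (u * (solX σ hσ A N 0 (zero_le)).det)) := by rw [hu, map_one, mul_one]
        _ = f (u * (solX σ hσ A N 0 (zero_le)).det) * g u := by
          rw [map_mul, map_mul, hdet]; ring
        _ = g u := by rw [hu, map_one, one_mul]
  | algebraMap r => exact hbase r
  | add x y hx hy h h' =>
    have : (⟨x + y, add_mem hx hy⟩ : solRing σ hσ A N) = ⟨x, hx⟩ + ⟨y, hy⟩ := rfl
    rw [this, RingHom.map_add, RingHom.map_add, h, h']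
  | mul x y hx hy h h' =>
    have : (⟨x * y, mul_mem hx hy⟩ : solRing σ hσ A N) = ⟨x, hx⟩ * ⟨y, hy⟩ := rfl
    rw [this, RingHom.map_mul, RingHom.map_mul, h, h']

variable (C : Type u) [Field C] [Algebra (constL σ hσ A) C]

lemma ringC_hom_ext {N : ℕ∞} {S : Type*} [CommRing S] {f g : ringC σ hσ A C N →+* S}
    (hC : ∀ x, f (inclC σ hσ A C N x) = g (inclC σ hσ A C N x))
    (hbase : ∀ r : kConstL σ hσ A, f (inclL σ hσ A C N (algebraMap _ _ r)) =
      g (inclL σ hσ A C N (algebraMap _ _ r)))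
    (hX : ∀ (j : ℕ) (hj : (j : ℕ∞) ≤ N) (a b : Fin m),
      f (inclL σ hσ A C N (solX σ hσ A N j hj a b)) =
        g (inclL σ hσ A C N (solX σ hσ A N j hj a b))) : f = g := by
  have h : f.comp (inclL σ hσ A C N) = g.comp (inclL σ hσ A C N) :=
    solRing_hom_ext σ hσ A hbase hX
  apply RingHom.ext
  intro x
  induction x using TensorProduct.induction_on with
  | zero => rw [map_zero, map_zero]
  | add x y hx hy => rw [RingHom.map_add, RingHom.map_add, hx, hy]
  | tmul r x =>
    have h1 : (r ⊗ₜ x : ringC σ hσ A C N) = inclL σ hσ A C N r * inclC σ hσ A C N x := by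
      simp [inclL, inclC]
    have h2 : f (inclL σ hσ A C N r) = g (inclL σ hσ A C N r) := congrArg (fun φ => φ r) h
    rw [h1, map_mul, map_mul, hC, h2]

/-- The inclusion of `F_N C_L ⊗ C` into `L ⊗ C`. -/
def inclM (N : ℕ∞) : ringC σ hσ A C N →ₐ[kConstL σ hσ A] GenField m k ⊗[constL σ hσ A] C :=
  Algebra.TensorProduct.map (solRing σ hσ A N).val (AlgHom.id _ C)

lemma inclM_injective (N : ℕ∞) : Function.Injective (inclM σ hσ A C N) := by
  have h : Function.Injective (LinearMap.rTensor C
      ((solRing σ hσ A N).val.restrictScalars (constL σ hσ A)).toLinearMap) :=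
    Module.Flat.rTensor_preserves_injective_linearMap _ Subtype.val_injective
  exact h

end Solution

/-! ### Translations of the prolonged fundamental matrix and the endomorphisms they induce -/

section Solution

variable {m : ℕ} {k : Type u} [Field k] [Differential k]
  (σ : k ≃+* k) (hσ : ∀ x, σ x′ = (σ x)′) (A : GL (Fin m) k)
  (C : Type u) [Field C] [Algebra (constL σ hσ A) C]

/-- The matrix `V B` over `L ⊗ C`, for a matrix `V` over `L` and a matrix `B` over `C`. -/
def translate {ι : Type*} [Fintype ι] (V : Matrix ι ι (GenField m k)) (B : Matrix ι ι C) :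
    Matrix ι ι (GenField m k ⊗[constL σ hσ A] C) :=
  V.map (Algebra.TensorProduct.includeLeft :
      GenField m k →ₐ[kConstL σ hσ A] GenField m k ⊗[constL σ hσ A] C) *
    B.map (Algebra.TensorProduct.includeRight :
      C →ₐ[constL σ hσ A] GenField m k ⊗[constL σ hσ A] C)

/-- The substitution `X_[n] ↦ X_[n] B` preserves the polynomial relations over `k C_L`. -/
def IsTranslation (n : ℕ) (B : Matrix (Fin (n + 1) × Fin m) (Fin (n + 1) × Fin m) C) : Prop :=
  IsSpec (kConstL σ hσ A) (fun v : (Fin (n + 1) × Fin m) × (Fin (n + 1) × Fin m) =>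
    jetX m k n v.1 v.2) (fun v => translate σ hσ A C (jetX m k n) B v.1 v.2)

lemma inclM_fundR {N : ℕ∞} (n : ℕ) (hn : (n : ℕ∞) ≤ N)
    (B : Matrix (Fin (n + 1) × Fin m) (Fin (n + 1) × Fin m) C) :
    ((fundR σ hσ A n hn).map (inclL σ hσ A C N) * B.map (inclC σ hσ A C N)).map
      (inclM σ hσ A C N) = translate σ hσ A C (jetX m k n) B := by
  rw [Matrix.map_mul, translate, ← fundR_val σ hσ A n hn]
  congr 1

/-- The family of the entries of `X^{(j)}`, `j ≤ N`. -/
abbrev JetIndex (m : ℕ) (N : ℕ∞) : Type := {p : ℕ × Fin m × Fin m // (p.1 : ℕ∞) ≤ N}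

lemma solRing_eq (N : ℕ∞) : solRing σ hσ A N = Algebra.adjoin (kConstL σ hσ A)
    (Set.range (fun p : JetIndex m N => GenField.X m k p.1.1 p.1.2.1 p.1.2.2) ∪
      {(GenField.X m k 0).det⁻¹}) := by
  rw [solRing]
  congr 2
  ext x
  constructor
  · rintro ⟨j, hj, a, b, rfl⟩
    exact ⟨⟨(j, a, b), hj⟩, rfl⟩
  · rintro ⟨p, rfl⟩
    exact ⟨p.1.1, p.2, _, _, rfl⟩

/-- Preservation of relations defines the map on the entries of the X^{(j)}. It extends to det(X)⁻¹
because the image det(X)·det(β) is a unit, and to the tensor product by fixing `C`. -/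
lemma exists_endomorphism (N : ℕ∞) (Z : JetIndex m N → ringC σ hσ A C N)
    (hZ : IsSpec (kConstL σ hσ A)
      (fun p : JetIndex m N => GenField.X m k p.1.1 p.1.2.1 p.1.2.2)
      (fun p => inclM σ hσ A C N (Z p)))
    (β : Matrix (Fin m) (Fin m) C) (hβ : β.det ≠ 0)
    (hZβ : (Matrix.of fun a b => Z ⟨(0, a, b), zero_le⟩) =
      (solX σ hσ A N 0 zero_le).map (inclL σ hσ A C N) * β.map (inclC σ hσ A C N)) :
    ∃ G : ringC σ hσ A C N →+* ringC σ hσ A C N,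
      (∀ x, G (inclC σ hσ A C N x) = inclC σ hσ A C N x) ∧
      (∀ r : kConstL σ hσ A, G (inclL σ hσ A C N (algebraMap _ _ r)) =
        inclL σ hσ A C N (algebraMap _ _ r)) ∧
      ∀ p : JetIndex m N, G (inclL σ hσ A C N (solX σ hσ A N p.1.1 p.2 p.1.2.1 p.1.2.2)) = Z p := by
  -- The relations are tested in `L ⊗ C`, but the smaller ring embeds there, so the map takes values
  -- in the ring itself.
  replace hZ := (isSpec_map_iff (inclM σ hσ A C N) (inclM_injective σ hσ A C N)).1 hZ
  set x : JetIndex m N → GenField m k := fun p => GenField.X m k p.1.1 p.1.2.1 p.1.2.2 with hx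
  let D : Matrix (Fin m) (Fin m) (GenField m k × ringC σ hσ A C N) :=
    Matrix.of fun a b => (x ⟨(0, a, b), zero_le⟩, Z ⟨(0, a, b), zero_le⟩)
  have hD : D.det ∈ graphAlg (kConstL σ hσ A) x Z := by
    rw [Matrix.det_apply]
    exact Subalgebra.sum_mem _ fun τ _ => Subalgebra.zsmul_mem _ (Subalgebra.prod_mem _
      fun i _ => mem_graphAlg x Z ⟨(0, τ i, i), zero_le⟩) _
  have hD1 : D.det.1 = (GenField.X m k 0).det :=
    RingHom.map_det (RingHom.fst (GenField m k) (ringC σ hσ A C N)) D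
  let d : solRing σ hσ A N := (solX σ hσ A N 0 zero_le).det
  have hD2 : D.det.2 = inclL σ hσ A C N d * inclC σ hσ A C N β.det := by
    refine (RingHom.map_det (RingHom.snd (GenField m k) (ringC σ hσ A C N)) D).trans ?_
    have : (RingHom.snd (GenField m k) (ringC σ hσ A C N)).mapMatrix D =
      (solX σ hσ A N 0 zero_le).map (inclL σ hσ A C N) * β.map (inclC σ hσ A C N) := hZβ
    rw [this, Matrix.det_mul, ← RingHom.mapMatrix_apply, ← RingHom.mapMatrix_apply,
      ← RingHom.map_det, ← RingHom.map_det]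
  let u : solRing σ hσ A N := ⟨(GenField.X m k 0).det⁻¹, Algebra.subset_adjoin (Or.inr rfl)⟩
  have hdu : d * u = 1 := by
    apply Subtype.ext
    have h1 : (d : GenField m k) = (GenField.X m k 0).det :=
      RingHom.map_det (solRing σ hσ A N).val.toRingHom _
    rw [MulMemClass.coe_mul, h1]
    exact mul_inv_cancel₀ (det_X_ne_zero m k)
  obtain ⟨ψ₀, hψ₀⟩ := hZ.exists_algHom hD (u := (GenField.X m k 0).det⁻¹)
    (w := inclL σ hσ A C N u * inclC σ hσ A C N β.det⁻¹)
    (by rw [hD1]; exact mul_inv_cancel₀ (det_X_ne_zero m k))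
    (by
      rw [hD2, mul_mul_mul_comm, ← map_mul, ← map_mul, hdu, mul_inv_cancel₀ hβ, map_one, map_one,
        one_mul])
  let ψ : solRing σ hσ A N →ₐ[kConstL σ hσ A] ringC σ hσ A C N :=
    ψ₀.comp (Subalgebra.equivOfEq _ _ (solRing_eq σ hσ A N)).toAlgHom
  refine ⟨(Algebra.TensorProduct.productMap (ψ.restrictScalars (constL σ hσ A))
    (Algebra.TensorProduct.includeRight : C →ₐ[constL σ hσ A] ringC σ hσ A C N)).toRingHom,
    fun y => ?_, fun r => ?_, fun p => ?_⟩
  · simp [inclC]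
  · have : ψ (algebraMap _ _ r) = algebraMap _ _ r := ψ.commutes r
    refine (Algebra.TensorProduct.productMap_apply_tmul _ _ _ _).trans ?_
    rw [map_one, mul_one]
    exact this
  · have : ψ (solX σ hσ A N p.1.1 p.2 p.1.2.1 p.1.2.2) = Z p := hψ₀ p _
    refine (Algebra.TensorProduct.productMap_apply_tmul _ _ _ _).trans ?_
    rw [map_one, mul_one]
    exact this

variable {C}

/-- An endomorphism over the base that maps the fundamental matrix to `X_[n] B` preserves the
relations. -/
lemma isTranslation_of_endomorphism {N : ℕ∞} (G : ringC σ hσ A C N →+* ringC σ hσ A C N)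
    (hbase : ∀ r : kConstL σ hσ A, G (inclL σ hσ A C N (algebraMap _ _ r)) =
        inclL σ hσ A C N (algebraMap _ _ r)) (n : ℕ) (hn : (n : ℕ∞) ≤ N)
    (B : Matrix (Fin (n + 1) × Fin m) (Fin (n + 1) × Fin m) C)
    (hG : ((fundR σ hσ A n hn).map (inclL σ hσ A C N)).map G =
      (fundR σ hσ A n hn).map (inclL σ hσ A C N) * B.map (inclC σ hσ A C N)) :
    IsTranslation σ hσ A C n B := by
  have hz : (fun v : (Fin (n + 1) × Fin m) × (Fin (n + 1) × Fin m) =>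
      translate σ hσ A C (jetX m k n) B v.1 v.2) = fun v => inclM σ hσ A C N
        ((((fundR σ hσ A n hn).map (inclL σ hσ A C N)).map G) v.1 v.2) := by
    rw [← inclM_fundR σ hσ A C n hn, ← hG]
    rfl
  have hx : (fun v : (Fin (n + 1) × Fin m) × (Fin (n + 1) × Fin m) => jetX m k n v.1 v.2) =
      fun v => (solRing σ hσ A N).val (fundR σ hσ A n hn v.1 v.2) := by
    rw [← fundR_val σ hσ A n hn]
    rfl
  rw [IsTranslation, hz, hx, isSpec_map_iff (inclM σ hσ A C N) (inclM_injective σ hσ A C N),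
    isSpec_comp_iff (solRing σ hσ A N).val Subtype.val_injective]
  rw [isSpec_iff]
  intro f hf
  have : (MvPolynomial.aeval (R := kConstL σ hσ A)
      fun v : (Fin (n + 1) × Fin m) × (Fin (n + 1) × Fin m) =>
        (((fundR σ hσ A n hn).map (inclL σ hσ A C N)).map G) v.1 v.2).toRingHom =
      (G.comp (inclL σ hσ A C N)).comp (MvPolynomial.aeval (R := kConstL σ hσ A)
        fun v : (Fin (n + 1) × Fin m) × (Fin (n + 1) × Fin m) =>
          fundR σ hσ A n hn v.1 v.2).toRingHom := by
    apply MvPolynomial.ringHom_ext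
    · intro r
      simp [hbase]
      rfl
    · intro v
      simp
  refine (congrArg (fun φ => φ f) this).trans ?_
  change G (inclL σ hσ A C N (MvPolynomial.aeval _ f)) = 0
  rw [hf, map_zero, map_zero]

/-- An endomorphism over the base that maps fundamental matrices to fundamental matrices
commutes with `σ`. -/
lemma endomorphism_sigma {N : ℕ∞} (G : ringC σ hσ A C N →+* ringC σ hσ A C N)
    (hC : ∀ x, G (inclC σ hσ A C N x) = inclC σ hσ A C N x)
    (hbase : ∀ r : kConstL σ hσ A, G (inclL σ hσ A C N (algebraMap _ _ r)) =
        inclL σ hσ A C N (algebraMap _ _ r))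
    (hG : ∀ j : ℕ, (j : ℕ∞) ≤ N → ∃ (n : ℕ) (hn : (n : ℕ∞) ≤ N)
      (B : Matrix (Fin (n + 1) × Fin m) (Fin (n + 1) × Fin m) C), j ≤ n ∧
      ((fundR σ hσ A n hn).map (inclL σ hσ A C N)).map G =
        (fundR σ hσ A n hn).map (inclL σ hσ A C N) * B.map (inclC σ hσ A C N))
    (x : ringC σ hσ A C N) : G (sigmaC σ hσ A C N x) = sigmaC σ hσ A C N (G x) := by
  have hsC : ∀ x, sigmaC σ hσ A C N (inclC σ hσ A C N x) = inclC σ hσ A C N x := fun x => by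
    simp [sigmaC, inclC]
  have hsL : ∀ x, sigmaC σ hσ A C N (inclL σ hσ A C N x) =
      inclL σ hσ A C N (sigmaRing σ hσ A N x) := fun x => by
    simp [sigmaC, inclL]
  have hsK : ∀ r : kConstL σ hσ A, sigmaRing σ hσ A N (algebraMap _ _ r) =
      algebraMap _ _ (sigmaK σ hσ A r) := fun r => rfl
  have : G.comp (sigmaC σ hσ A C N : ringC σ hσ A C N →+* ringC σ hσ A C N) =
      (sigmaC σ hσ A C N : ringC σ hσ A C N →+* ringC σ hσ A C N).comp G := by
    refine ringC_hom_ext σ hσ A C (S := ringC σ hσ A C N) ?_ ?_ ?_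
    · intro y
      simp only [RingHom.comp_apply, RingHom.coe_coe, hsC, hC]
    · intro r
      simp only [RingHom.comp_apply, RingHom.coe_coe, hsL, hsK, hbase]
    · intro j hj a b
      obtain ⟨n, hn, B, hjn, hB⟩ := hG j hj
      -- With V the fundamental matrix, σ(V) = A_[n]V and G(V) = VB, both sides equal A_[n]VB,
      -- because `G` fixes A_[n] and σ fixes `B`.
      have hmat : (((fundR σ hσ A n hn).map (inclL σ hσ A C N)).map (sigmaC σ hσ A C N)).map G =
          (((fundR σ hσ A n hn).map (inclL σ hσ A C N)).map G).map (sigmaC σ hσ A C N) := by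
        have h1 : ((fundR σ hσ A n hn).map (inclL σ hσ A C N)).map (sigmaC σ hσ A C N) =
            ((fundR σ hσ A n hn).map (sigmaRing σ hσ A N)).map (inclL σ hσ A C N) := by
          ext p q
          exact hsL _
        have h2 : (B.map (inclC σ hσ A C N)).map (sigmaC σ hσ A C N) =
            B.map (inclC σ hσ A C N) := by
          ext p q
          exact hsC _
        have h3 : (((prolongA σ hσ A n).map (algebraMap (kConstL σ hσ A)
            (solRing σ hσ A N))).map (inclL σ hσ A C N)).map G =
            ((prolongA σ hσ A n).map (algebraMap (kConstL σ hσ A)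
            (solRing σ hσ A N))).map (inclL σ hσ A C N) := by
          ext p q
          exact hbase _
        rw [hB, Matrix.map_mul, h2, h1, sigmaRing_fundR, Matrix.map_mul, Matrix.map_mul, h3, hB,
          mul_assoc]
      have := congrFun (congrFun hmat (⟨j, Nat.lt_succ_of_le hjn⟩, a)) (0, b)
      simp only [Matrix.map_apply] at this
      rw [fundR_zero_right σ hσ A n hn _ a b hj] at this
      exact this
  exact congrArg (fun φ => φ x) this

/-- The relations of `prolongMatrix_eq` among the entries of X_[n] must persist for X_[n]B. No block
shape is assumed of `B`: it is forced here. -/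
lemma IsTranslation.apply_eq {n : ℕ}
    {B : Matrix (Fin (n + 1) × Fin m) (Fin (n + 1) × Fin m) C}
    (hB : IsTranslation σ hσ A C n B) (p q : Fin (n + 1) × Fin m) :
    translate σ hσ A C (jetX m k n) B p q = ((p.1 : ℕ).choose q.1 : GenField m k ⊗[constL σ hσ A] C)
      * translate σ hσ A C (jetX m k n) B (⟨p.1 - q.1, by omega⟩, p.2) (0, q.2) := by
  set x := fun v : (Fin (n + 1) × Fin m) × (Fin (n + 1) × Fin m) => jetX m k n v.1 v.2
  set z := fun v : (Fin (n + 1) × Fin m) × (Fin (n + 1) × Fin m) =>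
    translate σ hσ A C (jetX m k n) B v.1 v.2
  have h := hB _ (sub_mem (mem_graphAlg x z (p, q)) (mul_mem
    (natCast_mem (graphAlg (kConstL σ hσ A) x z) ((p.1 : ℕ).choose q.1))
    (mem_graphAlg x z ((⟨p.1 - q.1, by omega⟩, p.2), (0, q.2))))) (by
      have := prolongMatrix_eq n (GenField.X m k 0) p q
      simp only [x, Prod.fst_sub, Prod.fst_mul, Prod.fst_natCast]
      rw [sub_eq_zero]
      exact this)
  rw [Prod.snd_sub, sub_eq_zero] at h
  exact h

/-- The upper left block of a matrix. -/
def block {n m : ℕ} {S : Type*} (B : Matrix (Fin (n + 1) × Fin m) (Fin (n + 1) × Fin m) S) :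
    Matrix (Fin m) (Fin m) S := Matrix.of fun a b => B (0, a) (0, b)

lemma jetX_zero_left (n : ℕ) (a b : Fin m) (i : Fin (n + 1)) :
    jetX m k n (0, a) (i, b) = if i = 0 then GenField.X m k 0 a b else 0 := by
  rw [jetX_apply]
  split_ifs with h
  · simp [h]
  · have : (0 : Fin (n + 1)).val.choose i.val = 0 :=
      Nat.choose_eq_zero_of_lt (Fin.pos_iff_ne_zero.2 h)
    simp only [this, Nat.cast_zero, zero_mul]

lemma translate_zero_left {n : ℕ} (B : Matrix (Fin (n + 1) × Fin m) (Fin (n + 1) × Fin m) C)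
    (a : Fin m) (q : Fin (n + 1) × Fin m) :
    translate σ hσ A C (jetX m k n) B (0, a) q =
      ∑ l, GenField.X m k 0 a l ⊗ₜ[constL σ hσ A] B (0, l) q := by
  simp only [translate, Matrix.mul_apply, Matrix.map_apply, Fintype.sum_prod_type, jetX_zero_left]
  rw [Finset.sum_eq_single 0]
  · simp
  · intro i _ hi
    simp [hi]
  · simp

/-- The first block row of X_[n]B must vanish off its first block. It equals X times the first block
row of `B`, so that row of `B` has the same shape, and the upper left block of `B⁻¹` inverts that of
`B`. -/
lemma IsTranslation.det_block_ne_zero {n : ℕ} {B : GL (Fin (n + 1) × Fin m) C}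
    (hB : IsTranslation σ hσ A C n B.1) : (block B.1).det ≠ 0 := by
  have hzero : ∀ (e : Fin m) (i : Fin (n + 1)) (b : Fin m), i ≠ 0 → B.1 (0, e) (i, b) = 0 := by
    intro e i b hi
    have h0 : ∀ a, ∑ l, GenField.X m k 0 a l ⊗ₜ[constL σ hσ A] B.1 (0, l) (i, b) = 0 := by
      intro a
      rw [← translate_zero_left, hB.apply_eq]
      have : (0 : Fin (n + 1)).val.choose i.val = 0 :=
        Nat.choose_eq_zero_of_lt (Fin.pos_iff_ne_zero.2 hi)
      simp only [this, Nat.cast_zero, zero_mul]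
    -- Multiplication by X⁻¹ isolates a single entry of `B`.
    have h1 : (1 : GenField m k) ⊗ₜ[constL σ hσ A] B.1 (0, e) (i, b) = 0 := by
      have hinv := (XL m k).inv_mul
      have h2 : ∑ a, ((XL m k)⁻¹.1 e a ⊗ₜ[constL σ hσ A] (1 : C)) *
          ∑ l, GenField.X m k 0 a l ⊗ₜ[constL σ hσ A] B.1 (0, l) (i, b) = 0 := by
        simp only [h0, mul_zero, Finset.sum_const_zero]
      simp only [Finset.mul_sum, Algebra.TensorProduct.tmul_mul_tmul, one_mul] at h2
      rw [Finset.sum_comm] at h2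
      simp only [← TensorProduct.sum_tmul] at h2
      have h3 : ∀ l, ∑ a, (XL m k)⁻¹.1 e a * GenField.X m k 0 a l =
          (1 : Matrix (Fin m) (Fin m) (GenField m k)) e l := fun l => by
        rw [← hinv, Matrix.mul_apply]; rfl
      simp only [h3, Matrix.one_apply, TensorProduct.ite_tmul] at h2
      simpa using h2
    exact (map_eq_zero_iff _ (Algebra.TensorProduct.includeRight_injective (R := constL σ hσ A)
      (A := GenField m k) (B := C) (FaithfulSMul.algebraMap_injective _ _))).1 h1
  have h : block B.1 * block B⁻¹.1 = 1 := by
    have := B.mul_inv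
    ext a b
    have h1 := congrFun (congrFun this (0, a)) (0, b)
    rw [Matrix.mul_apply, Fintype.sum_prod_type, Finset.sum_eq_single 0] at h1
    · rw [Matrix.mul_apply]
      refine h1.trans ?_
      simp [Matrix.one_apply]
    · intro i _ hi
      simp [hzero _ i _ hi]
    · simp
  intro h0
  have := congrArg Matrix.det h
  rw [Matrix.det_mul, h0, zero_mul, Matrix.det_one] at this
  exact zero_ne_one this

end Solution

/-- Over the subring of elements fixed by `G`, the span of the entries of `V` and of `u` is mapped
onto itself: `B⁻¹` and `b'` provide preimages. Then `bijective_of_map_span` applies. -/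
lemma bijective_of_matrix {ι S C : Type*} [Fintype ι] [DecidableEq ι] [CommRing S] [CommRing C]
    (G : S →+* S) (f : C →+* S) (hf : ∀ x, G (f x) = f x) (V : Matrix ι ι S) (B : GL ι C)
    (hG : V.map G = V * B.1.map f) (u : S) (b b' : C) (hb : b' * b = 1) (hu : G u = u * f b)
    (htop : Subring.closure ({x | G x = x} ∪
      (Set.range (fun p : ι × ι => V p.1 p.2) ∪ {u})) = ⊤) : Function.Bijective G := by
  let T : Subring S := G.eqLocus (RingHom.id _)
  have hTC : ∀ x, f x ∈ T := hf
  let v : Set S := Set.range (fun p : ι × ι => V p.1 p.2) ∪ {u}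
  have hcomb : ∀ (D : Matrix ι ι C) p q, (V * D.map f) p q ∈ Submodule.span T v := by
    intro D p q
    rw [Matrix.mul_apply]
    refine sum_mem fun l _ => ?_
    have : V p l * (D.map f) l q = (⟨f (D l q), hTC _⟩ : T) • V p l := mul_comm _ _
    rw [this]
    exact Submodule.smul_mem _ _ (Submodule.subset_span (Or.inl ⟨(p, l), rfl⟩))
  have hcombu : ∀ x, u * f x ∈ Submodule.span T v := by
    intro x
    have : u * f x = (⟨f x, hTC _⟩ : T) • u := mul_comm _ _
    rw [this]
    exact Submodule.smul_mem _ _ (Submodule.subset_span (Or.inr rfl))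
  have hmapC : ∀ D : Matrix ι ι C, (D.map f).map G = D.map f := fun D => by
    ext p q; exact hf _
  refine bijective_of_map_span G T (fun x hx => hx) v
    ((Set.finite_range _).union (Set.finite_singleton u)) ?_ ?_ ?_
  · rw [eq_top_iff]
    rintro x -
    have hx : x ∈ Subring.closure ({x | G x = x} ∪ v) := by rw [htop]; trivial
    have hle : Subring.closure ({x | G x = x} ∪ v) ≤ (Algebra.adjoin T v).toSubring := by
      rw [Subring.closure_le]
      rintro y (hy | hy)
      · exact Subalgebra.algebraMap_mem (Algebra.adjoin T v) (⟨y, hy⟩ : T)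
      · exact Algebra.subset_adjoin hy
    exact hle hx
  · rintro x (⟨⟨p, q⟩, rfl⟩ | rfl)
    · have : G (V p q) = (V * B.1.map f) p q := by rw [← hG]; rfl
      rw [this]
      exact hcomb _ _ _
    · rw [hu]
      exact hcombu _
  · rintro x (⟨⟨p, q⟩, rfl⟩ | rfl)
    · refine ⟨_, hcomb (B⁻¹).1 p q, ?_⟩
      have : (V * (B⁻¹).1.map f).map G = V := by
        rw [Matrix.map_mul, hG, hmapC, mul_assoc, ← Matrix.map_mul, B.mul_inv,
          Matrix.map_one _ (map_zero _) (map_one _), mul_one]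
      exact congrFun (congrFun this p) q
    · refine ⟨_, hcombu b', ?_⟩
      rw [map_mul, hf, hu, mul_assoc, ← map_mul, mul_comm b, hb, map_one, mul_one]

/-! ### From translations to automorphisms: membership in `groupHn` -/

section Solution

variable {m : ℕ} {k : Type u} [Field k] [Differential k]
  {σ : k ≃+* k} {hσ : ∀ x, σ x′ = (σ x)′} {A : GL (Fin m) k}
  {C : Type u} [Field C] [Algebra (constL σ hσ A) C]

lemma inclL_base_mem (N : ℕ∞) (r : kConstL σ hσ A) :
    inclL σ hσ A C N (algebraMap _ _ r) ∈ baseC σ hσ A C N :=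
  ⟨r ⊗ₜ 1, by simp [inclL]⟩

lemma eq_of_mem_baseC {N : ℕ∞} (G : ringC σ hσ A C N →+* ringC σ hσ A C N)
    (hC : ∀ x, G (inclC σ hσ A C N x) = inclC σ hσ A C N x)
    (hbase : ∀ r : kConstL σ hσ A, G (inclL σ hσ A C N (algebraMap _ _ r)) =
        inclL σ hσ A C N (algebraMap _ _ r)) {x : ringC σ hσ A C N}
    (hx : x ∈ baseC σ hσ A C N) : G x = x := by
  obtain ⟨t, rfl⟩ := hx
  induction t with
  | zero => simp
  | add s t hs ht => rw [map_add (Algebra.TensorProduct.map _ _), RingHom.map_add, hs, ht]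
  | tmul r y =>
    have : Algebra.TensorProduct.map
        (IsScalarTower.toAlgHom (constL σ hσ A) (kConstL σ hσ A) (solRing σ hσ A N))
        (AlgHom.id (constL σ hσ A) C) (r ⊗ₜ y) =
        inclL σ hσ A C N (algebraMap _ _ r) * inclC σ hσ A C N y := by
      simp [inclL, inclC]
    rw [this, map_mul, hC, hbase]

/-- The inverse of `det X`. -/
def invDet (σ : k ≃+* k) (hσ : ∀ x, σ x′ = (σ x)′) (A : GL (Fin m) k) (N : ℕ∞) :
    solRing σ hσ A N :=
  ⟨(GenField.X m k 0).det⁻¹, Algebra.subset_adjoin (Or.inr rfl)⟩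

lemma det_mul_invDet (N : ℕ∞) :
    (solX σ hσ A N 0 zero_le).det * invDet σ hσ A N = 1 := by
  apply Subtype.ext
  have h1 : ((solX σ hσ A N 0 zero_le).det : GenField m k) = (GenField.X m k 0).det :=
    RingHom.map_det (solRing σ hσ A N).val.toRingHom _
  rw [MulMemClass.coe_mul, h1]
  exact mul_inv_cancel₀ (det_X_ne_zero m k)

/-- `G` multiplies det X by det β, hence its inverse by (det β)⁻¹. Fixed elements, the entries of
the fundamental matrix and this inverse generate the ring. -/
lemma bijective_endomorphism {n : ℕ} (G : ringC σ hσ A C n →+* ringC σ hσ A C n)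
    (hC : ∀ x, G (inclC σ hσ A C n x) = inclC σ hσ A C n x)
    (hbase : ∀ r : kConstL σ hσ A, G (inclL σ hσ A C n (algebraMap _ _ r)) =
        inclL σ hσ A C n (algebraMap _ _ r))
    (B : GL (Fin (n + 1) × Fin m) C)
    (hG : ((fundR σ hσ A n le_rfl).map (inclL σ hσ A C n)).map G =
      (fundR σ hσ A n le_rfl).map (inclL σ hσ A C n) * B.1.map (inclC σ hσ A C n))
    (β : Matrix (Fin m) (Fin m) C) (hβ : β.det ≠ 0)
    (hGβ : ((solX σ hσ A n 0 zero_le).map (inclL σ hσ A C n)).map G =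
      (solX σ hσ A n 0 zero_le).map (inclL σ hσ A C n) * β.map (inclC σ hσ A C n)) :
    Function.Bijective G := by
  set V := (fundR σ hσ A n le_rfl).map (inclL σ hσ A C n) with hV
  set u := inclL σ hσ A C n (invDet σ hσ A n) with hu
  set d := inclL σ hσ A C n (solX σ hσ A n 0 zero_le).det with hd
  have hdu : d * u = 1 := by rw [hd, hu, ← map_mul, det_mul_invDet, map_one]
  have hGd : G d = d * inclC σ hσ A C n β.det := by
    have := congrArg Matrix.det hGβ
    rw [Matrix.det_mul] at this
    simp only [← RingHom.mapMatrix_apply, ← RingHom.map_det] at this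
    exact this
  have hGu : G u = u * inclC σ hσ A C n β.det⁻¹ := by
    have h1 : inclC σ hσ A C n β.det * inclC σ hσ A C n β.det⁻¹ = 1 := by
      rw [← map_mul, mul_inv_cancel₀ hβ, map_one]
    have h2 : G d * G u = 1 := by rw [← map_mul, hdu, map_one]
    calc G u = (d * u) * (inclC σ hσ A C n β.det * inclC σ hσ A C n β.det⁻¹) * G u := by
          rw [hdu, h1, one_mul, one_mul]
      _ = (G d * G u) * (u * inclC σ hσ A C n β.det⁻¹) := by rw [hGd]; ring
      _ = _ := by rw [h2, one_mul]
  set T := Subring.closure ({x | G x = x} ∪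
    (Set.range (fun p : (Fin (n + 1) × Fin m) × (Fin (n + 1) × Fin m) => V p.1 p.2) ∪ {u}))
    with hT
  have hL : ∀ r : solRing σ hσ A n, inclL σ hσ A C n r ∈ T := by
    rintro ⟨r, hr⟩
    induction hr using Algebra.adjoin_induction with
    | mem x hx =>
      rcases hx with ⟨j, hj, a, b, rfl⟩ | rfl
      · have hjn : j ≤ n := by exact_mod_cast hj
        refine Subring.subset_closure (Or.inr (Or.inl
          ⟨((⟨j, Nat.lt_succ_of_le hjn⟩, a), (0, b)), ?_⟩))
        simp only [hV, Matrix.map_apply]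
        rw [fundR_zero_right σ hσ A n le_rfl _ a b hj]
        rfl
      · exact Subring.subset_closure (Or.inr (Or.inr rfl))
    | algebraMap r => exact Subring.subset_closure (Or.inl (hbase r))
    | add x y hx hy h h' =>
      have : (⟨x + y, add_mem hx hy⟩ : solRing σ hσ A n) = ⟨x, hx⟩ + ⟨y, hy⟩ := rfl
      rw [this, RingHom.map_add]
      exact add_mem h h'
    | mul x y hx hy h h' =>
      have : (⟨x * y, mul_mem hx hy⟩ : solRing σ hσ A n) = ⟨x, hx⟩ * ⟨y, hy⟩ := rfl
      rw [this, RingHom.map_mul]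
      exact mul_mem h h'
  refine bijective_of_matrix G (inclC σ hσ A C n) hC V B hG u β.det⁻¹ β.det
    (mul_inv_cancel₀ hβ) hGu ?_
  rw [← hT, eq_top_iff]
  rintro x -
  induction x using TensorProduct.induction_on with
  | zero => exact zero_mem _
  | add x y hx hy => exact add_mem hx hy
  | tmul r y =>
    have h1 : (r ⊗ₜ y : ringC σ hσ A C n) = inclL σ hσ A C n r * inclC σ hσ A C n y := by
      simp [inclL, inclC]
    rw [h1]
    exact mul_mem (hL r) (Subring.subset_closure (Or.inl (hC y)))

/-- A translation of the relations comes from an automorphism. -/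
lemma IsTranslation.exists_automorphism {n : ℕ} {B : GL (Fin (n + 1) × Fin m) C}
    (hB : IsTranslation σ hσ A C n B.1) :
    ∃ g ∈ opAut (baseC σ hσ A C n) {⇑(sigmaC σ hσ A C n)},
      ((fundR σ hσ A n le_rfl).map (inclL σ hσ A C n)).map g =
      (fundR σ hσ A n le_rfl).map (inclL σ hσ A C n) * B.1.map (inclC σ hσ A C n) := by
  set V := (fundR σ hσ A n le_rfl).map (inclL σ hσ A C n) with hV
  set W := V * B.1.map (inclC σ hσ A C n) with hW
  have hWt : ∀ p q, inclM σ hσ A C n (W p q) = translate σ hσ A C (jetX m k n) B.1 p q := by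
    intro p q
    rw [← inclM_fundR σ hσ A C n le_rfl]
    rfl
  -- The prescribed images of the X^{(j)} are read off the first block column of X_[n]B.
  let Z : JetIndex m n → ringC σ hσ A C n := fun p =>
    W (⟨p.1.1, Nat.lt_succ_of_le (by exact_mod_cast p.2)⟩, p.1.2.1) (0, p.1.2.2)
  have hZ : IsSpec (kConstL σ hσ A)
      (fun p : JetIndex m n => GenField.X m k p.1.1 p.1.2.1 p.1.2.2)
      (fun p => inclM σ hσ A C n (Z p)) := by
    refine IsSpec.of_mem hB fun p => ?_
    have := mem_graphAlg (K := kConstL σ hσ A)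
      (fun v : (Fin (n + 1) × Fin m) × (Fin (n + 1) × Fin m) => jetX m k n v.1 v.2)
      (fun v => translate σ hσ A C (jetX m k n) B.1 v.1 v.2)
      ((⟨p.1.1, Nat.lt_succ_of_le (by exact_mod_cast p.2)⟩, p.1.2.1), (0, p.1.2.2))
    rw [jetX_zero_right, ← hWt] at this
    exact this
  have hZβ : (Matrix.of fun a b => Z ⟨(0, a, b), zero_le⟩) =
      (solX σ hσ A n 0 zero_le).map (inclL σ hσ A C n) *
        (block B.1).map (inclC σ hσ A C n) := by
    ext a b
    apply inclM_injective σ hσ A C n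
    refine (hWt (0, a) (0, b)).trans ?_
    rw [translate_zero_left, Matrix.mul_apply, map_sum]
    refine Finset.sum_congr rfl fun l _ => ?_
    simp [inclM, inclL, inclC, solX, block]
  obtain ⟨G, hC, hbase, hX⟩ := exists_endomorphism σ hσ A C n Z hZ (block B.1)
    (hB.det_block_ne_zero) hZβ
  -- The other block columns follow from the first, on both sides by the same integer relations
  -- (`IsTranslation.apply_eq` on the right).
  have hG : V.map G = W := by
    ext p q
    apply inclM_injective σ hσ A C n
    have h1 : V p q = ((p.1 : ℕ).choose q.1 : ringC σ hσ A C n) * inclL σ hσ A C n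
        (solX σ hσ A n (p.1 - q.1)
          (by exact_mod_cast (by omega : (p.1 : ℕ) - q.1 ≤ n)) p.2 q.2) := by
      rw [hV, Matrix.map_apply, fundR, Matrix.of_apply, map_mul, map_natCast]
    rw [hWt, hB.apply_eq, ← hWt, Matrix.map_apply, h1, map_mul, map_mul, map_natCast, map_natCast]
    exact congrArg (fun y => _ * inclM σ hσ A C n y) (hX ⟨(p.1 - q.1, p.2, q.2),
      by exact_mod_cast (by omega : (p.1 : ℕ) - q.1 ≤ n)⟩)
  have hGβ : ((solX σ hσ A n 0 zero_le).map (inclL σ hσ A C n)).map G =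
      (solX σ hσ A n 0 zero_le).map (inclL σ hσ A C n) *
        (block B.1).map (inclC σ hσ A C n) := by
    rw [← hZβ]
    ext a b
    exact hX ⟨(0, a, b), _⟩
  have hbij := bijective_endomorphism G hC hbase B hG _ hB.det_block_ne_zero hGβ
  refine ⟨RingEquiv.ofBijective G hbij, ⟨fun x hx => eq_of_mem_baseC G hC hbase hx, ?_⟩, hG⟩
  rintro _ rfl x
  exact endomorphism_sigma σ hσ A G hC hbase
    (fun j hj => ⟨n, le_rfl, B.1, by exact_mod_cast hj, hG⟩) x

/-- Existence of an automorphism is thereby replaced by a condition on polynomial relations alone.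
All later arguments about ℍ_n use this form. -/
theorem mem_groupHn_iff {n : ℕ} {B : GL (Fin (n + 1) × Fin m) C} :
    B ∈ groupHn σ hσ A C n ↔ IsTranslation σ hσ A C n B.1 := by
  constructor
  · rintro ⟨g, hg, hgB⟩
    exact isTranslation_of_endomorphism σ hσ A (g : ringC σ hσ A C n →+* ringC σ hσ A C n)
      (fun r => hg.1 _ (inclL_base_mem _ r)) n le_rfl _ hgB
  · intro hB
    obtain ⟨g, hg, hgB⟩ := hB.exists_automorphism
    exact ⟨g, hg, hgB⟩

lemma inclL_mem_nonZeroDivisors {N : ℕ∞} {s : solRing σ hσ A N} (hs : s ≠ 0) :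
    inclL σ hσ A C N s ∈ nonZeroDivisors (ringC σ hσ A C N) :=
  tmul_one_mem_nonZeroDivisors hs

lemma inclM_mem_nonZeroDivisors {N : ℕ∞} {x : ringC σ hσ A C N}
    (hx : x ∈ nonZeroDivisors (ringC σ hσ A C N)) :
    inclM σ hσ A C N x ∈ nonZeroDivisors (GenField m k ⊗[constL σ hσ A] C) :=
  map_mem_nonZeroDivisors_tensor (c := constL σ hσ A) (R := solRing σ hσ A N)
    (L := GenField m k) (C := C) (inclM σ hσ A C N).toRingHom
    (fun (_ : solRing σ hσ A N) (_ : C) => rfl) hx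

lemma map_mem_nonZeroDivisors_of_equiv {S : Type*} [CommRing S] (g : S ≃+* S) {x : S}
    (hx : x ∈ nonZeroDivisors S) : g x ∈ nonZeroDivisors S := by
  rw [mem_nonZeroDivisors_iff_left] at hx ⊢
  intro y hy
  have := hx (g.symm y) (g.injective (by rw [map_mul, g.apply_symm_apply, hy, map_zero]))
  exact g.symm.injective (by rw [this, map_zero])

lemma aeval_fundR (n : ℕ)
    (f : MvPolynomial ((Fin (n + 1) × Fin m) × (Fin (n + 1) × Fin m)) (kConstL σ hσ A)) :
    ((MvPolynomial.aeval (fun v : (Fin (n + 1) × Fin m) × (Fin (n + 1) × Fin m) =>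
      fundR σ hσ A n (N := n) le_rfl v.1 v.2) f : solRing σ hσ A n) : GenField m k) =
      MvPolynomial.aeval (fun v : (Fin (n + 1) × Fin m) × (Fin (n + 1) × Fin m) =>
        jetX m k n v.1 v.2) f := by
  have h : ∀ v : (Fin (n + 1) × Fin m) × (Fin (n + 1) × Fin m),
      (fundR σ hσ A n (N := n) le_rfl v.1 v.2 : GenField m k) = jetX m k n v.1 v.2 :=
    fun v => congrFun (congrFun (fundR_val σ hσ A n le_rfl) v.1) v.2
  generalize fundR σ hσ A n (N := n) le_rfl = F at h ⊢
  simp only [← h]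
  exact (MvPolynomial.comp_aeval_apply
    (fun v : (Fin (n + 1) × Fin m) × (Fin (n + 1) × Fin m) => F v.1 v.2)
    (solRing σ hσ A n).val f)

/-- `p.1` is a nonzero element s of R_n, and `p.2` is the image in `L ⊗ C` of g(s ⊗ 1), for an
automorphism g. Each map on the way preserves nonzerodivisors. This is the regularity that
`exists_bound_isSpec` asks for. -/
lemma IsTranslation.mem_nonZeroDivisors {n : ℕ} {B : GL (Fin (n + 1) × Fin m) C}
    (hB : IsTranslation σ hσ A C n B.1) {p : GenField m k × (GenField m k ⊗[constL σ hσ A] C)}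
    (hp : p ∈ graphAlg (kConstL σ hσ A)
      (fun v : (Fin (n + 1) × Fin m) × (Fin (n + 1) × Fin m) => jetX m k n v.1 v.2)
      (fun v => translate σ hσ A C (jetX m k n) B.1 v.1 v.2)) (hp0 : p.1 ≠ 0) :
    p.2 ∈ nonZeroDivisors (GenField m k ⊗[constL σ hσ A] C) := by
  obtain ⟨g, hg, hgB⟩ := hB.exists_automorphism
  obtain ⟨f, hf1, hf2⟩ := mem_graphAlg_iff.1 hp
  set s : solRing σ hσ A n := MvPolynomial.aeval
    (fun v : (Fin (n + 1) × Fin m) × (Fin (n + 1) × Fin m) => fundR σ hσ A n le_rfl v.1 v.2) f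
    with hs
  have h1 : (s : GenField m k) = p.1 := (aeval_fundR n f).trans hf1
  have h2 : inclM σ hσ A C n (g (inclL σ hσ A C n s)) = p.2 := by
    rw [← hf2]
    have : ((inclM σ hσ A C n : ringC σ hσ A C n →+* _).comp
        ((g : ringC σ hσ A C n →+* ringC σ hσ A C n).comp (inclL σ hσ A C n))).comp
        (MvPolynomial.aeval (R := kConstL σ hσ A)
          (fun v : (Fin (n + 1) × Fin m) × (Fin (n + 1) × Fin m) =>
            fundR σ hσ A n le_rfl v.1 v.2)).toRingHom =
        (MvPolynomial.aeval (R := kConstL σ hσ A)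
          (fun v : (Fin (n + 1) × Fin m) × (Fin (n + 1) × Fin m) =>
            translate σ hσ A C (jetX m k n) B.1 v.1 v.2)).toRingHom := by
      apply MvPolynomial.ringHom_ext
      · intro r
        have hr : g (inclL σ hσ A C n (algebraMap _ _ r)) = inclL σ hσ A C n (algebraMap _ _ r) :=
          hg.1 _ (inclL_base_mem _ r)
        have hr2 : inclM σ hσ A C n (algebraMap _ _ r) = algebraMap _ _ r :=
          (inclM σ hσ A C n).commutes r
        simp only [RingHom.comp_apply, AlgHom.toRingHom_eq_coe, RingHom.coe_coe,
          MvPolynomial.aeval_C, hr]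
        exact hr2
      · intro v
        simp only [RingHom.comp_apply, AlgHom.toRingHom_eq_coe, RingHom.coe_coe,
          MvPolynomial.aeval_X]
        rw [← inclM_fundR σ hσ A C n le_rfl, ← hgB]
        rfl
    exact congrArg (fun φ => φ f) this
  have hs0 : s ≠ 0 := fun h => hp0 (by rw [← h1, h]; rfl)
  rw [← h2]
  exact inclM_mem_nonZeroDivisors (map_mem_nonZeroDivisors_of_equiv g
    (inclL_mem_nonZeroDivisors hs0))

end Solution

section Solution

variable {m : ℕ} {k : Type u} [Field k] [Differential k]
  {σ : k ≃+* k} {hσ : ∀ x, σ x′ = (σ x)′} {A : GL (Fin m) k}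
  {C : Type u} [Field C] [Algebra (constL σ hσ A) C] [Differential C]
  [DifferentialAlgebra (constL σ hσ A) C]

/-! ### The differential Galois group -/

instance : Differential (ringC σ hσ A C ⊤) :=
  tensorDifferential (constL σ hσ A) (solRing σ hσ A ⊤) C

lemma deriv_inclC (x : C) : (inclC σ hσ A C ⊤ x)′ = inclC σ hσ A C ⊤ x′ := by
  refine (tensorDeriv_tmul (constL σ hσ A) (solRing σ hσ A ⊤) C 1 x).trans ?_
  rw [Derivation.map_one_eq_zero, TensorProduct.zero_tmul, zero_add]
  rfl

lemma deriv_inclL (x : solRing σ hσ A ⊤) : (inclL σ hσ A C ⊤ x)′ = inclL σ hσ A C ⊤ x′ := by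
  refine (tensorDeriv_tmul (constL σ hσ A) (solRing σ hσ A ⊤) C x 1).trans ?_
  rw [Derivation.map_one_eq_zero, TensorProduct.tmul_zero, add_zero]
  rfl

lemma solX_iterate (j : ℕ) (a b : Fin m) : solX σ hσ A ⊤ j le_top a b =
    (⇑(Differential.deriv (R := solRing σ hσ A ⊤)))^[j] (solX σ hσ A ⊤ 0 le_top a b) := by
  apply Subtype.ext
  have h := map_iterate_deriv ((solRing σ hσ A ⊤).val : solRing σ hσ A ⊤ →+* GenField m k)
    (fun _ => rfl) j (solX σ hσ A ⊤ 0 le_top a b)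
  exact (X_iterate j a b).trans h.symm

lemma inclL_solX_iterate (j : ℕ) (a b : Fin m) :
    inclL σ hσ A C ⊤ (solX σ hσ A ⊤ j le_top a b) =
    (⇑(Differential.deriv (R := ringC σ hσ A C ⊤)))^[j]
      (inclL σ hσ A C ⊤ (solX σ hσ A ⊤ 0 le_top a b)) := by
  rw [solX_iterate, map_iterate_deriv (inclL σ hσ A C ⊤) fun x => (deriv_inclL x).symm]

lemma fundR_map_inclL (n : ℕ) : (fundR σ hσ A n (N := ⊤) le_top).map (inclL σ hσ A C ⊤) =
    prolongMatrix n ((solX σ hσ A ⊤ 0 le_top).map (inclL σ hσ A C ⊤)) := by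
  ext p q
  rw [Matrix.map_apply, fundR, Matrix.of_apply, RingHom.map_mul, map_natCast, inclL_solX_iterate]
  rfl

lemma fundR_mul_prolong (n : ℕ) (B : GL (Fin m) C) :
    (fundR σ hσ A n (N := ⊤) le_top).map (inclL σ hσ A C ⊤) *
      (prolong n B).1.map (inclC σ hσ A C ⊤) =
    prolongMatrix n ((solX σ hσ A ⊤ 0 le_top).map (inclL σ hσ A C ⊤) *
      B.1.map (inclC σ hσ A C ⊤)) := by
  rw [prolongMatrix_mul, fundR_map_inclL,
    prolongMatrix_map (inclC σ hσ A C ⊤) fun x => (deriv_inclC x).symm]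
  rfl

/-- Commuting with the derivations amounts to equality of two ring homomorphisms into dual numbers,
so it may be checked on generators. -/
lemma ringC_hom_deriv {S : Type*} [CommRing S] [Differential S] (f : ringC σ hσ A C ⊤ →+* S)
    (hC : ∀ x, f (inclC σ hσ A C ⊤ x)′ = (f (inclC σ hσ A C ⊤ x))′)
    (hbase : ∀ r : kConstL σ hσ A, f (inclL σ hσ A C ⊤ (algebraMap _ _ r))′ =
      (f (inclL σ hσ A C ⊤ (algebraMap _ _ r)))′)
    (hX : ∀ (j : ℕ) (a b : Fin m),
      f (inclL σ hσ A C ⊤ (solX σ hσ A ⊤ j le_top a b))′ =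
        (f (inclL σ hσ A C ⊤ (solX σ hσ A ⊤ j le_top a b)))′)
    (x : ringC σ hσ A C ⊤) : f x′ = (f x)′ := by
  have key : ∀ a : ringC σ hσ A C ⊤, f a′ = (f a)′ →
      dualOfDeriv f a = (dualOfDeriv (RingHom.id S)).comp f a := by
    intro a ha
    apply TrivSqZeroExt.ext
    · simp [dualOfDeriv]
    · simp [dualOfDeriv, ha]
  refine ringHom_dual_ext ?_ x
  exact ringC_hom_ext σ hσ A C (S := TrivSqZeroExt S S) (fun x => key _ (hC x))
    (fun r => key _ (hbase r)) (fun j _ a b => key _ (hX j a b))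

lemma inclM_deriv_mem {n : ℕ} {B : GL (Fin m) C} (j : ℕ) (hj : j < n + 1) (a b : Fin m) :
    inclM σ hσ A C ⊤ ((⇑(Differential.deriv (R := ringC σ hσ A C ⊤)))^[j]
      (((solX σ hσ A ⊤ 0 le_top).map (inclL σ hσ A C ⊤) *
        B.1.map (inclC σ hσ A C ⊤)) a b)) =
      translate σ hσ A C (jetX m k n) (prolong n B).1 (⟨j, hj⟩, a) (0, b) := by
  rw [← inclM_fundR σ hσ A C n (N := ⊤) le_top, fundR_mul_prolong, Matrix.map_apply,
    prolongMatrix_zero_right]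

/-- X^{(j)} is sent to (XB)^{(j)}. By multiplicativity of prolongation these are entries of
X_[n]B_[n], so the hypotheses for the single n combine over their union. -/
lemma exists_differential_endomorphism {B : GL (Fin m) C}
    (hB : ∀ n, IsTranslation σ hσ A C n (prolong n B).1) :
    ∃ G : ringC σ hσ A C ⊤ →+* ringC σ hσ A C ⊤,
      (∀ x, G (inclC σ hσ A C ⊤ x) = inclC σ hσ A C ⊤ x) ∧
      (∀ r : kConstL σ hσ A, G (inclL σ hσ A C ⊤ (algebraMap _ _ r)) =
        inclL σ hσ A C ⊤ (algebraMap _ _ r)) ∧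
      ((solX σ hσ A ⊤ 0 le_top).map (inclL σ hσ A C ⊤)).map G =
        (solX σ hσ A ⊤ 0 le_top).map (inclL σ hσ A C ⊤) * B.1.map (inclC σ hσ A C ⊤) ∧
      (∀ x, G (sigmaC σ hσ A C ⊤ x) = sigmaC σ hσ A C ⊤ (G x)) ∧ ∀ x, G x′ = (G x)′ := by
  set Y := (solX σ hσ A ⊤ 0 le_top).map (inclL σ hσ A C ⊤) * B.1.map (inclC σ hσ A C ⊤) with hY
  let Z : JetIndex m ⊤ → ringC σ hσ A C ⊤ := fun p =>
    (⇑(Differential.deriv (R := ringC σ hσ A C ⊤)))^[p.1.1] (Y p.1.2.1 p.1.2.2)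
  have hZ : IsSpec (kConstL σ hσ A)
      (fun p : JetIndex m ⊤ => GenField.X m k p.1.1 p.1.2.1 p.1.2.2)
      (fun p => inclM σ hσ A C ⊤ (Z p)) := by
    refine isSpec_iUnion (fun n => {p | p.1.1 ≤ n}) (fun a b hab p hp => le_trans hp hab)
      (fun p => ⟨p.1.1, show p.1.1 ≤ p.1.1 from le_rfl⟩) fun n => ?_
    refine IsSpec.of_mem (hB n) fun p => ?_
    have := mem_graphAlg (K := kConstL σ hσ A)
      (fun v : (Fin (n + 1) × Fin m) × (Fin (n + 1) × Fin m) => jetX m k n v.1 v.2)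
      (fun v => translate σ hσ A C (jetX m k n) (prolong n B).1 v.1 v.2)
      ((⟨p.1.1.1, Nat.lt_succ_of_le p.2⟩, p.1.1.2.1), (0, p.1.1.2.2))
    rw [jetX_zero_right, ← inclM_deriv_mem] at this
    exact this
  obtain ⟨G, hC, hbase, hX⟩ := exists_endomorphism σ hσ A C ⊤ Z hZ B.1
    (B.isUnit.map Matrix.detMonoidHom).ne_zero (by
      ext a b
      rfl)
  have hX' : ∀ (j : ℕ) (a b : Fin m), G (inclL σ hσ A C ⊤ (solX σ hσ A ⊤ j le_top a b)) =
      (⇑(Differential.deriv (R := ringC σ hσ A C ⊤)))^[j] (Y a b) :=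
    fun j a b => hX ⟨(j, a, b), le_top⟩
  have hG : ∀ n, ((fundR σ hσ A n (N := ⊤) le_top).map (inclL σ hσ A C ⊤)).map G =
      (fundR σ hσ A n (N := ⊤) le_top).map (inclL σ hσ A C ⊤) *
        (prolong n B).1.map (inclC σ hσ A C ⊤) := by
    intro n
    rw [fundR_mul_prolong, ← hY]
    ext p q
    rw [Matrix.map_apply, Matrix.map_apply, fundR, Matrix.of_apply, RingHom.map_mul,
      RingHom.map_mul, map_natCast, map_natCast, hX']
    rfl
  refine ⟨G, hC, hbase, ?_, fun x => endomorphism_sigma σ hσ A G hC hbase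
    (fun j _ => ⟨j, le_top, _, le_rfl, hG j⟩) x, fun x => ringC_hom_deriv G ?_ ?_ ?_ x⟩
  · ext a b
    exact hX' 0 a b
  · intro x
    rw [deriv_inclC, hC, hC, deriv_inclC]
  · intro r
    rw [deriv_inclL, hbase, deriv_inclL]
    exact hbase r′
  · intro j a b
    have h : (inclL σ hσ A C ⊤ (solX σ hσ A ⊤ j le_top a b))′ =
        inclL σ hσ A C ⊤ (solX σ hσ A ⊤ (j + 1) le_top a b) := by
      rw [deriv_inclL]
      exact congrArg _ (Subtype.ext (GenField.deriv_X j a b))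
    rw [h, hX', hX']
    exact Function.iterate_succ_apply' _ _ _

theorem mem_groupH_iff {B : GL (Fin m) C} :
    B ∈ groupH σ hσ A C ↔ ∀ n, IsTranslation σ hσ A C n (prolong n B).1 := by
  constructor
  · rintro ⟨g, hg, hgB⟩ n
    refine isTranslation_of_endomorphism σ hσ A (g : ringC σ hσ A C ⊤ →+* ringC σ hσ A C ⊤)
      (fun r => hg.1 _ (inclL_base_mem _ r)) n le_top _ ?_
    have hd : ∀ x, (g : ringC σ hσ A C ⊤ →+* ringC σ hσ A C ⊤) x′ =
        ((g : ringC σ hσ A C ⊤ →+* ringC σ hσ A C ⊤) x)′ :=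
      fun x => hg.2 _ (Or.inr rfl) x
    rw [fundR_mul_prolong, fundR_map_inclL, ← prolongMatrix_map _ hd]
    exact congrArg _ hgB
  · intro hB
    -- The infinitely generated ring R ⊗ C is treated differently from R_n ⊗ C: the inverse
    -- endomorphism is constructed from `B⁻¹`, whose prolongations are translations because each
    -- ℍ_n(C) is a group.
    have hB' : ∀ n, IsTranslation σ hσ A C n (prolong n B⁻¹).1 := fun n => by
      rw [map_inv]
      exact mem_groupHn_iff.1 (inv_mem (mem_groupHn_iff.2 (hB n)))
    have key : ∀ B : GL (Fin m) C, ∀ G G' : ringC σ hσ A C ⊤ →+* ringC σ hσ A C ⊤,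
        (∀ x, G (inclC σ hσ A C ⊤ x) = inclC σ hσ A C ⊤ x) →
        (∀ r : kConstL σ hσ A, G (inclL σ hσ A C ⊤ (algebraMap _ _ r)) =
          inclL σ hσ A C ⊤ (algebraMap _ _ r)) →
        ((solX σ hσ A ⊤ 0 le_top).map (inclL σ hσ A C ⊤)).map G =
          (solX σ hσ A ⊤ 0 le_top).map (inclL σ hσ A C ⊤) * B.1.map (inclC σ hσ A C ⊤) →
        (∀ x, G x′ = (G x)′) →
        (∀ x, G' (inclC σ hσ A C ⊤ x) = inclC σ hσ A C ⊤ x) →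
        (∀ r : kConstL σ hσ A, G' (inclL σ hσ A C ⊤ (algebraMap _ _ r)) =
          inclL σ hσ A C ⊤ (algebraMap _ _ r)) →
        ((solX σ hσ A ⊤ 0 le_top).map (inclL σ hσ A C ⊤)).map G' =
          (solX σ hσ A ⊤ 0 le_top).map (inclL σ hσ A C ⊤) * B⁻¹.1.map (inclC σ hσ A C ⊤) →
        (∀ x, G' x′ = (G' x)′) → G.comp G' = RingHom.id _ := by
      intro B G G' hC hbase hX hd hC' hbase' hX' hd'
      have h0 : (((solX σ hσ A ⊤ 0 le_top).map (inclL σ hσ A C ⊤)).map G').map G =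
          (solX σ hσ A ⊤ 0 le_top).map (inclL σ hσ A C ⊤) := by
        have h1 : (B⁻¹.1.map (inclC σ hσ A C ⊤)).map G = B⁻¹.1.map (inclC σ hσ A C ⊤) := by
          ext a b
          exact hC _
        rw [hX', Matrix.map_mul, hX, h1, mul_assoc, ← Matrix.map_mul, B.mul_inv,
          Matrix.map_one _ (map_zero _) (map_one _), mul_one]
      refine ringC_hom_ext σ hσ A C (S := ringC σ hσ A C ⊤) (fun x => ?_) (fun r => ?_)
        (fun j _ a b => ?_)
      · rw [RingHom.comp_apply, hC', hC, RingHom.id_apply]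
      · rw [RingHom.comp_apply, hbase', hbase, RingHom.id_apply]
      · rw [RingHom.comp_apply, inclL_solX_iterate, map_iterate_deriv G' hd',
          map_iterate_deriv G hd, RingHom.id_apply]
        exact congrArg _ (congrFun (congrFun h0 a) b)
    obtain ⟨G, hC, hbase, hX, hs, hd⟩ := exists_differential_endomorphism hB
    obtain ⟨G', hC', hbase', hX', hs', hd'⟩ := exists_differential_endomorphism hB'
    have h1 := key B G G' hC hbase hX hd hC' hbase' hX' hd'
    have h2 := key B⁻¹ G' G hC' hbase' hX' hd' hC hbase (by rw [inv_inv]; exact hX) hd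
    refine ⟨RingEquiv.ofRingHom G G' h1 h2, ⟨fun x hx => eq_of_mem_baseC G hC hbase hx, ?_⟩, hX⟩
    rintro _ (rfl | rfl) x
    · exact hs x
    · exact hd x

end Solution

/-! ### Bounding the order -/

/-- The sequence of the entries of a sequence of matrices. -/
def entrySeq {m : ℕ} (hm : 0 < m * m) {S : Type*} (Z : ℕ → Matrix (Fin m) (Fin m) S) (v : ℕ) : S :=
  Z (v / (m * m)) (finProdFinEquiv.symm ⟨v % (m * m), Nat.mod_lt _ hm⟩).1
    (finProdFinEquiv.symm ⟨v % (m * m), Nat.mod_lt _ hm⟩).2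

lemma entrySeq_add {m : ℕ} (hm : 0 < m * m) {S : Type*} (Z : ℕ → Matrix (Fin m) (Fin m) S)
    (v : ℕ) : entrySeq hm Z (v + m * m) = entrySeq hm (fun j => Z (j + 1)) v := by
  simp only [entrySeq, Nat.add_mod_right, Nat.add_div_right _ hm]

lemma exists_entrySeq {m : ℕ} (hm : 0 < m * m) {n j : ℕ} (hj : j < n) (a b : Fin m) :
    ∃ v < n * (m * m), ∀ {S : Type u} (Z : ℕ → Matrix (Fin m) (Fin m) S),
      entrySeq hm Z v = Z j a b := by
  have hlt := (finProdFinEquiv (a, b)).2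
  refine ⟨finProdFinEquiv (a, b) + m * m * j, ?_, fun Z => ?_⟩
  · calc (finProdFinEquiv (a, b) : ℕ) + m * m * j < m * m + m * m * j := by omega
      _ = (j + 1) * (m * m) := by ring
      _ ≤ n * (m * m) := Nat.mul_le_mul_right _ hj
  · have h1 : ((finProdFinEquiv (a, b) : ℕ) + m * m * j) / (m * m) = j := by
      rw [Nat.add_mul_div_left _ _ hm, Nat.div_eq_of_lt hlt, zero_add]
    have h2 : ((finProdFinEquiv (a, b) : ℕ) + m * m * j) % (m * m) = finProdFinEquiv (a, b) := by
      rw [Nat.add_mul_mod_self_left, Nat.mod_eq_of_lt hlt]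
    simp only [entrySeq, h1, h2, Fin.eta, Equiv.symm_apply_apply]

section Solution

variable {m : ℕ} {k : Type u} [Field k] [Differential k]
  {σ : k ≃+* k} {hσ : ∀ x, σ x′ = (σ x)′} {A : GL (Fin m) k}
  {C : Type u} [Field C] [Algebra (constL σ hσ A) C] [Differential C]
  [DifferentialAlgebra (constL σ hσ A) C]

instance : Differential (GenField m k ⊗[constL σ hσ A] C) :=
  tensorDifferential (constL σ hσ A) (GenField m k) C

lemma deriv_tmul_one (x : GenField m k) :
    (x ⊗ₜ[constL σ hσ A] (1 : C))′ = x′ ⊗ₜ[constL σ hσ A] (1 : C) := by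
  refine (tensorDeriv_tmul (constL σ hσ A) (GenField m k) C x 1).trans ?_
  rw [Derivation.map_one_eq_zero, TensorProduct.tmul_zero, add_zero]

lemma deriv_one_tmul (x : C) :
    ((1 : GenField m k) ⊗ₜ[constL σ hσ A] x)′ = (1 : GenField m k) ⊗ₜ[constL σ hσ A] x′ := by
  refine (tensorDeriv_tmul (constL σ hσ A) (GenField m k) C 1 x).trans ?_
  rw [Derivation.map_one_eq_zero, TensorProduct.zero_tmul, zero_add]

instance : DifferentialAlgebra (kConstL σ hσ A) (GenField m k ⊗[constL σ hσ A] C) where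
  deriv_algebraMap r := deriv_tmul_one (r : GenField m k)

lemma translate_prolong (n : ℕ) (B : GL (Fin m) C) :
    translate σ hσ A C (jetX m k n) (prolong n B).1 =
      prolongMatrix n (translate σ hσ A C (GenField.X m k 0) B.1) := by
  have h1 := prolongMatrix_map ((Algebra.TensorProduct.includeLeft :
      GenField m k →ₐ[kConstL σ hσ A] GenField m k ⊗[constL σ hσ A] C) :
        GenField m k →+* GenField m k ⊗[constL σ hσ A] C)
    (fun x => (deriv_tmul_one (σ := σ) (hσ := hσ) (A := A) (C := C) x).symm) n (GenField.X m k 0)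
  have h2 := prolongMatrix_map ((Algebra.TensorProduct.includeRight :
      C →ₐ[constL σ hσ A] GenField m k ⊗[constL σ hσ A] C) :
        C →+* GenField m k ⊗[constL σ hσ A] C)
    (fun x => (deriv_one_tmul (σ := σ) (hσ := hσ) (A := A) (C := C) x).symm) n B.1
  rw [translate, translate, prolongMatrix_mul]
  exact congrArg₂ (· * ·) h1.symm h2.symm

variable (σ hσ A) in
/-- The derivatives of the matrix `X B`. -/
def translateSeq (B : GL (Fin m) C)
    (j : ℕ) : Matrix (Fin m) (Fin m) (GenField m k ⊗[constL σ hσ A] C) :=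
  (translate σ hσ A C (GenField.X m k 0) B.1).map
    (⇑(Differential.deriv (R := GenField m k ⊗[constL σ hσ A] C)))^[j]

/-- The first (n+1)m² terms of the sequence are the entries of X, …, X^{(n)}. They occur in the
first block column of X_[n], and all other entries of X_[n] are integer multiples of them. -/
lemma graphAlg_entrySeq (hm : 0 < m * m) (n : ℕ) (B : GL (Fin m) C) :
    graphAlg (kConstL σ hσ A)
      (fun i : Set.Iio ((n + 1) * (m * m)) => entrySeq hm (GenField.X m k) i.1)
      (fun i : Set.Iio ((n + 1) * (m * m)) => entrySeq hm (translateSeq σ hσ A B) i.1) =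
    graphAlg (kConstL σ hσ A)
      (fun v : (Fin (n + 1) × Fin m) × (Fin (n + 1) × Fin m) => jetX m k n v.1 v.2)
      (fun v => translate σ hσ A C (jetX m k n) (prolong n B).1 v.1 v.2) := by
  apply le_antisymm
  · refine graphAlg_le fun i => ?_
    have hi : i.1 / (m * m) < n + 1 := (Nat.div_lt_iff_lt_mul hm).2 i.2
    have := mem_graphAlg (K := kConstL σ hσ A)
      (fun v : (Fin (n + 1) × Fin m) × (Fin (n + 1) × Fin m) => jetX m k n v.1 v.2)
      (fun v => translate σ hσ A C (jetX m k n) (prolong n B).1 v.1 v.2)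
      ((⟨i.1 / (m * m), hi⟩, (finProdFinEquiv.symm ⟨i.1 % (m * m), Nat.mod_lt _ hm⟩).1),
        (0, (finProdFinEquiv.symm ⟨i.1 % (m * m), Nat.mod_lt _ hm⟩).2))
    rw [jetX_zero_right, translate_prolong, prolongMatrix_zero_right] at this
    rw [translate_prolong]
    exact this
  · refine graphAlg_le fun v => ?_
    obtain ⟨w, hw, hw'⟩ := exists_entrySeq.{u} hm
      (lt_of_le_of_lt (Nat.sub_le v.1.1 v.2.1) v.1.1.2) v.1.2 v.2.2
    have h := mul_mem (natCast_mem (graphAlg (kConstL σ hσ A)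
        (fun i : Set.Iio ((n + 1) * (m * m)) => entrySeq hm (GenField.X m k) i.1)
        (fun i : Set.Iio ((n + 1) * (m * m)) => entrySeq hm (translateSeq σ hσ A B) i.1))
        ((v.1.1 : ℕ).choose v.2.1))
      (mem_graphAlg (K := kConstL σ hσ A)
        (fun i : Set.Iio ((n + 1) * (m * m)) => entrySeq hm (GenField.X m k) i.1)
        (fun i : Set.Iio ((n + 1) * (m * m)) => entrySeq hm (translateSeq σ hσ A B) i.1) ⟨w, hw⟩)
    rw [hw' (GenField.X m k), hw' (translateSeq σ hσ A B)] at h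
    rw [translate_prolong, jetX_apply]
    exact h

lemma isTranslation_prolong_iff (hm : 0 < m * m) (n : ℕ) (B : GL (Fin m) C) :
    IsTranslation σ hσ A C n (prolong n B).1 ↔ IsSpec (kConstL σ hσ A)
      (fun i : Set.Iio ((n + 1) * (m * m)) => entrySeq hm (GenField.X m k) i.1)
      (fun i : Set.Iio ((n + 1) * (m * m)) => entrySeq hm (translateSeq σ hσ A B) i.1) := by
  simp only [IsTranslation, IsSpec, graphAlg_entrySeq]

end Solution

/-- Finitely many of the prolonged systems determine the differential Galois group. -/
theorem exists_bound_isTranslation {m : ℕ} {k : Type u} [Field k] [Differential k] [CharZero k] (σ : k ≃+* k) (hσ : ∀ x, σ x′ = (σ x)′)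
    (A : GL (Fin m) k) : ∃ n₀ : ℕ, ∀ (C : Type u) [Field C] [Differential C]
      [Algebra (constL σ hσ A) C] [DifferentialAlgebra (constL σ hσ A) C] (B : GL (Fin m) C),
      IsTranslation σ hσ A C n₀ (prolong n₀ B).1 →
        ∀ n, IsTranslation σ hσ A C n (prolong n B).1 := by
  -- For m = 0 there are no entries to enumerate, and the only matrix is the identity.
  rcases Nat.eq_zero_or_pos m with rfl | hm0
  · refine ⟨0, fun C _ _ _ _ B _ n => ?_⟩
    have hB : B = 1 := Subsingleton.elim _ _
    rw [hB, map_one]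
    exact mem_groupHn_iff.1 (one_mem _)
  have hm : 0 < m * m := Nat.mul_pos hm0 hm0
  have : CharZero (GenField m k) :=
    charZero_of_injective_algebraMap (algebraMap k (GenField m k)).injective
  obtain ⟨N, hN⟩ := exists_bound_isSpec.{u} (K := kConstL σ hσ A)
    (entrySeq hm (GenField.X m k)) hm (fun v => by
      rw [entrySeq_add]
      exact GenField.deriv_X _ _ _)
  refine ⟨N, fun C _ _ _ _ B hB n => ?_⟩
  have hz : ∀ v, (entrySeq hm (translateSeq σ hσ A B) v)′ =
      entrySeq hm (translateSeq σ hσ A B) (v + m * m) := fun v => by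
    rw [entrySeq_add]
    exact (Function.iterate_succ_apply' _ _ _).symm
  rw [isTranslation_prolong_iff hm] at hB ⊢
  refine hN _ (entrySeq hm (translateSeq σ hσ A B)) hz ?_ ?_ _
  -- An empty block generates only K, whose nonzero elements are units. For n + 1 blocks, the
  -- specialization is a translation of order n and comes from an automorphism.
  · rintro (_ | n) hs p hp hp0
    · have hempty : (Set.range fun i : Set.Iio (0 * (m * m)) =>
          (entrySeq hm (GenField.X m k) i.1, entrySeq hm (translateSeq σ hσ A B) i.1)) = ∅ := by
        rw [Set.range_eq_empty_iff]
        exact ⟨fun i => absurd i.2 (by simp)⟩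
      rw [graphAlg, hempty, Algebra.adjoin_empty, Algebra.mem_bot] at hp
      obtain ⟨t, rfl⟩ := hp
      have ht : t ≠ 0 := by
        rintro rfl
        exact hp0 (by simp)
      exact (IsUnit.map (algebraMap (kConstL σ hσ A) (GenField m k ⊗[constL σ hσ A] C))
        (Ne.isUnit ht)).mem_nonZeroDivisors
    · rw [graphAlg_entrySeq] at hp
      exact IsTranslation.mem_nonZeroDivisors (B := prolong n B)
        ((isTranslation_prolong_iff hm n B).2 hs) hp hp0
  -- Order `N` covers (N+1)m² terms, which include the first `N`.
  · refine IsSpec.of_mem hB fun i => mem_graphAlg (K := kConstL σ hσ A)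
      (fun i : Set.Iio ((N + 1) * (m * m)) => entrySeq hm (GenField.X m k) i.1)
      (fun i : Set.Iio ((N + 1) * (m * m)) => entrySeq hm (translateSeq σ hσ A B) i.1)
      ⟨i.1, ?_⟩
    refine lt_of_lt_of_le (b := N) i.2 ?_
    exact (Nat.le_succ N).trans (Nat.le_mul_of_pos_right _ hm)

/-! ### Differential points -/

/-- A polynomial in the product of two matrices which is not nilpotent after one pair of
specializations does not vanish at some pair of differential specializations. -/
theorem exists_differentialField_pair {K L M M' R C : Type u} {ι : Type*} [Field K] [Field L]
    [CharZero L] [CommRing M] [CommRing M'] [CommRing R] [CommRing C] [Fintype ι]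
    [Algebra K L] [Algebra K M] [Algebra K M'] [Algebra K R] [Differential K] [Differential L]
    [Differential M] [DifferentialAlgebra K L] [DifferentialAlgebra K M]
    (j : R →ₐ[K] M) (hj : Function.Injective j) (u : L →ₐ[K] M') (v : R →ₐ[K] M') (γ : C →+* R)
    (U : Matrix ι ι L) (V : Matrix ι ι R) (P : MvPolynomial (ι × ι) C)
    (hP : ¬ IsNilpotent (MvPolynomial.eval₂ ((v : R →+* M').comp γ)
      (fun w => (U.map u * V.map v) w.1 w.2) P)) :
    ∃ (E : Type u) (_ : Field E) (_ : Differential E) (α : L →+* E) (β : M →+* E),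
      (∀ x, α x′ = (α x)′) ∧ (∀ x, β x′ = (β x)′) ∧
      (∀ x : K, α (algebraMap K L x) = β (algebraMap K M x)) ∧
      MvPolynomial.eval₂ (β.comp ((j : R →+* M).comp γ))
        (fun w => (U.map α * (V.map j).map β) w.1 w.2) P ≠ 0 := by
  let iL : L →ₐ[K] L ⊗[K] R := Algebra.TensorProduct.includeLeft
  let iR : R →ₐ[K] L ⊗[K] R := Algebra.TensorProduct.includeRight
  -- `p` is the universal version of the given element: `ψ` specializes it to the value of `P`
  -- assumed non-nilpotent, so `p` is not nilpotent.
  let p : L ⊗[K] R := MvPolynomial.eval₂ ((iR : R →+* L ⊗[K] R).comp γ)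
    (fun w => (U.map iL * V.map iR) w.1 w.2) P
  -- `R` carries no derivation. So `p` is moved along `φ`, injective by flatness over the field `K`,
  -- into a differential ring.
  let _ : Differential (L ⊗[K] M) := tensorDifferential K L M
  let φ : L ⊗[K] R →ₐ[K] L ⊗[K] M := Algebra.TensorProduct.map (AlgHom.id K L) j
  have hφ : Function.Injective φ :=
    Module.Flat.lTensor_preserves_injective_linearMap j.toLinearMap hj
  let ψ : L ⊗[K] R →ₐ[K] M' := Algebra.TensorProduct.productMap u v
  have hψL : ∀ x, ψ (iL x) = u x := fun x => by simp [ψ, iL]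
  have hψR : ∀ x, ψ (iR x) = v x := fun x => by simp [ψ, iR]
  have hp : ¬ IsNilpotent p := by
    intro h
    refine hP ?_
    have h1 := h.map ψ
    have h2 : ψ p = MvPolynomial.eval₂ ((v : R →+* M').comp γ)
        (fun w => (U.map u * V.map v) w.1 w.2) P := by
      have := MvPolynomial.hom_eval₂ P ((iR : R →+* L ⊗[K] R).comp γ) (ψ : L ⊗[K] R →+* M')
        (fun w => (U.map iL * V.map iR) w.1 w.2)
      refine this.trans ?_
      congr 1
      · ext x
        exact hψR _
      · ext w
        simp only [Matrix.mul_apply, Matrix.map_apply, map_sum, map_mul, RingHom.coe_coe,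
          hψL, hψR]
    rwa [h2] at h1
  let _ : Algebra ℚ (L ⊗[K] M) :=
    ((Algebra.TensorProduct.includeLeft : L →ₐ[K] L ⊗[K] M).toRingHom.comp
      (algebraMap ℚ L)).toAlgebra
  obtain ⟨E, _, _, θ, hθ, hθp⟩ := exists_differentialField (φ p)
    (fun h => hp ((IsNilpotent.map_iff hφ).1 h))
  refine ⟨E, inferInstance, inferInstance,
    θ.comp (Algebra.TensorProduct.includeLeft : L →ₐ[K] L ⊗[K] M).toRingHom,
    θ.comp (Algebra.TensorProduct.includeRight : M →ₐ[K] L ⊗[K] M).toRingHom,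
    fun x => ?_, fun x => ?_, fun x => ?_, ?_⟩
  · have h : (x ⊗ₜ[K] (1 : M))′ = x′ ⊗ₜ[K] (1 : M) := by
      refine (tensorDeriv_tmul K L M x 1).trans ?_
      rw [Derivation.map_one_eq_zero, TensorProduct.tmul_zero, add_zero]
    refine (congrArg θ h.symm).trans (hθ _)
  · have h : ((1 : L) ⊗ₜ[K] x)′ = (1 : L) ⊗ₜ[K] x′ := by
      refine (tensorDeriv_tmul K L M 1 x).trans ?_
      rw [Derivation.map_one_eq_zero, TensorProduct.zero_tmul, zero_add]
    refine (congrArg θ h.symm).trans (hθ _)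
  · refine congrArg θ ?_
    exact ((Algebra.TensorProduct.includeLeft : L →ₐ[K] L ⊗[K] M).commutes x).trans
      ((Algebra.TensorProduct.includeRight : M →ₐ[K] L ⊗[K] M).commutes x).symm
  · refine ne_of_eq_of_ne ?_ hθp
    have := MvPolynomial.hom_eval₂ P ((iR : R →+* L ⊗[K] R).comp γ)
      (θ.comp (φ : L ⊗[K] R →+* L ⊗[K] M)) (fun w => (U.map iL * V.map iR) w.1 w.2)
    refine Eq.trans ?_ this.symm
    congr 1
    have hm : U.map (θ.comp (Algebra.TensorProduct.includeLeft : L →ₐ[K] L ⊗[K] M).toRingHom) *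
        (V.map j).map (θ.comp (Algebra.TensorProduct.includeRight : M →ₐ[K] L ⊗[K] M).toRingHom) =
        (U.map iL * V.map iR).map (θ.comp (φ : L ⊗[K] R →+* L ⊗[K] M)) := by
      rw [Matrix.map_mul]
      refine congrArg₂ (· * ·) ?_ ?_
      · ext a b
        simp [φ, iL]
      · ext a b
        simp [φ, iR]
    ext w
    exact congrFun (congrFun hm w.1) w.2

/-- Systems in a finite family of unknowns over a differentially closed field. -/
lemma IsDifferentiallyClosed.exists_solution {C : Type u} [Field C] [Differential C]
    (hC : IsDifferentiallyClosed C) {ι : Type*} [Finite ι] {S : Set (MvPolynomial (ι × ℕ) C)}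
    (hS : S.Finite) (E : Type u) [Field E] [Differential E] [Algebra C E] [DifferentialAlgebra C E]
    (y : ι → E) (hy : ∀ p ∈ S,
      MvPolynomial.aeval (fun v => (⇑(Differential.deriv (R := E)))^[v.2] (y v.1)) p = 0) :
    ∃ z : ι → C, ∀ p ∈ S,
      MvPolynomial.aeval (fun v => (⇑(Differential.deriv (R := C)))^[v.2] (z v.1)) p = 0 := by
  classical
  obtain ⟨r, ⟨e⟩⟩ := Finite.exists_equiv_fin ι
  obtain ⟨z, hz⟩ := hC r (hS.toFinset.image (MvPolynomial.rename (Prod.map e id)))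
    ⟨E, inferInstance, inferInstance, inferInstance, inferInstance, y ∘ e.symm, by
      intro p hp
      obtain ⟨q, hq, rfl⟩ := Finset.mem_image.1 hp
      rw [MvPolynomial.aeval_rename, ← hy q (hS.mem_toFinset.1 hq)]
      congr 2
      ext v
      simp⟩
  refine ⟨z ∘ e, fun p hp => ?_⟩
  rw [← hz _ (Finset.mem_image_of_mem _ (hS.mem_toFinset.2 hp)), MvPolynomial.aeval_rename]
  rfl

/-- The prolongation of a matrix of unknowns. -/
def unknownMatrix (m : ℕ) (C : Type*) [CommRing C] (n : ℕ) :
    Matrix (Fin (n + 1) × Fin m) (Fin (n + 1) × Fin m)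
      (MvPolynomial (Option (Fin m × Fin m) × ℕ) C) :=
  Matrix.of fun (p q : Fin (n + 1) × Fin m) =>
    ((p.1 : ℕ).choose q.1 : MvPolynomial (Option (Fin m × Fin m) × ℕ) C) *
    (MvPolynomial.X (some (p.2, q.2), (p.1 : ℕ) - q.1) :
      MvPolynomial (Option (Fin m × Fin m) × ℕ) C)

lemma aeval_unknownMatrix {m : ℕ} {C E : Type*} [CommRing C] [CommRing E] [Differential E]
    [Algebra C E] (n : ℕ) (y : Option (Fin m × Fin m) → E)
    (f : MvPolynomial ((Fin (n + 1) × Fin m) × (Fin (n + 1) × Fin m)) C) :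
    MvPolynomial.aeval (fun v => (⇑(Differential.deriv (R := E)))^[v.2] (y v.1))
      (MvPolynomial.aeval (fun v => unknownMatrix m C n v.1 v.2) f) =
    MvPolynomial.aeval
      (fun v => prolongMatrix n (Matrix.of fun a b => y (some (a, b))) v.1 v.2) f := by
  rw [MvPolynomial.comp_aeval_apply]
  congr 2
  ext v
  simp [unknownMatrix, prolongMatrix]

/-- Over a differentially closed field, the matrices whose prolongation satisfies a system of
equations and one inequation. -/
lemma IsDifferentiallyClosed.exists_matrix {C : Type u} [Field C] [Differential C]
    (hC : IsDifferentiallyClosed C) {m : ℕ} (N n : ℕ)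
    {S : Set (MvPolynomial ((Fin (N + 1) × Fin m) × (Fin (N + 1) × Fin m)) C)} (hS : S.Finite)
    (P : MvPolynomial ((Fin (n + 1) × Fin m) × (Fin (n + 1) × Fin m)) C)
    (E : Type u) [Field E] [Differential E] [Algebra C E] [DifferentialAlgebra C E]
    (Y : Matrix (Fin m) (Fin m) E) (hdet : Y.det ≠ 0)
    (hY : ∀ f ∈ S, MvPolynomial.aeval (fun v => prolongMatrix N Y v.1 v.2) f = 0)
    (hP : MvPolynomial.aeval (fun v => prolongMatrix n Y v.1 v.2) P ≠ 0) :
    ∃ B : GL (Fin m) C,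
      (∀ f ∈ S, MvPolynomial.aeval (fun v => (prolong N B).1 v.1 v.2) f = 0) ∧
      MvPolynomial.aeval (fun v => (prolong n B).1 v.1 v.2) P ≠ 0 := by
  let Q := MvPolynomial (Option (Fin m × Fin m) × ℕ) C
  let Z : Matrix (Fin m) (Fin m) Q := Matrix.of fun a b => MvPolynomial.X (some (a, b), 0)
  -- Rabinowitsch's trick: the unknown `none` is an inverse of the determinant times the value of
  -- `P`, which makes both inequations a single equation.
  let w : Q := MvPolynomial.X (none, 0) * (Z.det *
    MvPolynomial.aeval (fun v => unknownMatrix m C n v.1 v.2) P) - 1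
  have hw : ∀ {F : Type u} [Field F] [Differential F] [Algebra C F]
      (y : Option (Fin m × Fin m) → F),
      MvPolynomial.aeval (fun v => (⇑(Differential.deriv (R := F)))^[v.2] (y v.1)) w =
        y none * ((Matrix.of fun a b => y (some (a, b))).det * MvPolynomial.aeval
          (fun v => prolongMatrix n (Matrix.of fun a b => y (some (a, b))) v.1 v.2) P) - 1 := by
    intro F _ _ _ y
    simp only [w, map_sub, map_mul, map_one, aeval_unknownMatrix, MvPolynomial.aeval_X,
      Function.iterate_zero, id_eq, AlgHom.map_det]
    congr 4
    ext a b
    simp [Z]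
  obtain ⟨y, hy0, hy⟩ : ∃ y : Option (Fin m × Fin m) → E,
      y none = (Y.det * MvPolynomial.aeval (fun v => prolongMatrix n Y v.1 v.2) P)⁻¹ ∧
      (Matrix.of fun a b => y (some (a, b))) = Y :=
    ⟨fun o => o.elim (Y.det * MvPolynomial.aeval (fun v => prolongMatrix n Y v.1 v.2) P)⁻¹
      (fun p => Y p.1 p.2), rfl, rfl⟩
  obtain ⟨z, hz⟩ := hC.exists_solution (ι := Option (Fin m × Fin m))
    (S := insert w ((fun f => MvPolynomial.aeval (fun v => unknownMatrix m C N v.1 v.2) f) '' S))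
    ((hS.image _).insert _) E y (by
    rintro _ (rfl | ⟨f, hf, rfl⟩)
    · rw [hw, hy0, hy, inv_mul_cancel₀ (mul_ne_zero hdet hP), sub_self]
    · refine (aeval_unknownMatrix N y f).trans ?_
      rw [hy]
      exact hY f hf)
  have hz0 := hz w (Or.inl rfl)
  rw [hw, sub_eq_zero] at hz0
  have hz1 := right_ne_zero_of_mul (hz0.trans_ne one_ne_zero)
  refine ⟨Matrix.GeneralLinearGroup.mkOfDetNeZero (Matrix.of fun a b => z (some (a, b)))
    (left_ne_zero_of_mul hz1), fun f hf => ?_, right_ne_zero_of_mul hz1⟩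
  exact (aeval_unknownMatrix N z f).symm.trans (hz _ (Or.inr ⟨f, hf, rfl⟩))

section Solution

variable {m : ℕ} {k : Type u} [Field k] [Differential k]
  {σ : k ≃+* k} {hσ : ∀ x, σ x′ = (σ x)′} {A : GL (Fin m) k}
  {C : Type u} [Field C] [Algebra (constL σ hσ A) C]

/-! ### Density -/

lemma isTranslation_iff_constIdeal {n : ℕ}
    (B : Matrix (Fin (n + 1) × Fin m) (Fin (n + 1) × Fin m) C) :
    IsTranslation σ hσ A C n B ↔
      ∀ f ∈ constIdeal (constL σ hσ A) (kConstL σ hσ A) (jetX m k n),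
        MvPolynomial.aeval (fun v => B v.1 v.2) f = 0 :=
  isSpec_iff_constIdeal (σ := sigmaL σ hσ A) (σK := sigmaK σ hσ A) (A := prolongA σ hσ A n)
    (fun _ => rfl) (sigmaL_jetX σ hσ A n) (fun x hx => ⟨⟨x, hx⟩, rfl⟩) B

/-- Since g(X_[n]) = X_[n]B, multiplying by X_[n]⁻¹ leaves `B`. The value is therefore the nonzero
element P(B) of the field `C`, which embeds in `L ⊗ C`. -/
lemma eval₂_translate_ne_zero {n : ℕ} {g : ringC σ hσ A C n ≃+* ringC σ hσ A C n}
    (hg : ∀ x, g (inclC σ hσ A C n x) = inclC σ hσ A C n x) {B : GL (Fin (n + 1) × Fin m) C}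
    (hgB : ((fundR σ hσ A n le_rfl).map (inclL σ hσ A C n)).map g =
      (fundR σ hσ A n le_rfl).map (inclL σ hσ A C n) * B.1.map (inclC σ hσ A C n))
    (P : MvPolynomial ((Fin (n + 1) × Fin m) × (Fin (n + 1) × Fin m)) C)
    (hP : MvPolynomial.eval (fun v => B.1 v.1 v.2) P ≠ 0)
    (v : ringC σ hσ A C n →ₐ[kConstL σ hσ A] GenField m k ⊗[constL σ hσ A] C)
    (hv : ∀ x, v x = inclM σ hσ A C n (g x)) :
    ¬ IsNilpotent (MvPolynomial.eval₂
      ((v : ringC σ hσ A C n →+* GenField m k ⊗[constL σ hσ A] C).comp (inclC σ hσ A C n))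
      (fun w => ((fundL m k n)⁻¹.1.map (Algebra.TensorProduct.includeLeft :
        GenField m k →ₐ[kConstL σ hσ A] GenField m k ⊗[constL σ hσ A] C) *
        ((fundR σ hσ A n le_rfl).map (inclL σ hσ A C n)).map v) w.1 w.2) P) := by
  set iL : GenField m k →ₐ[kConstL σ hσ A] GenField m k ⊗[constL σ hσ A] C :=
    Algebra.TensorProduct.includeLeft with hiL
  let iR : C →ₐ[constL σ hσ A] GenField m k ⊗[constL σ hσ A] C :=
    Algebra.TensorProduct.includeRight
  have h1 : ((fundR σ hσ A n le_rfl).map (inclL σ hσ A C n)).map v =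
      (jetX m k n).map iL * B.1.map iR := by
    have : ((fundR σ hσ A n le_rfl).map (inclL σ hσ A C n)).map v =
        (((fundR σ hσ A n le_rfl).map (inclL σ hσ A C n)).map g).map (inclM σ hσ A C n) := by
      ext p q
      exact hv _
    rw [this, hgB, inclM_fundR]
    rfl
  have h2 : (fundL m k n)⁻¹.1.map iL *
      ((fundR σ hσ A n le_rfl).map (inclL σ hσ A C n)).map v = B.1.map iR := by
    rw [h1, ← mul_assoc, ← Matrix.map_mul, ← fundL_val, Units.inv_mul,
      Matrix.map_one _ (map_zero _) (map_one _), one_mul]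
  have h3 : ((v : ringC σ hσ A C n →+* GenField m k ⊗[constL σ hσ A] C).comp
      (inclC σ hσ A C n)) = (iR : C →+* GenField m k ⊗[constL σ hσ A] C) := by
    ext x
    refine (hv _).trans ?_
    rw [hg]
    simp [inclM, inclC, iR]
  rw [h2, h3]
  have h4 : MvPolynomial.eval₂ (iR : C →+* GenField m k ⊗[constL σ hσ A] C)
      (fun w => (B.1.map iR) w.1 w.2) P = iR (MvPolynomial.eval (fun v => B.1 v.1 v.2) P) := by
    rw [MvPolynomial.eval, MvPolynomial.coe_eval₂Hom]
    refine Eq.trans ?_ (MvPolynomial.hom_eval₂ P (RingHom.id C)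
      (iR : C →+* GenField m k ⊗[constL σ hσ A] C) (fun v => B.1 v.1 v.2)).symm
    rfl
  rw [h4, IsNilpotent.map_iff (Algebra.TensorProduct.includeRight_injective (R := constL σ hσ A)
      (A := GenField m k) (B := C) (FaithfulSMul.algebraMap_injective _ _))]
  exact fun h => hP h.eq_zero

variable [Differential C] [DifferentialAlgebra (constL σ hσ A) C]

/-- A point of ℍ_n(C) with P ≠ 0 yields a differential point over some extension field of `C`, where
only finitely many equations and one inequation matter. A differentially closed `C` then already has
such a point. `N` is arbitrary here, and independent of `n`. -/
lemma exists_prolong_eval_ne_zero [CharZero k] (hC : IsDifferentiallyClosed C) {n : ℕ}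
    {B₀ : GL (Fin (n + 1) × Fin m) C} (hB₀ : B₀ ∈ groupHn σ hσ A C n)
    (P : MvPolynomial ((Fin (n + 1) × Fin m) × (Fin (n + 1) × Fin m)) C)
    (hP : MvPolynomial.eval (fun v => B₀.1 v.1 v.2) P ≠ 0) (N : ℕ) :
    ∃ B : GL (Fin m) C, IsTranslation σ hσ A C N (prolong N B).1 ∧
      MvPolynomial.eval (fun v => (prolong n B).1 v.1 v.2) P ≠ 0 := by
  have : CharZero (GenField m k) :=
    charZero_of_injective_algebraMap (algebraMap k (GenField m k)).injective
  obtain ⟨g, hg, hgB⟩ := hB₀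
  let iL : GenField m k →ₐ[kConstL σ hσ A] GenField m k ⊗[constL σ hσ A] C :=
    Algebra.TensorProduct.includeLeft
  let iR : C →ₐ[constL σ hσ A] GenField m k ⊗[constL σ hσ A] C :=
    Algebra.TensorProduct.includeRight
  let v : ringC σ hσ A C n →ₐ[kConstL σ hσ A] GenField m k ⊗[constL σ hσ A] C :=
    { (inclM σ hσ A C n).toRingHom.comp (g : ringC σ hσ A C n →+* ringC σ hσ A C n) with
      commutes' := fun r => (congrArg (inclM σ hσ A C n) (hg.1 _ (inclL_base_mem _ r))).trans
        ((inclM σ hσ A C n).commutes r) }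
  obtain ⟨E, _, _, α, β, hα, hβ, hαβ, hne⟩ := exists_differentialField_pair
    (K := kConstL σ hσ A) (L := GenField m k) (inclM σ hσ A C n) (inclM_injective σ hσ A C n) iL v
    (inclC σ hσ A C n) (fundL m k n)⁻¹.1 ((fundR σ hσ A n le_rfl).map (inclL σ hσ A C n)) P
    (eval₂_translate_ne_zero (fun x => hg.1 _ (inclC_mem σ hσ A C n x)) hgB P hP v fun _ => rfl)
  let ρ : GenField m k →+* E := β.comp (iL : GenField m k →+* _)
  have hρ : ∀ x, ρ x′ = (ρ x)′ := fun x => by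
    have := hβ (x ⊗ₜ 1)
    rw [deriv_tmul_one] at this
    exact this
  let _ : Algebra C E := (β.comp (iR : C →+* _)).toAlgebra
  have hCE : DifferentialAlgebra C E := ⟨fun x => by
    have := hβ (1 ⊗ₜ x)
    rw [deriv_one_tmul] at this
    exact this.symm⟩
  let _ : Algebra (constL σ hσ A) E :=
    ((algebraMap C E).comp (algebraMap (constL σ hσ A) C)).toAlgebra
  have htower : IsScalarTower (constL σ hσ A) C E := IsScalarTower.of_algebraMap_eq fun _ => rfl
  let _ : Algebra (kConstL σ hσ A) E := (α.comp (algebraMap (kConstL σ hσ A) _)).toAlgebra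
  let αK : GenField m k →ₐ[kConstL σ hσ A] E := { α with commutes' := fun _ => rfl }
  let ρK : GenField m k →ₐ[kConstL σ hσ A] E :=
    { ρ with commutes' := fun r => (hαβ r).symm }
  -- `Y` is the quotient of the images of X under `α` and `ρ`, two differential embeddings of L that
  -- agree on K. Its prolongations are the corresponding quotients of the images of X_[j].
  let Y : Matrix (Fin m) (Fin m) E := (XL m k)⁻¹.1.map α * (GenField.X m k 0).map ρ
  have hY : ∀ j, prolongMatrix j Y = (fundL m k j)⁻¹.1.map α * (jetX m k j).map ρ := by
    intro j
    rw [prolongMatrix_mul, prolongMatrix_map α hα, prolongMatrix_map ρ hρ, fundL, ← map_inv]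
    rfl
  have hdet : Y.det ≠ 0 := by
    rw [Matrix.det_mul, ← RingHom.mapMatrix_apply, ← RingHom.mapMatrix_apply, ← RingHom.map_det,
      ← RingHom.map_det]
    exact mul_ne_zero
      ((map_ne_zero α).2 ((XL m k)⁻¹.isUnit.map Matrix.detMonoidHom).ne_zero)
      ((map_ne_zero ρ).2 (det_X_ne_zero m k))
  have hconst : ∀ f ∈ constIdeal (constL σ hσ A) (kConstL σ hσ A) (jetX m k N),
      MvPolynomial.aeval (fun v => prolongMatrix N Y v.1 v.2) f = 0 := by
    intro f hf
    refine eval_constIdeal αK (fun x => ?_) (prolongMatrix N Y) ?_ hf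
    -- On `C_L`, `α` agrees with `ρ` because `C_L` lies in K, and `ρ` agrees with the structure map
    -- through `C` because the tensor product is taken over `C_L`.
    · have h1 : α (x : GenField m k) = ρ (x : GenField m k) :=
        hαβ (algebraMap (constL σ hσ A) (kConstL σ hσ A) x)
      refine h1.trans (congrArg β ?_)
      exact (iR.commutes x).symm
    -- Multiplication by Y_[N] turns the `α`-copy of X_[N] into the `ρ`-copy. The latter satisfies
    -- all the relations over K, since `ρ` is a K-homomorphism.
    · have h1 : (jetX m k N).map αK * prolongMatrix N Y = (jetX m k N).map ρK := by
        have : (jetX m k N).map αK = (fundL m k N).1.map α := rfl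
        rw [hY, this, ← mul_assoc, ← Matrix.map_mul, Units.mul_inv,
          Matrix.map_one _ (map_zero _) (map_one _), one_mul]
        rfl
      rw [h1, isSpec_iff]
      intro f hf
      have := MvPolynomial.comp_aeval_apply (fun v : (Fin (N + 1) × Fin m) ×
        (Fin (N + 1) × Fin m) => jetX m k N v.1 v.2) ρK f
      rw [hf, map_zero] at this
      exact this.symm
  -- Hilbert's basis theorem makes the system finite, as differential closedness requires.
  obtain ⟨T, hT⟩ := IsNoetherian.noetherian
    (constIdeal (constL σ hσ A) (kConstL σ hσ A) (jetX m k N))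
  have hTmem : ∀ f ∈ T, f ∈ constIdeal (constL σ hσ A) (kConstL σ hσ A) (jetX m k N) :=
    fun f hf => hT ▸ Submodule.subset_span hf
  obtain ⟨B, hB, hBP⟩ := hC.exists_matrix N n
    (S := MvPolynomial.map (algebraMap (constL σ hσ A) C) '' (T : Set _))
    (T.finite_toSet.image _) P E Y hdet (by
      rintro _ ⟨f, hf, rfl⟩
      rw [MvPolynomial.aeval_map_algebraMap]
      exact hconst f (hTmem f hf)) (by
      rw [hY]
      refine ne_of_eq_of_ne ?_ hne
      rw [MvPolynomial.aeval_def]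
      congr 1
      ext w
      rw [← fundR_val σ hσ A n le_rfl]
      rfl)
  refine ⟨B, (isTranslation_iff_constIdeal _).2 fun f hf => ?_, hBP⟩
  rw [← hT] at hf
  suffices hle : Ideal.span (T : Set (MvPolynomial _ (constL σ hσ A))) ≤
      RingHom.ker (MvPolynomial.aeval (R := constL σ hσ A)
        (fun v : (Fin (N + 1) × Fin m) × (Fin (N + 1) × Fin m) =>
          (prolong N B).1 v.1 v.2)).toRingHom from hle hf
  rw [Ideal.span_le]
  intro f hf
  have := hB _ ⟨f, hf, rfl⟩
  rw [MvPolynomial.aeval_map_algebraMap] at this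
  exact this

end Solution

/-- The image of the differential Galois group is Zariski dense in the difference Galois groups. -/
theorem isZariskiDenseIn_groupH {m : ℕ} {k : Type u} [Field k] [Differential k] [CharZero k]
    (σ : k ≃+* k) (hσ : ∀ x, σ x′ = (σ x)′) (A : GL (Fin m) k) (C : Type u) [Field C]
    [Algebra (constL σ hσ A) C] [Differential C] [DifferentialAlgebra (constL σ hσ A) C]
    (hC : IsDifferentiallyClosed C) (n : ℕ) :
    IsZariskiDenseIn (prolong n '' (groupH σ hσ A C : Set (GL (Fin m) C)))
      (groupHn σ hσ A C n : Set (GL (Fin (n + 1) × Fin m) C)) := by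
  obtain ⟨N, hN⟩ := exists_bound_isTranslation σ hσ A
  refine ⟨?_, fun P hP B₀ hB₀ => ?_⟩
  · rintro _ ⟨B, hB, rfl⟩
    exact mem_groupHn_iff.2 (mem_groupH_iff.1 hB n)
  · by_contra hne
    obtain ⟨B, hB, hBP⟩ := exists_prolong_eval_ne_zero hC hB₀ P hne N
    exact hBP (hP _ ⟨B, mem_groupH_iff.2 (hN C B hB), rfl⟩)

/-! ### Galois groups as matrix groups -/

/-- `M⁻¹ g(M)` is fixed by `T`: applying `T` replaces `M` by `AM`, and `A` cancels because `g` fixes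
it. Its inverse is fixed as well, and descends separately so that the matrix over `C` is invertible.
-/
lemma exists_matrix_of_fixed {ι E C : Type*} [Fintype ι] [DecidableEq ι] [CommRing C] [CommRing E]
    (f : C →+* E) (hf : Function.Injective f) (M A : GL ι E) (g T : E →+* E)
    (hgT : ∀ x, g (T x) = T (g x)) (hT : M.1.map T = A.1 * M.1) (hA : A.1.map g = A.1)
    (hfix : ∀ x, T x = x → ∃ c, f c = x) :
    ∃ B : GL ι C, M.1.map g = M.1 * B.1.map f := by
  let τ : GL ι E →* GL ι E := Units.map (T.mapMatrix : Matrix ι ι E →+* Matrix ι ι E).toMonoidHom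
  let γ : GL ι E →* GL ι E := Units.map (g.mapMatrix : Matrix ι ι E →+* Matrix ι ι E).toMonoidHom
  have hτM : τ M = A * M := Units.ext hT
  have hγA : γ A = A := Units.ext hA
  have hτγ : τ (γ M) = γ (τ M) := Units.ext (by
    ext i j
    exact (hgT _).symm)
  set D : GL ι E := M⁻¹ * γ M with hD
  have hτD : τ D = D := by
    rw [hD, map_mul, map_inv, hτγ, hτM, map_mul, hγA]
    group
  have hτD' : τ D⁻¹ = D⁻¹ := by rw [map_inv, hτD]
  have hlift : ∀ Z : GL ι E, τ Z = Z → ∃ N : Matrix ι ι C, N.map f = Z.1 := by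
    intro Z hZ
    choose N hN using fun i j => hfix (Z.1 i j)
      (congrArg (fun z : GL ι E => z.1 i j) hZ)
    exact ⟨Matrix.of N, by ext i j; exact hN i j⟩
  obtain ⟨N, hN⟩ := hlift D hτD
  obtain ⟨N', hN'⟩ := hlift D⁻¹ hτD'
  have h1 : N * N' = 1 := by
    apply Matrix.map_injective hf
    simp only [Matrix.map_mul, hN, hN', Units.mul_inv, Matrix.map_one f (map_zero f) (map_one f)]
  have h2 : N' * N = 1 := by
    apply Matrix.map_injective hf
    simp only [Matrix.map_mul, hN, hN', Units.inv_mul, Matrix.map_one f (map_zero f) (map_one f)]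
  refine ⟨⟨N, N', h1, h2⟩, ?_⟩
  have h3 : M * D = γ M := by rw [hD]; group
  exact ((congrArg Units.val h3).symm.trans (congrArg (M.1 * ·) hN.symm))

/-- The order of multiplication is preserved because g(h(M)) = g(M B_h) = M B_g B_h, the entries of
B_h being fixed by `g`. -/
lemma exists_mulEquiv_of_matrix {ι E C : Type*} [Fintype ι] [DecidableEq ι] [CommRing C]
    [CommRing E] (f : C →+* E) (hf : Function.Injective f) (M : GL ι E) (Γ : Subgroup (E ≃+* E))
    (hΓ : ∀ g ∈ Γ, ∀ c, g (f c) = f c) (H : Subgroup (GL ι C))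
    (hH : ∀ B : GL ι C, B ∈ H ↔ ∃ g ∈ Γ, M.1.map g = M.1 * B.1.map f)
    (hex : ∀ g ∈ Γ, ∃ B : GL ι C, M.1.map g = M.1 * B.1.map f)
    (hinj : ∀ g ∈ Γ, M.1.map g = M.1 → g = 1) :
    ∃ φ : Γ ≃* H, ∀ g : Γ, M.1.map (g : E ≃+* E) = M.1 * (φ g : GL ι C).1.map f := by
  have hcancel : ∀ B B' : GL ι C, M.1 * B.1.map f = M.1 * B'.1.map f → B = B' := by
    intro B B' h
    exact Units.ext (Matrix.map_injective hf (M.isUnit.mul_left_cancel h))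
  choose β hβ using fun g : Γ => hex g.1 g.2
  have hone : M.1.map ((1 : Γ) : E ≃+* E) = M.1 := rfl
  have hmul : ∀ g h : Γ, β (g * h) = β g * β h := by
    intro g h
    apply hcancel
    have e : M.1.map ((g * h : Γ) : E ≃+* E) = (M.1.map (h : E ≃+* E)).map (g : E ≃+* E) := rfl
    have e' : ((β h).1.map f).map (g : E ≃+* E) = (β h).1.map f := by
      ext i j
      exact hΓ g g.2 _
    rw [← hβ, e, hβ h, Matrix.map_mul, hβ g, e', Units.val_mul, Matrix.map_mul, mul_assoc]
  let φ₀ : Γ →* H := MonoidHom.mk' (fun g => ⟨β g, (hH _).2 ⟨g, g.2, hβ g⟩⟩)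
    (fun g h => Subtype.ext (hmul g h))
  have hbij : Function.Bijective φ₀ := by
    constructor
    · rw [injective_iff_map_eq_one]
      intro g hg
      have hg1 : β g = 1 := congrArg Subtype.val hg
      have := hβ g
      rw [hg1, Units.val_one, Matrix.map_one f (map_zero f) (map_one f), mul_one] at this
      exact Subtype.ext (hinj g g.2 this)
    · rintro ⟨B, hB⟩
      obtain ⟨g, hg, hgB⟩ := (hH B).1 hB
      exact ⟨⟨g, hg⟩, Subtype.ext (hcancel _ _ ((hβ ⟨g, hg⟩).symm.trans hgB))⟩
  exact ⟨MulEquiv.ofBijective φ₀ hbij, hβ⟩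

section Solution

variable {m : ℕ} {k : Type u} [Field k] [Differential k]
  (σ : k ≃+* k) (hσ : ∀ x, σ x′ = (σ x)′) (A : GL (Fin m) k)

/-- The matrix is block triangular with n + 1 diagonal blocks equal to X. -/
lemma det_fundR (n : ℕ) : (fundR σ hσ A n (N := n) le_rfl).det =
    (solX σ hσ A n 0 zero_le).det ^ (n + 1) := by
  have ht : ((fundR σ hσ A n (N := n) le_rfl)ᵀ).BlockTriangular Prod.fst := by
    intro i j hij
    rw [Matrix.transpose_apply, fundR, Matrix.of_apply, Nat.choose_eq_zero_of_lt hij,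
      Nat.cast_zero, zero_mul]
  rw [← Matrix.det_transpose, ht.det_fintype]
  have hb : ∀ i : Fin (n + 1), (((fundR σ hσ A n (N := n) le_rfl)ᵀ).toSquareBlock Prod.fst i).det =
      (solX σ hσ A n 0 zero_le).det := by
    intro i
    let e : Fin m ≃ {p : Fin (n + 1) × Fin m // p.1 = i} :=
      { toFun := fun a => ⟨(i, a), rfl⟩
        invFun := fun p => p.1.2
        left_inv := fun _ => rfl
        right_inv := by rintro ⟨⟨_, a⟩, rfl⟩; rfl }
    rw [← Matrix.det_submatrix_equiv_self e, ← Matrix.det_transpose]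
    congr 1
    ext a b
    simp [e, Matrix.toSquareBlock, Matrix.toSquareBlockProp, fundR, solX]
  rw [Finset.prod_congr rfl fun i _ => hb i, Finset.prod_const, Finset.card_univ, Fintype.card_fin]

/-- The fundamental matrix as an invertible matrix over `F_n C_L`. -/
def fundGL (n : ℕ) : GL (Fin (n + 1) × Fin m) (solRing σ hσ A n) :=
  Matrix.GeneralLinearGroup.mk'' (fundR σ hσ A n (N := n) le_rfl) (by
    rw [det_fundR]
    exact (IsUnit.of_mul_eq_one _ (det_mul_invDet n)).pow _)

lemma fundGL_val (n : ℕ) : (fundGL σ hσ A n).1 = fundMatrix σ hσ A n := rfl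

/-- The isomorphism of `F_N C_L ⊗ C_L` with `F_N C_L`. -/
def ridR (N : ℕ∞) : ringC σ hσ A (constL σ hσ A) N ≃+* solRing σ hσ A N :=
  (Algebra.TensorProduct.rid (constL σ hσ A) (constL σ hσ A) (solRing σ hσ A N)).toRingEquiv

lemma ridR_inclL {N : ℕ∞} (x : solRing σ hσ A N) : ridR σ hσ A N (inclL σ hσ A _ N x) = x := by
  refine (Algebra.TensorProduct.rid_tmul (constL σ hσ A) (1 : constL σ hσ A) x).trans ?_
  exact one_smul _ _

lemma ridR_symm {N : ℕ∞} (x : solRing σ hσ A N) :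
    (ridR σ hσ A N).symm x = inclL σ hσ A (constL σ hσ A) N x := by
  rw [RingEquiv.symm_apply_eq, ridR_inclL]

lemma ridR_inclC {N : ℕ∞} (x : constL σ hσ A) : ridR σ hσ A N (inclC σ hσ A _ N x) =
    algebraMap (constL σ hσ A) (solRing σ hσ A N) x := by
  refine (Algebra.TensorProduct.rid_tmul (constL σ hσ A) x (1 : solRing σ hσ A N)).trans ?_
  exact (Algebra.algebraMap_eq_smul_one x).symm

lemma ridR_symm_algebraMap {N : ℕ∞} (x : constL σ hσ A) :
    inclL σ hσ A (constL σ hσ A) N (algebraMap (constL σ hσ A) (solRing σ hσ A N) x) =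
      inclC σ hσ A (constL σ hσ A) N x := by
  rw [← ridR_symm, RingEquiv.symm_apply_eq, ridR_inclC]

lemma sigmaC_inclL (C : Type u) [Field C] [Algebra (constL σ hσ A) C] {N : ℕ∞}
    (x : solRing σ hσ A N) :
    sigmaC σ hσ A C N (inclL σ hσ A C N x) = inclL σ hσ A C N (sigmaRing σ hσ A N x) := by
  simp [sigmaC, inclL]

/-- Automorphisms are transported in both directions along R_n ⊗ C_L ≅ R_n. -/
lemma mem_groupHn_constL_iff (n : ℕ) (B : GL (Fin (n + 1) × Fin m) (constL σ hσ A)) :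
    B ∈ groupHn σ hσ A (constL σ hσ A) n ↔ ∃ g ∈ autRing σ hσ A n,
      (fundGL σ hσ A n).1.map g = (fundGL σ hσ A n).1 *
        B.1.map (algebraMap (constL σ hσ A) (solRing σ hσ A n)) := by
  have hsub : Function.Injective (inclL σ hσ A (constL σ hσ A) n) := fun x y h => by
    rw [← ridR_inclL σ hσ A x, h, ridR_inclL]
  have hB : (B.1.map (algebraMap (constL σ hσ A) (solRing σ hσ A n))).map
      (inclL σ hσ A (constL σ hσ A) n) = B.1.map (inclC σ hσ A (constL σ hσ A) n) := by
    ext p q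
    exact ridR_symm_algebraMap σ hσ A _
  have hsurj : ∀ x : ringC σ hσ A (constL σ hσ A) n,
      inclL σ hσ A (constL σ hσ A) n (ridR σ hσ A n x) = x := fun x => by
    rw [← ridR_symm, RingEquiv.symm_apply_apply]
  constructor
  · rintro ⟨g, hg, hgB⟩
    let h : solRing σ hσ A (n : ℕ∞) ≃+* solRing σ hσ A (n : ℕ∞) :=
      ((ridR σ hσ A n).symm.trans g).trans (ridR σ hσ A n)
    have hh : ∀ x, inclL σ hσ A (constL σ hσ A) n (h x) =
        g (inclL σ hσ A (constL σ hσ A) n x) := fun x => by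
      have : h x = ridR σ hσ A n (g ((ridR σ hσ A n).symm x)) := rfl
      rw [this, hsurj, ridR_symm]
    refine ⟨h, ⟨?_, ?_⟩, ?_⟩
    · rintro _ ⟨r, rfl⟩
      apply hsub
      rw [hh]
      exact hg.1 _ (inclL_base_mem _ r)
    · rintro _ rfl x
      apply hsub
      rw [hh, ← sigmaC_inclL, ← sigmaC_inclL, hh]
      exact hg.2 _ rfl _
    · apply Matrix.map_injective hsub
      dsimp only
      rw [Matrix.map_mul, hB]
      refine Eq.trans ?_ hgB
      ext p q
      exact hh _
  · rintro ⟨h, hh, hhB⟩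
    let g : ringC σ hσ A (constL σ hσ A) n ≃+* ringC σ hσ A (constL σ hσ A) n :=
      ((ridR σ hσ A n).trans h).trans (ridR σ hσ A n).symm
    have hg : ∀ x, g (inclL σ hσ A (constL σ hσ A) n x) =
        inclL σ hσ A (constL σ hσ A) n (h x) := fun x => by
      have : g (inclL σ hσ A (constL σ hσ A) n x) =
        (ridR σ hσ A n).symm (h (ridR σ hσ A n (inclL σ hσ A (constL σ hσ A) n x))) := rfl
      rw [this, ridR_inclL, ridR_symm]
    have hbase : ∀ r : kConstL σ hσ A,
        h (algebraMap (kConstL σ hσ A) (solRing σ hσ A n) r) = algebraMap _ _ r :=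
      fun r => hh.1 _ ⟨r, rfl⟩
    refine ⟨g, ⟨fun x hx => eq_of_mem_baseC
      (g : ringC σ hσ A (constL σ hσ A) n →+* ringC σ hσ A (constL σ hσ A) n)
      (fun x => ?_) (fun r => ?_) hx, ?_⟩, ?_⟩
    · rw [← ridR_symm_algebraMap]
      refine (hg _).trans (congrArg _ ?_)
      exact hbase (algebraMap (constL σ hσ A) (kConstL σ hσ A) x)
    · exact (hg _).trans (congrArg _ (hbase r))
    · rintro _ rfl x
      rw [← hsurj x, sigmaC_inclL, hg, hg, sigmaC_inclL]
      exact congrArg _ (hh.2 _ rfl _)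
    · rw [← hB, ← fundGL_val, ← Matrix.map_mul, ← hhB]
      ext p q
      exact hg _

lemma algebraMap_solRing_injective (N : ℕ∞) :
    Function.Injective (algebraMap (constL σ hσ A) (solRing σ hσ A N)) := fun _ _ h =>
  Subtype.ext (congrArg (fun z : solRing σ hσ A N => (z : GenField m k)) h)

/-- The Galois group of the prolonged system, as a group of matrices. -/
theorem exists_autRing_equiv (n : ℕ) :
    ∃ φ : autRing σ hσ A n ≃* groupHn σ hσ A (constL σ hσ A) n, ∀ g : autRing σ hσ A n,
      (fundGL σ hσ A n).1.map (g : solRing σ hσ A (n : ℕ∞) ≃+* solRing σ hσ A (n : ℕ∞)) =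
        (fundGL σ hσ A n).1 * (φ g : GL (Fin (n + 1) × Fin m) (constL σ hσ A)).1.map
          (algebraMap (constL σ hσ A) (solRing σ hσ A (n : ℕ∞))) := by
  have hbase : ∀ g ∈ autRing σ hσ A n, ∀ r : kConstL σ hσ A,
      g (algebraMap (kConstL σ hσ A) (solRing σ hσ A n) r) = algebraMap _ _ r :=
    fun g hg r => hg.1 _ ⟨r, rfl⟩
  refine exists_mulEquiv_of_matrix (algebraMap (constL σ hσ A) (solRing σ hσ A (n : ℕ∞)))
    (algebraMap_solRing_injective σ hσ A n) (fundGL σ hσ A n) (autRing σ hσ A n)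
    (fun g hg x => hbase g hg (algebraMap (constL σ hσ A) (kConstL σ hσ A) x)) _
    (mem_groupHn_constL_iff σ hσ A n) (fun g hg => ?_) (fun g hg hg1 => ?_)
  · let P : GL (Fin (n + 1) × Fin m) (solRing σ hσ A n) :=
      Matrix.GeneralLinearGroup.map (algebraMap (kConstL σ hσ A) (solRing σ hσ A n))
        (prolong n (Matrix.GeneralLinearGroup.map (baseToK σ hσ A) A))
    exact exists_matrix_of_fixed (algebraMap (constL σ hσ A) (solRing σ hσ A (n : ℕ∞)))
      (algebraMap_solRing_injective σ hσ A n) (fundGL σ hσ A n) P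
      (g : solRing σ hσ A (n : ℕ∞) →+* solRing σ hσ A (n : ℕ∞))
      (sigmaRing σ hσ A n : solRing σ hσ A (n : ℕ∞) →+* solRing σ hσ A (n : ℕ∞))
      (fun x => hg.2 _ rfl x) (sigmaRing_fundR σ hσ A n le_rfl)
      (by ext p q; exact congrArg Subtype.val (hbase g hg (prolongA σ hσ A n p q)))
      (fun x hx => ⟨⟨x, congrArg Subtype.val hx⟩, Subtype.ext rfl⟩)
  · have : (g : solRing σ hσ A (n : ℕ∞) →+* solRing σ hσ A (n : ℕ∞)) = RingHom.id _ := by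
      refine solRing_hom_ext σ hσ A (hbase g hg) fun j hj a b => ?_
      have hjn : j ≤ n := by exact_mod_cast hj
      have := congrFun (congrFun hg1 (⟨j, Nat.lt_succ_of_le hjn⟩, a)) (0, b)
      rw [Matrix.map_apply, fundGL, Matrix.GeneralLinearGroup.val_mk'',
        fundR_zero_right σ hσ A n le_rfl _ a b hj] at this
      exact this
    exact RingEquiv.ext fun x => congrArg (fun φ => φ x) this

end Solution

section Solution

variable {m : ℕ} {k : Type u} [Field k] [Differential k]
  (σ : k ≃+* k) (hσ : ∀ x, σ x′ = (σ x)′) (A : GL (Fin m) k)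

/-! ### Automorphisms of the field `L` -/

lemma algebraMap_mem_solRing (p : DiffPoly m k) :
    algebraMap (DiffPoly m k) (GenField m k) p ∈ solRing σ hσ A ⊤ := by
  induction p using MvPolynomial.induction_on with
  | C x => exact base_mem_solRing ⊤ x
  | add p q hp hq => rw [map_add]; exact add_mem hp hq
  | mul_X p v hp => rw [map_mul]; exact mul_mem hp (X_mem_solRing le_top v.2.1 v.2.2)

instance : IsFractionRing (solRing σ hσ A ⊤) (GenField m k) := by
  have : FaithfulSMul (solRing σ hσ A ⊤) (GenField m k) :=
    (faithfulSMul_iff_algebraMap_injective _ _).2 Subtype.val_injective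
  refine IsFractionRing.of_field _ _ fun z => ?_
  obtain ⟨p, q, -, rfl⟩ := IsFractionRing.div_surjective (DiffPoly m k) z
  exact ⟨⟨_, algebraMap_mem_solRing σ hσ A p⟩, ⟨_, algebraMap_mem_solRing σ hσ A q⟩, rfl⟩

lemma field_hom_ext {S : Type*} [CommRing S] {f g : GenField m k →+* S}
    (h : ∀ x : solRing σ hσ A ⊤, f x = g x) : f = g :=
  IsLocalization.ringHom_ext (nonZeroDivisors (solRing σ hσ A ⊤)) (RingHom.ext h)

/-- An automorphism of `R` over `k C_L` extends to `L`. -/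
lemma exists_mem_autL (h : solRing σ hσ A ⊤ ≃+* solRing σ hσ A ⊤)
    (hbase : ∀ r : kConstL σ hσ A, h (algebraMap _ _ r) = algebraMap _ _ r)
    (hs : ∀ x, h (sigmaRing σ hσ A ⊤ x) = sigmaRing σ hσ A ⊤ (h x)) (hd : ∀ x, h x′ = (h x)′) :
    ∃ g ∈ autL σ hσ A, ∀ x : solRing σ hσ A ⊤, g x = h x := by
  let g : GenField m k ≃+* GenField m k := IsFractionRing.ringEquivOfRingEquiv h
  have hg : ∀ x : solRing σ hσ A ⊤, g x = h x := fun x =>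
    IsFractionRing.ringEquivOfRingEquiv_algebraMap h x
  refine ⟨g, ⟨fun x hx => ?_, ?_⟩, hg⟩
  · exact (hg (algebraMap (kConstL σ hσ A) _ ⟨x, hx⟩)).trans (congrArg Subtype.val (hbase ⟨x, hx⟩))
  · rintro _ (rfl | rfl) x
    · have : (g : GenField m k →+* GenField m k).comp (sigmaL σ hσ A : GenField m k →+* _) =
          (sigmaL σ hσ A : GenField m k →+* GenField m k).comp (g : GenField m k →+* _) := by
        refine field_hom_ext σ hσ A fun x => ?_
        change g (sigmaL σ hσ A x) = sigmaL σ hσ A (g x)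
        rw [hg]
        exact (hg (sigmaRing σ hσ A ⊤ x)).trans (congrArg Subtype.val (hs x))
      exact congrArg (fun φ => φ x) this
    · refine ringHom_dual_ext (f := (g : GenField m k →+* GenField m k)) ?_ x
      refine field_hom_ext σ hσ A fun x => ?_
      apply TrivSqZeroExt.ext
      · simp [dualOfDeriv]
      · have : g (x : GenField m k)′ = (g x)′ := by
          rw [hg]
          exact (hg x′).trans (congrArg Subtype.val (hd x))
        simp [dualOfDeriv, this]

variable {σ hσ A} in
lemma autL_apply_base {g : GenField m k ≃+* GenField m k} (hg : g ∈ autL σ hσ A)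
    (r : kConstL σ hσ A) : g r = r := hg.1 _ r.2

variable {σ hσ A} in
lemma autL_apply_const {g : GenField m k ≃+* GenField m k} (hg : g ∈ autL σ hσ A)
    (x : constL σ hσ A) : g x = x :=
  hg.1 _ ((kConstL σ hσ A).algebraMap_mem x)

/-- One direction transports an automorphism to R and extends it to the fraction field L. The other
does not restrict `g` to R: as a K-algebra map of L, `g` preserves all relations, which is enough by
`mem_groupH_iff`. -/
lemma mem_groupH_constL_iff (B : GL (Fin m) (constL σ hσ A)) :
    B ∈ groupH σ hσ A (constL σ hσ A) ↔ ∃ g ∈ autL σ hσ A,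
      (XL m k).1.map g = (XL m k).1 * B.1.map (algebraMap (constL σ hσ A) (GenField m k)) := by
  constructor
  · rintro ⟨g, hg, hgB⟩
    have hsub : Function.Injective (inclL σ hσ A (constL σ hσ A) ⊤) := fun x y h => by
      rw [← ridR_inclL σ hσ A x, h, ridR_inclL]
    let h : solRing σ hσ A ⊤ ≃+* solRing σ hσ A ⊤ :=
      ((ridR σ hσ A ⊤).symm.trans g).trans (ridR σ hσ A ⊤)
    have hh : ∀ x, inclL σ hσ A (constL σ hσ A) ⊤ (h x) =
        g (inclL σ hσ A (constL σ hσ A) ⊤ x) := fun x => by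
      have : h x = ridR σ hσ A ⊤ (g ((ridR σ hσ A ⊤).symm x)) := rfl
      rw [this, ← ridR_symm, RingEquiv.symm_apply_apply, ridR_symm]
    obtain ⟨f, hf, hfh⟩ := exists_mem_autL σ hσ A h
      (fun r => hsub ((hh _).trans (hg.1 _ (inclL_base_mem _ r))))
      (fun x => hsub (by
        rw [hh, ← sigmaC_inclL, ← sigmaC_inclL, hh]
        exact hg.2 _ (Or.inl rfl) _))
      (fun x => hsub (by
        rw [hh, ← deriv_inclL, ← deriv_inclL, hh]
        exact hg.2 _ (Or.inr rfl) (inclL σ hσ A (constL σ hσ A) ⊤ x)))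
    refine ⟨f, hf, ?_⟩
    have h1 : (solX σ hσ A ⊤ 0 le_top).map h = solX σ hσ A ⊤ 0 le_top *
        B.1.map (algebraMap (constL σ hσ A) (solRing σ hσ A ⊤)) := by
      apply Matrix.map_injective hsub
      dsimp only
      have hB : (B.1.map (algebraMap (constL σ hσ A) (solRing σ hσ A ⊤))).map
          (inclL σ hσ A (constL σ hσ A) ⊤) = B.1.map (inclC σ hσ A (constL σ hσ A) ⊤) := by
        ext p q
        exact ridR_symm_algebraMap σ hσ A _
      rw [Matrix.map_mul, hB]
      refine Eq.trans ?_ hgB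
      ext p q
      exact hh _
    have h2 := congrArg (fun Z : Matrix (Fin m) (Fin m) (solRing σ hσ A ⊤) =>
      Z.map (solRing σ hσ A ⊤).val) h1
    simp only [Matrix.map_mul] at h2
    refine Eq.trans ?_ h2
    ext a b
    exact hfh (solX σ hσ A ⊤ 0 le_top a b)
  · rintro ⟨g, hg, hgB⟩
    rw [mem_groupH_iff]
    intro n
    let iL : GenField m k →ₐ[kConstL σ hσ A] GenField m k ⊗[constL σ hσ A] (constL σ hσ A) :=
      Algebra.TensorProduct.includeLeft
    let gK : GenField m k →ₐ[kConstL σ hσ A] GenField m k :=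
      { (g : GenField m k →+* GenField m k) with commutes' := autL_apply_base hg }
    have h1 : (jetX m k n).map g = jetX m k n *
        (prolong n B).1.map (algebraMap (constL σ hσ A) (GenField m k)) := by
      have e1 := prolongMatrix_map (g : GenField m k →+* GenField m k)
        (fun x => hg.2 _ (Or.inr rfl) x) n (GenField.X m k 0)
      have e2 := prolongMatrix_map (algebraMap (constL σ hσ A) (GenField m k))
        (fun x => (deriv_algebraMap x).symm) n B.1
      refine e1.symm.trans ((congrArg (prolongMatrix n) hgB).trans ?_)
      rw [prolongMatrix_mul, e2]
      rfl
    have h2 : translate σ hσ A (constL σ hσ A) (jetX m k n) (prolong n B).1 =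
        ((jetX m k n).map g).map iL := by
      rw [h1, Matrix.map_mul, translate]
      congr 1
      ext p q
      exact ((Algebra.TensorProduct.includeRight : constL σ hσ A →ₐ[constL σ hσ A]
        GenField m k ⊗[constL σ hσ A] (constL σ hσ A)).commutes ((prolong n B).1 p q)).trans
        ((Algebra.TensorProduct.includeLeft : GenField m k →ₐ[constL σ hσ A]
          GenField m k ⊗[constL σ hσ A] (constL σ hσ A)).commutes ((prolong n B).1 p q)).symm
    rw [IsTranslation, h2, isSpec_iff]
    intro f hf
    have := MvPolynomial.comp_aeval_apply (fun v : (Fin (n + 1) × Fin m) × (Fin (n + 1) × Fin m) =>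
      jetX m k n v.1 v.2) (iL.comp gK) f
    rw [hf, map_zero] at this
    exact this.symm

/-- The Galois group of the system, as a group of matrices. -/
theorem exists_autL_equiv :
    ∃ φ : autL σ hσ A ≃* groupH σ hσ A (constL σ hσ A), ∀ g : autL σ hσ A,
      (XL m k).1.map (g : GenField m k ≃+* GenField m k) =
        (XL m k).1 * (φ g : GL (Fin m) (constL σ hσ A)).1.map
          (algebraMap (constL σ hσ A) (GenField m k)) := by
  have hinj : Function.Injective (algebraMap (constL σ hσ A) (GenField m k)) :=
    Subtype.val_injective
  refine exists_mulEquiv_of_matrix (algebraMap (constL σ hσ A) (GenField m k)) hinj (XL m k)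
    (autL σ hσ A) (fun g hg x => autL_apply_const hg x) _ (mem_groupH_constL_iff σ hσ A)
    (fun g hg => ?_) (fun g hg hg1 => ?_)
  · refine exists_matrix_of_fixed (algebraMap (constL σ hσ A) (GenField m k)) hinj (XL m k)
      (Matrix.GeneralLinearGroup.map (algebraMap k (GenField m k)) A)
      (g : GenField m k →+* GenField m k) (sigmaL σ hσ A : GenField m k →+* GenField m k)
      (fun x => hg.2 _ (Or.inl rfl) x) (sigmaL_X σ hσ A) ?_ (fun x hx => ⟨⟨x, hx⟩, rfl⟩)
    ext a b
    exact autL_apply_base hg (baseToK σ hσ A (A.1 a b))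
  · have : (g : GenField m k →+* GenField m k) = RingHom.id _ := by
      refine field_hom_ext σ hσ A fun x => ?_
      have h : (g : GenField m k →+* GenField m k).comp
          (solRing σ hσ A ⊤).val.toRingHom = (solRing σ hσ A ⊤).val.toRingHom := by
        refine solRing_hom_ext σ hσ A (autL_apply_base hg) fun j hj a b => ?_
        change (g : GenField m k →+* GenField m k) (GenField.X m k j a b) = GenField.X m k j a b
        -- Fixing X and commuting with the derivation forces `g` to fix every X^{(j)}.
        rw [X_iterate, map_iterate_deriv (g : GenField m k →+* GenField m k)
          (fun x => hg.2 _ (Or.inr rfl) x)]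
        exact congrArg _ (congrFun (congrFun hg1 a) b)
      exact congrArg (fun φ => φ x) h
    exact RingEquiv.ext fun x => congrArg (fun φ => φ x) this

end Solution

/-! ### The embeddings of the Galois group into the groups of the prolonged systems -/

lemma prolong_injective {m : ℕ} {S : Type*} [CommRing S] [Differential S] (n : ℕ) :
    Function.Injective (prolong n : GL (Fin m) S →* GL (Fin (n + 1) × Fin m) S) := by
  intro B B' h
  ext a b
  have := congrArg (fun Z : GL (Fin (n + 1) × Fin m) S => Z.1 (0, a) (0, b)) h
  simpa [prolong, prolongMatrix] using this

lemma exists_prolong_hom {m : ℕ} {k : Type u} [Field k] [Differential k]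
    (σ : k ≃+* k) (hσ : ∀ x, σ x′ = (σ x)′) (A : GL (Fin m) k) (C : Type u) [Field C]
    [Differential C] [Algebra (constL σ hσ A) C] [DifferentialAlgebra (constL σ hσ A) C] (n : ℕ) :
    ∃ i : groupH σ hσ A C →* groupHn σ hσ A C n, Function.Injective i ∧
      ∀ B : groupH σ hσ A C, (i B : GL (Fin (n + 1) × Fin m) C) = prolong n B :=
  ⟨((prolong n).comp (groupH σ hσ A C).subtype).codRestrict _ fun B =>
      mem_groupHn_iff.2 (mem_groupH_iff.1 B.2 n),
    fun _ _ h => Subtype.ext (prolong_injective n (congrArg Subtype.val h)), fun _ => rfl⟩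

end DiffGalois

end

theorem mainTheorem5 {k : Type u} [Field k] [CharZero k] [Differential k]
    (σ : k ≃+* k) (hσ : ∀ x : k, σ x′ = (σ x)′)
    (hk : ∀ x : k, IsAlgebraic (fixedSubfield σ) x → x ∈ fixedSubfield σ)
    (m : ℕ) (A : GL (Fin m) k) :
    -- the `C_L`-points of `ℍ` and of `ℍ_n` are the Galois groups
    (∃ φ : autL σ hσ A ≃* groupH σ hσ A (constL σ hσ A),
      ∀ g : autL σ hσ A, (GenField.X m k 0).map (g : GenField m k ≃+* GenField m k) =
        GenField.X m k 0 * (((φ g : GL (Fin m) (constL σ hσ A)) :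
          Matrix (Fin m) (Fin m) (constL σ hσ A)).map (algebraMap (constL σ hσ A) (GenField m k)))) ∧
    (∀ n : ℕ, ∃ φ : autRing σ hσ A n ≃* groupHn σ hσ A (constL σ hσ A) n,
      ∀ g : autRing σ hσ A n,
        (fundMatrix σ hσ A n).map (g : solRing σ hσ A (n : ℕ∞) ≃+* solRing σ hσ A (n : ℕ∞)) =
        fundMatrix σ hσ A n *
          (((φ g : GL (Fin (n + 1) × Fin m) (constL σ hσ A)) :
            Matrix (Fin (n + 1) × Fin m) (Fin (n + 1) × Fin m) (constL σ hσ A)).map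
              (algebraMap (constL σ hσ A) (solRing σ hσ A (n : ℕ∞))))) ∧
    -- `ℍ` is defined by the groups `ℍ_n`
    (∀ (C : Type u) [Field C] [Differential C] [Algebra (constL σ hσ A) C]
      [DifferentialAlgebra (constL σ hσ A) C] (B : GL (Fin m) C),
      B ∈ groupH σ hσ A C ↔ ∀ n : ℕ, prolong n B ∈ groupHn σ hσ A C n) ∧
    -- finitely many `n` suffice
    (∃ n₀ : ℕ, ∀ (C : Type u) [Field C] [Differential C] [Algebra (constL σ hσ A) C]
      [DifferentialAlgebra (constL σ hσ A) C] (B : GL (Fin m) C),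
      B ∈ groupH σ hσ A C ↔ ∀ n : ℕ, n ≤ n₀ → prolong n B ∈ groupHn σ hσ A C n) ∧
    -- the maps `i_n` are embeddings of groups, with Zariski dense image
    (∀ (C : Type u) [Field C] [Differential C] [Algebra (constL σ hσ A) C]
      [DifferentialAlgebra (constL σ hσ A) C] (n : ℕ),
      (∃ i : groupH σ hσ A C →* groupHn σ hσ A C n, Function.Injective i ∧
        ∀ B : groupH σ hσ A C, (i B : GL (Fin (n + 1) × Fin m) C) = prolong n B) ∧
      (IsDifferentiallyClosed C →
        IsZariskiDenseIn (prolong n '' (groupH σ hσ A C : Set (GL (Fin m) C)))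
          (groupHn σ hσ A C n : Set (GL (Fin (n + 1) × Fin m) C)))) := by
  obtain ⟨n₀, hn₀⟩ := exists_bound_isTranslation σ hσ A
  refine ⟨exists_autL_equiv σ hσ A, exists_autRing_equiv σ hσ A, fun C _ _ _ _ B => ?_,
    ⟨n₀, fun C _ _ _ _ B => ?_⟩, fun C _ _ _ _ n =>
    ⟨exists_prolong_hom σ hσ A C n, fun hC => isZariskiDenseIn_groupH σ hσ A C hC n⟩⟩
  · exact mem_groupH_iff.trans (forall_congr' fun n => mem_groupHn_iff.symm)
  -- For the converse, the single condition at `n₀` already suffices.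
  · exact ⟨fun hB n _ => mem_groupHn_iff.2 (mem_groupH_iff.1 hB n), fun hB =>
      mem_groupH_iff.2 (hn₀ C B (mem_groupHn_iff.1 (hB n₀ le_rfl)))⟩
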